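/- **Setting.** Let $d_X,d_Y\ge 1$, let $\mathcal X\subset\mathbb R^{d_X}$, $\mathcal Y\subset\mathbb R^{d_Y}$ be compact convex with diameters at most $D_{\mathcal X},D_{\mathcal Y}$, and let $f(x,y)=\mathbf E_\xi[F(x,y,\xi)]$ for $(x,y)\in\mathbb R^{d_X}\times\mathbb R^{d_Y}$, with $F(x,y,\cdot)$ integrable. Almost surely: $F(\cdot,\cdot,\xi)$ is $C^1$; on $\mathcal X\times\mathcal Y$ it is $\mu_X$-strongly convex in $x$, $\mu_Y$-strongly concave in $y$ ($\mu_X,\mu_Y>0$), $L_X$-Lipschitz in $x$ and $L_Y$-Lipschitz in $y$, $\nabla_xF$ is $L_{XY}$-Lipschitz in $y$ and $\nabla_yF$ is $L_{YX}$-Lipschitz in $x$; $\nabla_xF(\cdot,y,\xi)$ is $L_{GX}$-Lipschitz on $\mathbb R^{d_X}$ for $y\in\mathcal Y$ and $\nabla_yF(x,\cdot,\xi)$ is $L_{GY}$-Lipschitz on $\mathbb R^{d_Y}$ for $x\in\mathcal X$. On $\mathcal X\times\mathcal Y$ the gradients satisfy $\mathbf E\nabla_xF=\nabla_xf$, $\mathbf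 E\nabla_yF=\nabla_yf$, $\mathbf E\|\nabla_xF-\nabla_xf\|^2\le\sigma^2$ and $\mathbf E\|\nabla_yF-\nabla_yf\|^2\le\sigma^2$. Let $(x^*,y^*)$ be the saddle point of $f$ on $\mathcal X\times\mathcal Y$, assumed interior, with distances $\delta_{\mathcal X},\delta_{\mathcal Y}$ of $x^*,y^*$ to $\partial\mathcal X,\partial\mathcal Y$. Put $L_G=\max(L_{GX},L_{GY})$, $\delta_\mu=\sqrt{\min(\mu_X\delta_{\mathcal X}^2,\mu_Y\delta_{\mathcal Y}^2)}$, $C_1=\tfrac12L_G(D_{\mathcal X}^2+D_{\mathcal Y}^2)$, $B_X=\max\{\sqrt{L_X^2+\sigma^2}/L_{GX},1\}$, $B_Y=\max\{\sqrt{L_Y^2+\sigma^2}/L_{GY},1\}$, $$C_0=1-\frac{\sqrt2}{\delta_\mu}\max\Big\{\frac{D_{\mathcal X}L_{XY}}{\sqrt{\mu_Y}},\frac{D_{\mathcal Y}L_{YX}}{\sqrt{\mu_X}}\Big\},$$ and assume $C_0>0$. For $z=(x,y)$ let $w(z)=f(x,y^*)-f(x^*,y)$ be the merit function, $\widehat g(z)=\max_{(u,v)\in\mathcal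 X\times\mathcal Y}\{\langle\nabla_xf(z),x-u\rangle-\langle\nabla_yf(z),y-v\rangle\}$ the Frank–Wolfe gap, and $\max_{(u,v)\in\mathcal X\times\mathcal Y}\{f(x,v)-f(u,y)\}$ the Nash gap. **Method.** From a deterministic $z_0\in\mathcal X\times\mathcal Y$, iteration $k=1,2,\dots$ forms, at $z_{k-1}=(x,y)$, $$\bar G^x_k=\frac1{m^X_k}\sum_{j=1}^{m_k^X}\frac{F(x+\nu_Xu_{j},y,\xi_j)-F(x,y,\xi_j)}{\nu_X}u_j,\qquad \bar G^y_k=\frac1{m^Y_k}\sum_{j=1}^{m_k^Y}\frac{F(x,y+\nu_Yu'_{j},\xi'_j)-F(x,y,\xi'_j)}{\nu_Y}u'_j$$ with fresh independent standard Gaussian directions $u_j,u_j'$ and fresh independent oracle noises $\xi_j,\xi'_j$; with $\bar G_k=(\bar G_k^x,-\bar G_k^y)$ it calls a (measurable) linear optimization oracle for some $s_k\in\arg\min_{s\in\mathcal X\times\mathcal Y}\langle s,\bar G_k\rangle$, sets $g_{k-1}=\langle-\bar G_k,s_k-z_{k-1}\rangle$ and $z_k=(1-\gamma_k)z_{k-1}+\gamma_ks_k$.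 An iteration costs $2(m_k^X+m_k^Y)$ zeroth-order calls (single function evaluations) and one linear-oracle call. Below, $K$ and $\varepsilon_0$ denote positive constants depending only on $\mu_X,\mu_Y,L_X,L_Y,L_{GX},L_{GY},L_{XY},L_{YX},\sigma,D_{\mathcal X},D_{\mathcal Y},\delta_{\mathcal X},\delta_{\mathcal Y}$, not on $d_X,d_Y$ or $\varepsilon$. **(a) Non-adaptive step.** For $N\ge1$ let $\gamma_k=\frac6{5+k}$, $m_k^X=\lceil B_X(d_X+5)N^2\rceil$, $m_k^Y=\lceil B_Y(d_Y+5)N^2\rceil$, $\nu_X=\sqrt{\tfrac{B_X}{2N^2(d_X+6)^3}}$, $\nu_Y=\sqrt{\tfrac{B_Y}{2N^2(d_Y+6)^3}}$, and let $R\in\{1,\dots,N\}$ be independent of the samples with $P(R=k)=\frac{\gamma_k\Gamma_N}{2\Gamma_k(1-\Gamma_N)}$, $\Gamma_k=\prod_{i=1}^k(1-\gamma_i/2)$. Then $w(z_N)$ and $\widehat g(z_R)$ are integrable and $$\mathbf E[w(z_N)]+\mathbf E[\widehat g(z_R)]\le\frac{120\,w(z_0)}{(N+3)^3}+\frac{18L_G(D_{\mathcal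 X}^2+D_{\mathcal Y}^2)}{C_0(N+5)}+\frac{11(L_{GX}B_X+L_{GY}B_Y)}{2NC_0}.$$ Moreover there is $K$ such that for every $\varepsilon\in(0,1]$ some $N\ge 1$, the same for all problems with the given constants, ensures $\mathbf E[w(z_N)]+\mathbf E[\widehat g(z_R)]\le\varepsilon$ and an expected Nash gap of $z_R$ of at most $\varepsilon$, with at most $K(d_X+d_Y)/\varepsilon^3$ zeroth-order calls and at most $K/\varepsilon$ linear-oracle calls. **(b) Adaptive step.** Let $\gamma_k=\min\{\frac{C_0}{4C_1}g_{k-1},1\}$ and $\rho=\min\{\frac{C_0^2\delta_\mu^2}{8C_1},\frac{C_0}2\}$. For constant batch sizes $m^X,m^Y\ge1$ and $\nu_X,\nu_Y>0$ put $V_X=\frac{4(d_X+5)(L_X^2+\sigma^2)}{m^X}+\frac{3\nu_X^2}2L_{GX}^2(d_X+6)^3$, define $V_Y$ likewise, and $$C_2=\frac{D_{\mathcal X}^2V_X+D_{\mathcal Y}^2V_Y}{4C_1},\qquad C_3=\frac{C_0}2\big(D_{\mathcal X}\sqrt{V_X}+D_{\mathcal Y}\sqrt{V_Y}\big),\qquad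 C_4=\frac{V_X+V_Y}{L_G}.$$ Then for every $k\ge0$, $w(z_k)$ is integrable and $$\mathbf E[w(z_k)]\le(1-\rho)^k\Big[w(z_0)-\tfrac1\rho(\max\{C_2,C_3\}+C_4)\Big]+\tfrac1\rho(\max\{C_2,C_3\}+C_4).$$ Moreover there are $K$ and $\varepsilon_0\in(0,\frac12]$ such that for every $\varepsilon\in(0,\varepsilon_0]$ there is an $N\ge1$, the same for all problems with the given constants, for which, with $\nu_X=\sqrt{\tfrac{B_X\varepsilon^2}{2(d_X+6)^3}}$ and $\nu_Y=\sqrt{\tfrac{B_Y\varepsilon^2}{2(d_Y+6)^3}}$: * with $m^X=\lceil B_X(d_X+5)/\varepsilon^2\rceil$, $m^Y=\lceil B_Y(d_Y+5)/\varepsilon^2\rceil$, the output satisfies $\mathbf E[w(z_N)]\le\varepsilon$, with at most $K\log(1/\varepsilon)$ linear-oracle calls and at most $K\frac{d_X+d_Y}{\varepsilon^2}\log(1/\varepsilon)$ zeroth-order calls; * with $m^X=\big\lceil\frac{B_X(d_X+5)}{\varepsilon^2\log(1/\varepsilon)}\big\rceil$, $m^Y=\big\lceil\frac{B_Y(d_Y+5)}{\varepsilon^2\log(1/\varepsilon)}\big\rceil$,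 the output satisfies $\mathbf E[w(z_N)]\le\varepsilon$, with at most $K\log(1/\varepsilon)$ linear-oracle calls and at most $K\frac{d_X+d_Y}{\varepsilon^2}$ zeroth-order calls. -/

import Mathlib

open MeasureTheory ProbabilityTheory

universe u v

noncomputable section

/-- `d`-dimensional Euclidean space. -/
abbrev Euc (d : ℕ) : Type := EuclideanSpace ℝ (Fin d)

/-- The scalar constants of a problem: strong convexity / concavity moduli, Lipschitz constants of the
function (`LX`, `LY`), of the partial gradients in their own variable (`LGX`, `LGY`) and in the other
variable (`LXY`, `LYX`), the standard deviation bound `σ` of the gradient noise, the diameter bounds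
`DX`, `DY`, and the border distances `δX`, `δY`. -/
structure Constants where
  μX : ℝ
  μY : ℝ
  LX : ℝ
  LY : ℝ
  LGX : ℝ
  LGY : ℝ
  LXY : ℝ
  LYX : ℝ
  σ : ℝ
  DX : ℝ
  DY : ℝ
  δX : ℝ
  δY : ℝ

namespace Constants

variable (c : Constants)

def LG : ℝ := max c.LGX c.LGY

def δμ : ℝ := √(min (c.μX * c.δX ^ 2) (c.μY * c.δY ^ 2))

def C0 : ℝ := 1 - √2 / c.δμ * max (c.DX * c.LXY / √c.μY) (c.DY * c.LYX / √c.μX)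

def C1 : ℝ := (c.LG * c.DX ^ 2 + c.LG * c.DY ^ 2) / 2

def BX : ℝ := max (√(c.LX ^ 2 + c.σ ^ 2) / c.LGX) 1

def BY : ℝ := max (√(c.LY ^ 2 + c.σ ^ 2) / c.LGY) 1

/-- Bound on the mean square error of the `x`-gradient estimator with batch size `m` and smoothing
parameter `ν` in dimension `d`. -/
def errX (d m : ℕ) (ν : ℝ) : ℝ :=
  4 * (d + 5) * (c.LX ^ 2 + c.σ ^ 2) / m + 3 * ν ^ 2 / 2 * c.LGX ^ 2 * (d + 6) ^ 3

/-- Bound on the mean square error of the `y`-gradient estimator. -/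
def errY (d m : ℕ) (ν : ℝ) : ℝ :=
  4 * (d + 5) * (c.LY ^ 2 + c.σ ^ 2) / m + 3 * ν ^ 2 / 2 * c.LGY ^ 2 * (d + 6) ^ 3

def C2 (dX dY mX mY : ℕ) (νX νY : ℝ) : ℝ :=
  1 / (4 * c.C1) * c.DX ^ 2 * c.errX dX mX νX + 1 / (4 * c.C1) * c.DY ^ 2 * c.errY dY mY νY

def C3 (dX dY mX mY : ℕ) (νX νY : ℝ) : ℝ :=
  c.C0 * c.DX / 2 * √(c.errX dX mX νX) + c.C0 * c.DY / 2 * √(c.errY dY mY νY)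

def C4 (dX dY mX mY : ℕ) (νX νY : ℝ) : ℝ :=
  (c.errX dX mX νX + c.errY dY mY νY) / c.LG

/-- The geometric rate of the adaptive method. -/
def ρ : ℝ := min (c.C0 ^ 2 * c.δμ ^ 2 / (8 * c.C1)) (c.C0 / 2)

end Constants

/-- An offline stochastic saddle-point problem
`min_{x ∈ X} max_{y ∈ Y} f x y`, `f x y = 𝔼_ξ [F x y ξ]`, with constants `c`. -/
structure SaddleProblem (c : Constants) where
  dX : ℕ
  dY : ℕ
  dX_pos : 0 < dX
  dY_pos : 0 < dY
  X : Set (Euc dX)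
  Y : Set (Euc dY)
  convex_X : Convex ℝ X
  convex_Y : Convex ℝ Y
  compact_X : IsCompact X
  compact_Y : IsCompact Y
  dist_X : ∀ x₁ ∈ X, ∀ x₂ ∈ X, ‖x₁ - x₂‖ ≤ c.DX
  dist_Y : ∀ y₁ ∈ Y, ∀ y₂ ∈ Y, ‖y₁ - y₂‖ ≤ c.DY
  /-- the space of the noise variable `ξ` and its law -/
  Ξ : Type u
  [mΞ : MeasurableSpace Ξ]
  P : Measure Ξ
  [probP : IsProbabilityMeasure P]
  /-- the value `F x y ξ` returned by the stochastic zeroth-order oracle -/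
  F : Euc dX → Euc dY → Ξ → ℝ
  measurable_F : Measurable fun q : Euc dX × Euc dY × Ξ => F q.1 q.2.1 q.2.2
  integrable_F : ∀ x y, Integrable (F x y) P
  -- smoothness, strong convexity and strong concavity
  contDiff_F : ∀ᵐ ξ ∂P, ContDiff ℝ 1 fun z : Euc dX × Euc dY => F z.1 z.2 ξ
  μX_pos : 0 < c.μX
  μY_pos : 0 < c.μY
  strongConvex : ∀ᵐ ξ ∂P, ∀ y ∈ Y, StrongConvexOn X c.μX fun x => F x y ξ
  strongConcave : ∀ᵐ ξ ∂P, ∀ x ∈ X, StrongConcaveOn Y c.μY fun y => F x y ξ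
  -- Lipschitz continuity of the function on the domain
  lipschitz_X : ∀ᵐ ξ ∂P, ∀ x₁ ∈ X, ∀ x₂ ∈ X, ∀ y ∈ Y, |F x₁ y ξ - F x₂ y ξ| ≤ c.LX * ‖x₁ - x₂‖
  lipschitz_Y : ∀ᵐ ξ ∂P, ∀ x ∈ X, ∀ y₁ ∈ Y, ∀ y₂ ∈ Y, |F x y₁ ξ - F x y₂ ξ| ≤ c.LY * ‖y₁ - y₂‖
  -- Lipschitz gradients; the oracle is queried outside the domain, hence `x₁ x₂` and `y₁ y₂` are free
  lipGrad_X : ∀ᵐ ξ ∂P, ∀ x₁ x₂, ∀ y ∈ Y,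
    ‖gradient (fun x => F x y ξ) x₁ - gradient (fun x => F x y ξ) x₂‖ ≤ c.LGX * ‖x₁ - x₂‖
  lipGrad_Y : ∀ᵐ ξ ∂P, ∀ x ∈ X, ∀ y₁ y₂,
    ‖gradient (fun y => F x y ξ) y₁ - gradient (fun y => F x y ξ) y₂‖ ≤ c.LGY * ‖y₁ - y₂‖
  -- Lipschitz partial gradients in the other variable
  lipGrad_XY : ∀ᵐ ξ ∂P, ∀ x ∈ X, ∀ y₁ ∈ Y, ∀ y₂ ∈ Y,
    ‖gradient (fun x' => F x' y₁ ξ) x - gradient (fun x' => F x' y₂ ξ) x‖ ≤ c.LXY * ‖y₁ - y₂‖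
  lipGrad_YX : ∀ᵐ ξ ∂P, ∀ x₁ ∈ X, ∀ x₂ ∈ X, ∀ y ∈ Y,
    ‖gradient (fun y' => F x₁ y' ξ) y - gradient (fun y' => F x₂ y' ξ) y‖ ≤ c.LYX * ‖x₁ - x₂‖
  -- unbiased gradients of bounded variance
  integrable_gradX : ∀ x ∈ X, ∀ y ∈ Y, Integrable (fun ξ => gradient (fun x' => F x' y ξ) x) P
  integrable_gradY : ∀ x ∈ X, ∀ y ∈ Y, Integrable (fun ξ => gradient (fun y' => F x y' ξ) y) P
  unbiased_gradX : ∀ x ∈ X, ∀ y ∈ Y,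
    ∫ ξ, gradient (fun x' => F x' y ξ) x ∂P = gradient (fun x' => ∫ ξ, F x' y ξ ∂P) x
  unbiased_gradY : ∀ x ∈ X, ∀ y ∈ Y,
    ∫ ξ, gradient (fun y' => F x y' ξ) y ∂P = gradient (fun y' => ∫ ξ, F x y' ξ ∂P) y
  integrable_varX : ∀ x ∈ X, ∀ y ∈ Y, Integrable (fun ξ =>
    ‖gradient (fun x' => F x' y ξ) x - gradient (fun x' => ∫ ξ', F x' y ξ' ∂P) x‖ ^ 2) P
  integrable_varY : ∀ x ∈ X, ∀ y ∈ Y, Integrable (fun ξ =>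
    ‖gradient (fun y' => F x y' ξ) y - gradient (fun y' => ∫ ξ', F x y' ξ' ∂P) y‖ ^ 2) P
  variance_X : ∀ x ∈ X, ∀ y ∈ Y,
    ∫ ξ, ‖gradient (fun x' => F x' y ξ) x - gradient (fun x' => ∫ ξ', F x' y ξ' ∂P) x‖ ^ 2 ∂P
      ≤ c.σ ^ 2
  variance_Y : ∀ x ∈ X, ∀ y ∈ Y,
    ∫ ξ, ‖gradient (fun y' => F x y' ξ) y - gradient (fun y' => ∫ ξ', F x y' ξ' ∂P) y‖ ^ 2 ∂P
      ≤ c.σ ^ 2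
  /-- the saddle point `(xs, ys)`, interior to the domain -/
  xs : Euc dX
  ys : Euc dY
  xs_mem : xs ∈ interior X
  ys_mem : ys ∈ interior Y
  saddle_X : ∀ x ∈ X, ∫ ξ, F xs ys ξ ∂P ≤ ∫ ξ, F x ys ξ ∂P
  saddle_Y : ∀ y ∈ Y, ∫ ξ, F xs y ξ ∂P ≤ ∫ ξ, F xs ys ξ ∂P
  border_X : Metric.infDist xs (frontier X) = c.δX
  border_Y : Metric.infDist ys (frontier Y) = c.δY

attribute [instance] SaddleProblem.mΞ SaddleProblem.probP

namespace SaddleProblem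

variable {c : Constants} (p : SaddleProblem.{u} c)

/-- Points `z = (x, y)`. -/
abbrev Point : Type := Euc p.dX × Euc p.dY

/-- The objective `f x y = 𝔼_ξ [F x y ξ]`. -/
def f (x : Euc p.dX) (y : Euc p.dY) : ℝ := ∫ ξ, p.F x y ξ ∂p.P

def gradX (z : p.Point) : Euc p.dX := gradient (fun x => p.f x z.2) z.1

def gradY (z : p.Point) : Euc p.dY := gradient (fun y => p.f z.1 y) z.2

/-- The merit function `w(z) = f(x, y*) - f(x*, y)`. -/
def merit (z : p.Point) : ℝ := p.f z.1 p.ys - p.f p.xs z.2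

/-- The pairing `⟨u, r⟩` on the product space. -/
def pairing (w r : p.Point) : ℝ := inner ℝ w.1 r.1 + inner ℝ w.2 r.2

/-- The Frank-Wolfe gap `ĝ(z) = max_{w ∈ X × Y} ⟨z - w, (∇ₓ f(z), -∇_y f(z))⟩`. -/
def fwGap (z : p.Point) : ℝ :=
  sSup ((fun w : p.Point => p.pairing (z - w) (p.gradX z, -p.gradY z)) '' (p.X ×ˢ p.Y))

/-- The Nash gap `max_{(u, v) ∈ X × Y} f(x, v) - f(u, y)` of `z = (x, y)`; a feasible point whose Nash
gap is at most `ε` is an `ε`-Nash equilibrium. -/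
def nashGap (z : p.Point) : ℝ :=
  sSup ((fun w : p.Point => p.f z.1 w.2 - p.f w.1 z.2) '' (p.X ×ˢ p.Y))

/-- One unit of randomness: `(u_x, ξ_x, u_y, ξ_y)`. -/
abbrev Sample : Type u := Euc p.dX × p.Ξ × Euc p.dY × p.Ξ

/-- The law of a unit of randomness: Gaussian directions and oracle noises, all independent. -/
def sampleLaw : Measure p.Sample :=
  (stdGaussian (Euc p.dX)).prod (p.P.prod ((stdGaussian (Euc p.dY)).prod p.P))

/-- The free parameters of the method: batch sizes `m_k`, smoothing parameters `ν`, and the step size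
`γ_k` as a function of `k` and of the estimated gap `g_{k-1}`. -/
structure Tuning where
  mX : ℕ → ℕ
  mY : ℕ → ℕ
  νX : ℝ
  νY : ℝ
  γ : ℕ → ℝ → ℝ

/-- The minibatch zeroth-order estimator of `∇ₓ f` at `z`; it makes `2 m` oracle calls. -/
def estX (m : ℕ) (ν : ℝ) (z : p.Point) (s : ℕ → p.Sample) : Euc p.dX :=
  (m : ℝ)⁻¹ • ∑ j ∈ Finset.range m,
    ((p.F (z.1 + ν • (s j).1) z.2 (s j).2.1 - p.F z.1 z.2 (s j).2.1) / ν) • (s j).1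

/-- The minibatch zeroth-order estimator of `∇_y f` at `z`; it makes `2 m` oracle calls. -/
def estY (m : ℕ) (ν : ℝ) (z : p.Point) (s : ℕ → p.Sample) : Euc p.dY :=
  (m : ℝ)⁻¹ • ∑ j ∈ Finset.range m,
    ((p.F z.1 (z.2 + ν • (s j).2.2.1) (s j).2.2.2 - p.F z.1 z.2 (s j).2.2.2) / ν) • (s j).2.2.1

/-- The state of the method: current point and numbers of oracle calls made so far. -/
structure State where
  z : p.Point
  zoCalls : ℕ
  loCalls : ℕ

/-- Iteration `k` of the method with linear optimization oracle `lmo`. -/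
def step (lmo : p.Point → p.Point) (T : Tuning) (k : ℕ) (s : ℕ → p.Sample) (S : p.State) : p.State :=
  let G : p.Point := (p.estX (T.mX k) T.νX S.z s, -p.estY (T.mY k) T.νY S.z s)
  let t : p.Point := lmo G
  let g : ℝ := p.pairing (S.z - t) G
  let γ : ℝ := T.γ k g
  { z := (1 - γ) • S.z + γ • t
    zoCalls := S.zoCalls + (2 * T.mX k + 2 * T.mY k)
    loCalls := S.loCalls + 1 }

/-- The state after `k` iterations from `z0`; iteration `k` uses the samples `s k 0, s k 1, …`. -/
def run (lmo : p.Point → p.Point) (T : Tuning) (z0 : p.Point) (s : ℕ → ℕ → p.Sample) : ℕ → p.State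
  | 0 => ⟨z0, 0, 0⟩
  | k + 1 => p.step lmo T (k + 1) (s (k + 1)) (run lmo T z0 s k)

end SaddleProblem

/-- What an execution of the method needs: a starting point, a linear optimization oracle, and i.i.d.
samples on a probability space. -/
structure Execution {c : Constants} (p : SaddleProblem.{u} c) where
  z0 : p.Point
  z0_mem : z0 ∈ p.X ×ˢ p.Y
  lmo : p.Point → p.Point
  measurable_lmo : Measurable lmo
  lmo_mem : ∀ r, lmo r ∈ p.X ×ˢ p.Y
  lmo_min : ∀ r, ∀ w ∈ p.X ×ˢ p.Y, p.pairing (lmo r) r ≤ p.pairing w r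
  Ω : Type v
  [mΩ : MeasurableSpace Ω]
  μ : Measure Ω
  [probμ : IsProbabilityMeasure μ]
  sample : ℕ → ℕ → Ω → p.Sample
  measurable_sample : ∀ k j, Measurable (sample k j)
  law_sample : ∀ k j, HasLaw (sample k j) p.sampleLaw μ
  indep_sample : iIndepFun (fun q : ℕ × ℕ => sample q.1 q.2) μ

attribute [instance] Execution.mΩ Execution.probμ

namespace Execution

variable {c : Constants} {p : SaddleProblem.{u} c} (e : Execution.{u, v} p)

/-- The random state after `k` iterations. -/
def state (T : SaddleProblem.Tuning) (k : ℕ) (ω : e.Ω) : p.State :=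
  p.run e.lmo T e.z0 (fun i j => e.sample i j ω) k

/-- The random iterate `z_k`. -/
def iter (T : SaddleProblem.Tuning) (k : ℕ) (ω : e.Ω) : p.Point := (e.state T k ω).z

end Execution

/-- The non-adaptive step size. -/
def stepSize (k : ℕ) : ℝ := 6 / (5 + k)

/-- `Γ_k = ∏_{i=1}^k (1 - γ_i / 2)`. -/
def Gam (k : ℕ) : ℝ := ∏ i ∈ Finset.Icc 1 k, (1 - stepSize i / 2)

/-- `P_R(R = k)` for a run of `N` iterations. -/
def outputProb (N k : ℕ) : ℝ := stepSize k * Gam N / (2 * Gam k * (1 - Gam N))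

/-- `R` is a random index in `{1, …, N}` with law `P_R`, independent of the samples. -/
def Execution.IsOutputIndex {c : Constants} {p : SaddleProblem.{u} c} (e : Execution.{u, v} p)
    (N : ℕ) (R : e.Ω → ℕ) : Prop :=
  Measurable R ∧ (∀ ω, R ω ∈ Finset.Icc 1 N) ∧
    (∀ k ∈ Finset.Icc 1 N, e.μ.real {ω | R ω = k} = outputProb N k) ∧
    IndepFun R (fun ω k j => e.sample k j ω) e.μ

namespace Constants

variable (c : Constants)

/-- The non-adaptive tuning for a run of `N` iterations in dimensions `dX`, `dY`. -/
def nonadaptive (dX dY N : ℕ) : SaddleProblem.Tuning where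
  mX _ := ⌈c.BX * (dX + 5) * (N : ℝ) ^ 2⌉₊
  mY _ := ⌈c.BY * (dY + 5) * (N : ℝ) ^ 2⌉₊
  νX := √(c.BX / (2 * (N : ℝ) ^ 2 * ((dX : ℝ) + 6) ^ 3))
  νY := √(c.BY / (2 * (N : ℝ) ^ 2 * ((dY : ℝ) + 6) ^ 3))
  γ k _ := stepSize k

/-- The adaptive step size with constant batch sizes and smoothing parameters. -/
def adaptive (mX mY : ℕ) (νX νY : ℝ) : SaddleProblem.Tuning where
  mX _ := mX
  mY _ := mY
  νX := νX
  νY := νY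
  γ _ g := min (c.C0 / (4 * c.C1) * g) 1

/-- The adaptive tuning for accuracy `ε`: smoothing parameters `√(B ε² / (2 (d + 6)³))` and constant
batch sizes `⌈B (d + 5) / (ε² a)⌉`. -/
def adaptiveFor (dX dY : ℕ) (ε a : ℝ) : SaddleProblem.Tuning :=
  c.adaptive ⌈c.BX * (dX + 5) / (ε ^ 2 * a)⌉₊ ⌈c.BY * (dY + 5) / (ε ^ 2 * a)⌉₊
    (√(c.BX * ε ^ 2 / (2 * ((dX : ℝ) + 6) ^ 3))) (√(c.BY * ε ^ 2 / (2 * ((dY : ℝ) + 6) ^ 3)))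

end Constants

end

noncomputable section

/-! ### Gaussian moments -/

/-! Write `w` for the merit, `ĝ` for the Frank-Wolfe gap and `S = √2 δμ √w`. Since the saddle point
is interior, both partial gradients of `f` vanish there, so on the domain `w` is at least a
quadratic (`le_merit`) and at most `C1` (`merit_le_C1`). Interiority also lets a competitor move
from the saddle by `δX`, `δY` against the gradients at `z`. Hence `ĝ` exceeds the pairing with `z -
z*` by `δX ‖∇ₓf‖ + δY ‖∇_y f‖`, while strong convexity bounds `w` by the squared gradient norms over
`2μ`. Together, `ĝ ≥ w + S` (`merit_add_sqrt_le_fwGap`). The `√w` in `S` makes `ĝ²` dominate a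
multiple of `w`, which is the source of the linear rate.

One step (`merit_step_le`): the descent lemma for `w` involves gradients at `(x, y*)` and `(x*, y)`
instead of at `z`. Replacing them costs at most `(1 - C0) S`, which `ĝ ≥ w + S` pays for when `C0 >
0`. An inexact gradient costs its weighted error `n`.

Non-adaptive step: `w⁺ ≤ (1 - γ/2) w - γ (C0/2) ĝ + γ² C1 + γ n`. Dividing by `Γ` makes the merit
terms telescope, and the resulting weights of `ĝ` are, up to a shift of index, the law of `R`. The
initial merit is absorbed through `w ≤ C1`.

Adaptive step: for `γ` proportional to the estimated gap, optimizing a quadratic gives `w⁺ ≤ (1 - ρ)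
w + n² / (2 C1)`; a full step can only occur when `n ≥ 2 C1`, and then the bound is trivial. The
noise enters squared, so a mean square error of order `ε² log (1/ε)` is still far below `ε`. Hence
the smaller batches suffice.

Noise (`estimator_mse`): a finite difference along `u` is `⟨∇F, u⟩ u` plus a remainder of size at
most `ν L ‖u‖³ / 2`. The first part is unbiased, has second moment `(d + 2) ‖∇F‖²`, and averages out
like `1/m`; the second is controlled by the sixth Gaussian moment. Bounds at a fixed `z` carry over
to the random iterate because it is independent of the next batch (`integral_iter_batch_le`). -/

theorem integrable_pow_gaussianReal (n : ℕ) :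
    Integrable (fun x : ℝ => x ^ n) (gaussianReal 0 1) := by
  have h := (memLp_id_gaussianReal (μ := 0) (v := 1) n)
  rcases Nat.eq_zero_or_pos n with rfl | hn
  · simp
  have h2 := h.integrable_norm_pow hn.ne'
  refine h2.mono (by fun_prop) (Filter.Eventually.of_forall fun x => ?_)
  simp

theorem hasDerivAt_gaussianPDFReal (x : ℝ) :
    HasDerivAt (gaussianPDFReal 0 1) (-(x * gaussianPDFReal 0 1 x)) x := by
  unfold gaussianPDFReal
  have h1 : HasDerivAt (fun x : ℝ => -(x - 0) ^ 2 / (2 * ((1 : NNReal) : ℝ))) (-x) x := by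
    refine ((((hasDerivAt_id x).sub_const 0).fun_pow 2).fun_neg.div_const
      (2 * ((1 : NNReal) : ℝ))).congr_deriv ?_
    simp only [id_eq, sub_zero, NNReal.coe_one]
    ring
  refine (h1.exp.const_mul (√(2 * Real.pi * ((1 : NNReal) : ℝ)))⁻¹).congr_deriv ?_
  ring

/-- Integration by parts with `φ' = -x φ`, applied to `x ^ (n + 1)`. -/
theorem integral_pow_gaussianReal_succ (n : ℕ) :
    ∫ x, x ^ (n + 2) ∂gaussianReal 0 1 = (n + 1) * ∫ x, x ^ n ∂gaussianReal 0 1 := by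
  have hint : ∀ k : ℕ, Integrable (fun x : ℝ => x ^ k * gaussianPDFReal 0 1 x) := by
    intro k
    have h := integrable_pow_gaussianReal k
    rw [gaussianReal_of_var_ne_zero _ one_ne_zero, integrable_withDensity_iff_integrable_smul'
      (measurable_gaussianPDF _ _) (Filter.Eventually.of_forall fun _ => gaussianPDF_lt_top)] at h
    refine h.congr (Filter.Eventually.of_forall fun x => ?_)
    simp [toReal_gaussianPDF, mul_comm]
  rw [integral_gaussianReal_eq_integral_smul one_ne_zero,
    integral_gaussianReal_eq_integral_smul one_ne_zero]
  have := integral_mul_deriv_eq_deriv_mul_of_integrable (u := fun x : ℝ => x ^ (n + 1))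
    (v := gaussianPDFReal 0 1) (u' := fun x => ((n + 1 : ℕ) : ℝ) * x ^ n)
    (v' := fun x => -(x * gaussianPDFReal 0 1 x))
    (fun x _ => by simpa using hasDerivAt_pow (n + 1) x)
    (fun x _ => hasDerivAt_gaussianPDFReal x)
    (((hint (n + 2)).neg).congr (Filter.Eventually.of_forall fun x => by
      simp only [Pi.neg_apply, Pi.mul_apply]; ring))
    (((hint n).const_mul ((n + 1 : ℕ) : ℝ)).congr (Filter.Eventually.of_forall fun x => by
      simp only [Pi.mul_apply]; ring))
    ((hint (n + 1)).congr (Filter.Eventually.of_forall fun x => by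
      simp only [Pi.mul_apply]))
  have e1 : ∫ x, gaussianPDFReal 0 1 x • x ^ (n + 2) =
      -∫ x, x ^ (n + 1) * (-(x * gaussianPDFReal 0 1 x)) := by
    rw [← integral_neg]
    refine integral_congr_ae (Filter.Eventually.of_forall fun x => ?_)
    simp only [smul_eq_mul]; ring
  rw [e1, this, neg_neg, ← integral_const_mul]
  refine integral_congr_ae (Filter.Eventually.of_forall fun x => ?_)
  push_cast
  simp only [smul_eq_mul]; ring

theorem integral_sq_gaussianReal : ∫ x, x ^ 2 ∂gaussianReal 0 1 = 1 := by
  simpa using integral_pow_gaussianReal_succ 0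

theorem integral_pow_four_gaussianReal : ∫ x, x ^ 4 ∂gaussianReal 0 1 = 3 := by
  have := integral_pow_gaussianReal_succ 2
  rw [integral_sq_gaussianReal] at this
  norm_num at this ⊢; exact this

theorem integral_pow_six_gaussianReal : ∫ x, x ^ 6 ∂gaussianReal 0 1 = 15 := by
  have := integral_pow_gaussianReal_succ 4
  rw [integral_pow_four_gaussianReal] at this
  norm_num at this ⊢; exact this

/-! ### Chi-square moments -/

section Chi

variable {ι : Type*} [Fintype ι]

/-- The law of independent standard Gaussians indexed by `ι`. -/
abbrev gaussPi (ι : Type*) [Fintype ι] : Measure (ι → ℝ) := Measure.pi fun _ : ι => gaussianReal 0 1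

theorem integrable_eval_pow_gaussPi (i : ι) (n : ℕ) :
    Integrable (fun x : ι → ℝ => x i ^ n) (gaussPi ι) :=
  (integrable_comp_eval (μ := fun _ : ι => gaussianReal 0 1) (i := i)
    (integrable_pow_gaussianReal n) :)

theorem integral_eval_pow_gaussPi (i : ι) (n : ℕ) :
    ∫ x : ι → ℝ, x i ^ n ∂gaussPi ι = ∫ x, x ^ n ∂gaussianReal 0 1 :=
  integral_comp_eval (μ := fun _ : ι => gaussianReal 0 1) (i := i) (f := fun x : ℝ => x ^ n)
    (by fun_prop)

theorem indepFun_sum_sq_gaussPi {s : Finset ι} {i : ι} (hi : i ∉ s) :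
    IndepFun (fun x : ι → ℝ => ∑ j ∈ s, x j ^ 2) (fun x => x i ^ 2) (gaussPi ι) := by
  have h : iIndepFun (fun (i : ι) (x : ι → ℝ) => x i ^ 2) (gaussPi ι) :=
    iIndepFun_pi (X := fun _ (x : ℝ) => x ^ 2) (fun _ => by fun_prop)
  have := h.indepFun_finsetSum_of_notMem (fun i => by fun_prop) hi
  convert this using 1
  ext x
  simp

/-- Moments of the chi-square distribution. -/
theorem chiSq_moments [DecidableEq ι] (s : Finset ι) :
    (Integrable (fun x : ι → ℝ => ∑ j ∈ s, x j ^ 2) (gaussPi ι) ∧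
      ∫ x : ι → ℝ, ∑ j ∈ s, x j ^ 2 ∂gaussPi ι = s.card) ∧
    (Integrable (fun x : ι → ℝ => (∑ j ∈ s, x j ^ 2) ^ 2) (gaussPi ι) ∧
      ∫ x : ι → ℝ, (∑ j ∈ s, x j ^ 2) ^ 2 ∂gaussPi ι = s.card * (s.card + 2)) ∧
    (Integrable (fun x : ι → ℝ => (∑ j ∈ s, x j ^ 2) ^ 3) (gaussPi ι) ∧
      ∫ x : ι → ℝ, (∑ j ∈ s, x j ^ 2) ^ 3 ∂gaussPi ι = s.card * (s.card + 2) * (s.card + 4)) := by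
  induction s using Finset.induction_on with
  | empty => simp
  | insert a s ha ih =>
    obtain ⟨⟨i1, e1⟩, ⟨i2, e2⟩, ⟨i3, e3⟩⟩ := ih
    set S : (ι → ℝ) → ℝ := fun x => ∑ j ∈ s, x j ^ 2 with hS
    have hSm : Measurable S := by fun_prop
    have hind := indepFun_sum_sq_gaussPi ha
    have q2 : ∫ x : ι → ℝ, x a ^ 2 ∂gaussPi ι = 1 := by
      rw [integral_eval_pow_gaussPi, integral_sq_gaussianReal]
    have q4 : ∫ x : ι → ℝ, x a ^ 4 ∂gaussPi ι = 3 := by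
      rw [integral_eval_pow_gaussPi, integral_pow_four_gaussianReal]
    have q6 : ∫ x : ι → ℝ, x a ^ 6 ∂gaussPi ι = 15 := by
      rw [integral_eval_pow_gaussPi, integral_pow_six_gaussianReal]
    have j2 := integrable_eval_pow_gaussPi a 2
    have j4 := integrable_eval_pow_gaussPi a 4
    have j6 := integrable_eval_pow_gaussPi a 6
    have hind12 : IndepFun S (fun x : ι → ℝ => x a ^ 4) (gaussPi ι) := by
      have e : (fun x : ι → ℝ => x a ^ 4) = (fun t : ℝ => t ^ 2) ∘ fun x => x a ^ 2 := by
        funext x; simp only [Function.comp_apply]; ring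
      rw [e]
      exact hind.comp (φ := id) (ψ := fun t : ℝ => t ^ 2) measurable_id (by fun_prop)
    have hind21 : IndepFun (fun x => S x ^ 2) (fun x : ι → ℝ => x a ^ 2) (gaussPi ι) :=
      hind.comp (φ := fun t : ℝ => t ^ 2) (ψ := id) (by fun_prop) measurable_id
    have m11 : Integrable (fun x => S x * x a ^ 2) (gaussPi ι) := hind.integrable_mul i1 j2
    have m12 : Integrable (fun x => S x * x a ^ 4) (gaussPi ι) := hind12.integrable_mul i1 j4
    have m21 : Integrable (fun x => S x ^ 2 * x a ^ 2) (gaussPi ι) := hind21.integrable_mul i2 j2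
    have f11 : ∫ x, S x * x a ^ 2 ∂gaussPi ι = s.card := by
      rw [hind.integral_fun_mul_eq_mul_integral i1.1 j2.1, q2, mul_one]; exact e1
    have f12 : ∫ x, S x * x a ^ 4 ∂gaussPi ι = s.card * 3 := by
      rw [hind12.integral_fun_mul_eq_mul_integral i1.1 j4.1, q4, e1]
    have f21 : ∫ x, S x ^ 2 * x a ^ 2 ∂gaussPi ι = s.card * (s.card + 2) := by
      rw [hind21.integral_fun_mul_eq_mul_integral i2.1 j2.1, q2, mul_one, e2]
    -- Binomial expansion of the powers of `x a ^ 2 + S`, where `S` is independent of `x a`. The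
    -- scalar moments 1, 3, 15 and the induction hypothesis for `S` then determine every term.
    have r1 : (fun x : ι → ℝ => ∑ j ∈ insert a s, x j ^ 2) = fun x => x a ^ 2 + S x := by
      ext x; rw [Finset.sum_insert ha]
    have r2 : (fun x : ι → ℝ => (∑ j ∈ insert a s, x j ^ 2) ^ 2) =
        fun x => (x a ^ 4 + 2 * (S x * x a ^ 2)) + S x ^ 2 := by
      ext x; rw [Finset.sum_insert ha]; simp only [hS]; ring
    have r3 : (fun x : ι → ℝ => (∑ j ∈ insert a s, x j ^ 2) ^ 3) =
        fun x => ((x a ^ 6 + 3 * (S x * x a ^ 4)) + 3 * (S x ^ 2 * x a ^ 2)) + S x ^ 3 := by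
      ext x; rw [Finset.sum_insert ha]; simp only [hS]; ring
    have hc : ((insert a s).card : ℝ) = s.card + 1 := by
      rw [Finset.card_insert_of_notMem ha]; push_cast; ring
    rw [r1, r2, r3, hc]
    have k2 : Integrable (fun x => x a ^ 4 + 2 * (S x * x a ^ 2)) (gaussPi ι) :=
      j4.add (m11.const_mul 2)
    have k3 : Integrable (fun x => x a ^ 6 + 3 * (S x * x a ^ 4)) (gaussPi ι) :=
      j6.add (m12.const_mul 3)
    have k4 : Integrable (fun x => x a ^ 6 + 3 * (S x * x a ^ 4) + 3 * (S x ^ 2 * x a ^ 2))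
      (gaussPi ι) := k3.add (m21.const_mul 3)
    have i2' : Integrable (fun x => S x ^ 2) (gaussPi ι) := i2
    have i3' : Integrable (fun x => S x ^ 3) (gaussPi ι) := i3
    refine ⟨⟨j2.add i1, ?_⟩, ⟨k2.add i2, ?_⟩, k4.add i3, ?_⟩
    · rw [integral_add j2 i1, q2, e1]; ring
    · rw [integral_add k2 i2', integral_add j4 (m11.const_mul 2),
        integral_const_mul, q4, f11, e2]; ring
    · rw [integral_add k4 i3', integral_add k3 (m21.const_mul 3),
        integral_add j6 (m12.const_mul 3), integral_const_mul, integral_const_mul, q6, f12, f21,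
        e3]
      ring

/-- The square of coordinate `i` is independent of the sum over the other coordinates, so the
expectation is `3 + (card ι - 1)`. After a rotation this is the second moment of the estimator `⟨a,
w⟩ w`. -/
theorem gaussPi_sq_mul_chiSq [DecidableEq ι] (i : ι) :
    Integrable (fun x : ι → ℝ => x i ^ 2 * ∑ j, x j ^ 2) (gaussPi ι) ∧
    ∫ x : ι → ℝ, x i ^ 2 * ∑ j, x j ^ 2 ∂gaussPi ι = Fintype.card ι + 2 := by
  have hi : i ∉ Finset.univ.erase i := Finset.notMem_erase _ _
  obtain ⟨i1, e1⟩ := (chiSq_moments (Finset.univ.erase i)).1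
  have hind := indepFun_sum_sq_gaussPi hi
  have j2 := integrable_eval_pow_gaussPi i 2
  have j4 := integrable_eval_pow_gaussPi i 4
  have r : (fun x : ι → ℝ => x i ^ 2 * ∑ j, x j ^ 2) = fun x =>
      x i ^ 4 + (∑ j ∈ Finset.univ.erase i, x j ^ 2) * x i ^ 2 := by
    ext x
    rw [← Finset.add_sum_erase _ _ (Finset.mem_univ i)]; ring
  have m : Integrable (fun x : ι → ℝ => (∑ j ∈ Finset.univ.erase i, x j ^ 2) * x i ^ 2)
    (gaussPi ι) := hind.integrable_mul i1 j2
  rw [r]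
  refine ⟨j4.add m, ?_⟩
  rw [integral_add j4 m, hind.integral_fun_mul_eq_mul_integral i1.1 j2.1,
    integral_eval_pow_gaussPi, integral_eval_pow_gaussPi, integral_pow_four_gaussianReal,
    integral_sq_gaussianReal, e1, Finset.card_erase_of_mem (Finset.mem_univ i), Finset.card_univ]
  have : 1 ≤ Fintype.card ι := Fintype.card_pos_iff.2 ⟨i⟩
  push_cast [this]; ring

end Chi

/-! ### Moments of the standard Gaussian vector -/

variable {d : ℕ}

/-- Expectations under the standard Gaussian as expectations of coordinates in an orthonormal
basis. -/
theorem stdGaussian_integral_basis {ι : Type*} [Fintype ι] (b : OrthonormalBasis ι ℝ (Euc d))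
    {g : Euc d → ℝ} (hg : Measurable g) {h : (ι → ℝ) → ℝ}
    (hgh : ∀ x : ι → ℝ, g (∑ i, x i • b i) = h x) (hh : Integrable h (gaussPi ι)) :
    Integrable g (stdGaussian (Euc d)) ∧
      ∫ w, g w ∂stdGaussian (Euc d) = ∫ x, h x ∂gaussPi ι := by
  have hm : Measurable (fun x : ι → ℝ => ∑ i, x i • b i) := by fun_prop
  rw [stdGaussian_eq_map_pi_orthonormalBasis b]
  refine ⟨?_, ?_⟩
  · rw [integrable_map_measure hg.aestronglyMeasurable hm.aemeasurable]
    exact hh.congr (Filter.Eventually.of_forall fun x => (hgh x).symm)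
  · rw [integral_map hm.aemeasurable hg.aestronglyMeasurable]
    exact integral_congr_ae (Filter.Eventually.of_forall fun x => hgh x)

theorem OrthonormalBasis.norm_sq_sum_smul {ι : Type*} [Fintype ι]
    (b : OrthonormalBasis ι ℝ (Euc d)) (x : ι → ℝ) : ‖∑ i, x i • b i‖ ^ 2 = ∑ i, x i ^ 2 := by
  have := b.orthonormal.sum_inner_products_le (s := Finset.univ) (x := ∑ i, x i • b i)
  rw [← real_inner_self_eq_norm_sq, b.orthonormal.inner_sum]
  simp [sq]

theorem stdGaussian_norm_pow_six :
    Integrable (fun w : Euc d => ‖w‖ ^ 6) (stdGaussian (Euc d)) ∧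
      ∫ w : Euc d, ‖w‖ ^ 6 ∂stdGaussian (Euc d) = d * (d + 2) * (d + 4) := by
  classical
  obtain ⟨i3, e3⟩ := (chiSq_moments (Finset.univ : Finset (Fin d))).2.2
  have := stdGaussian_integral_basis (EuclideanSpace.basisFun (Fin d) ℝ)
    (g := fun w : Euc d => ‖w‖ ^ 6) (by fun_prop)
    (fun x => by
      rw [show (6 : ℕ) = 2 * 3 from rfl, pow_mul, OrthonormalBasis.norm_sq_sum_smul]) i3
  rw [e3] at this
  simpa using this

/-- By rotation invariance: in an orthonormal basis containing `a / ‖a‖`, the pairing with `a` is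
`‖a‖` times a single coordinate. -/
theorem stdGaussian_inner_sq_mul_norm_sq (a : Euc d) :
    Integrable (fun w : Euc d => inner ℝ a w ^ 2 * ‖w‖ ^ 2) (stdGaussian (Euc d)) ∧
      ∫ w : Euc d, inner ℝ a w ^ 2 * ‖w‖ ^ 2 ∂stdGaussian (Euc d) = (d + 2) * ‖a‖ ^ 2 := by
  classical
  by_cases ha : a = 0
  · simp [ha]
  have hn : ‖a‖ ≠ 0 := norm_ne_zero_iff.2 ha
  have ho : Orthonormal ℝ ((↑) : ({(‖a‖⁻¹ • a)} : Set (Euc d)) → Euc d) := by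
    refine ⟨fun ⟨v, hv⟩ => ?_, fun ⟨v, hv⟩ ⟨w, hw⟩ h => ?_⟩
    · simp only [Set.mem_singleton_iff.1 hv, norm_smul, norm_inv, norm_norm]
      exact inv_mul_cancel₀ hn
    · exact absurd (Subtype.ext ((Set.mem_singleton_iff.1 hv).trans
        (Set.mem_singleton_iff.1 hw).symm)) h
  obtain ⟨s, b, hs, hb⟩ := ho.exists_orthonormalBasis_extension
  have hmem : ‖a‖⁻¹ • a ∈ s := by simpa using hs
  obtain ⟨i1, e1⟩ := gaussPi_sq_mul_chiSq (⟨‖a‖⁻¹ • a, hmem⟩ : s)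
  have hab : a = ‖a‖ • b ⟨‖a‖⁻¹ • a, hmem⟩ := by
    rw [hb, smul_smul, mul_inv_cancel₀ hn, one_smul]
  have hin : ∀ x : s → ℝ, inner ℝ a (∑ i, x i • b i) = ‖a‖ * x ⟨‖a‖⁻¹ • a, hmem⟩ := by
    intro x
    conv_lhs => rw [hab]
    rw [real_inner_smul_left, b.orthonormal.inner_right_sum _ (Finset.mem_univ _)]
  have := stdGaussian_integral_basis b
    (g := fun w : Euc d => inner ℝ a w ^ 2 * ‖w‖ ^ 2) (by fun_prop)
    (h := fun x => ‖a‖ ^ 2 * (x ⟨‖a‖⁻¹ • a, hmem⟩ ^ 2 * ∑ j, x j ^ 2))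
    (fun x => by rw [hin, OrthonormalBasis.norm_sq_sum_smul]; ring) (i1.const_mul _)
  refine ⟨this.1, this.2.trans ?_⟩
  rw [integral_const_mul, e1]
  have hc : Fintype.card s = d := by
    rw [← Module.finrank_eq_card_basis b.toBasis]; simp
  rw [hc]; ring

/-- The covariance is the identity; this is why `⟨a, w⟩ w` is an unbiased estimator of `a`. -/
theorem stdGaussian_inner_mul_inner (a b : Euc d) :
    ∫ w : Euc d, inner ℝ a w * inner ℝ b w ∂stdGaussian (Euc d) = inner ℝ a b := by
  have h := covarianceBilin_apply (μ := stdGaussian (Euc d)) IsGaussian.memLp_two_id a b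
  rw [covarianceBilin_stdGaussian] at h
  simp only [integral_id_stdGaussian, id_eq, sub_zero] at h
  exact h.symm

/-! ### Smooth and strongly convex functions -/

section Smooth

variable {E : Type*} [NormedAddCommGroup E] [InnerProductSpace ℝ E] [CompleteSpace E]

theorem HasGradientAt.hasDerivAt_comp_add_smul {h : E → ℝ} {g x v : E} {t : ℝ}
    (hg : HasGradientAt h g (x + t • v)) :
    HasDerivAt (fun t : ℝ => h (x + t • v)) (inner ℝ g v) t := by
  have h1 : HasDerivAt (fun t : ℝ => x + t • v) v t := by
    simpa using ((hasDerivAt_id t).smul_const v).const_add x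
  have h2 := hg.hasFDerivAt.comp_hasDerivAt t h1
  simpa [Function.comp_def] using h2

/-- Two-sided descent lemma. Along the segment the remainder `φ` has derivative at most `L ‖v‖² t`
in absolute value, so it stays below the majorant `L/2 ‖v‖² t²`; no integral of the gradient is
needed. -/
theorem abs_sub_sub_inner_gradient_le {h : E → ℝ} {L : ℝ} (hd : Differentiable ℝ h)
    (hL : ∀ x y, ‖gradient h x - gradient h y‖ ≤ L * ‖x - y‖) (x y : E) :
    |h y - h x - inner ℝ (gradient h x) (y - x)| ≤ L / 2 * ‖y - x‖ ^ 2 := by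
  set v := y - x with hv
  set φ : ℝ → ℝ := fun t => h (x + t • v) - h x - t * inner ℝ (gradient h x) v with hφ
  set φ' : ℝ → ℝ := fun t => inner ℝ (gradient h (x + t • v)) v - inner ℝ (gradient h x) v
    with hφ'
  have hder : ∀ t, HasDerivAt φ (φ' t) t := by
    intro t
    have h1 := (hd (x + t • v)).hasGradientAt.hasDerivAt_comp_add_smul
    have h2 : HasDerivAt (fun t : ℝ => t * inner ℝ (gradient h x) v)
        (inner ℝ (gradient h x) v) t := by
      simpa using (hasDerivAt_id t).mul_const (inner ℝ (gradient h x) v)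
    exact (h1.sub_const (h x)).sub h2
  have key := image_norm_le_of_norm_deriv_right_le_deriv_boundary (f := φ) (f' := φ')
    (a := 0) (b := 1) (B := fun t => L / 2 * ‖v‖ ^ 2 * t ^ 2)
    (B' := fun t => L / 2 * ‖v‖ ^ 2 * (2 * t))
    (fun t _ => (hder t).continuousAt.continuousWithinAt)
    (fun t _ => (hder t).hasDerivWithinAt) (by simp [hφ])
    (fun t => by simpa using (hasDerivAt_pow 2 t).const_mul (L / 2 * ‖v‖ ^ 2))
    (fun t ht => by
      simp only [hφ']
      rw [← inner_sub_left]
      refine (norm_inner_le_norm _ _).trans ?_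
      have := hL (x + t • v) x
      rw [add_sub_cancel_left, norm_smul, Real.norm_of_nonneg ht.1] at this
      nlinarith [norm_nonneg v])
    (Set.right_mem_Icc.2 zero_le_one)
  simpa [hφ, hv] using key

/-- First order lower bound for strongly convex functions. -/
theorem StrongConvexOn.add_inner_add_le {s : Set E} {m : ℝ} {h : E → ℝ} {x y g : E}
    (hc : StrongConvexOn s m h) (hx : x ∈ s) (hy : y ∈ s) (hg : HasGradientAt h g x) :
    h x + inner ℝ g (y - x) + m / 2 * ‖y - x‖ ^ 2 ≤ h y := by
  have hg0 : HasGradientAt h g (x + (0 : ℝ) • (y - x)) := by simpa using hg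
  have h1 := hg0.hasDerivAt_comp_add_smul.tendsto_slope_zero_right
  have h2 : Filter.Tendsto (fun t : ℝ => h y - h x - (1 - t) * (m / 2 * ‖y - x‖ ^ 2))
      (nhdsWithin 0 (Set.Ioi 0)) (nhds (h y - h x - (1 - 0) * (m / 2 * ‖y - x‖ ^ 2))) := by
    refine Filter.Tendsto.mono_left (Continuous.tendsto ?_ 0) nhdsWithin_le_nhds
    fun_prop
  -- Strong convexity with weights `1 - t` and `t`, divided by `t`, bounds the difference quotient;
  -- the claim is its limit as `t` decreases to 0.
  have hle := le_of_tendsto_of_tendsto h1 h2 (by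
    filter_upwards [Ioo_mem_nhdsGT (zero_lt_one (α := ℝ))] with t ht
    have := hc.2 hx hy (sub_nonneg.2 ht.2.le) ht.1.le (by ring : 1 - t + t = 1)
    have e : (1 - t) • x + t • y = x + t • (y - x) := by module
    rw [e, norm_sub_rev x y] at this
    simp only [zero_add, zero_smul, add_zero, smul_eq_mul] at this ⊢
    rw [inv_mul_le_iff₀ ht.1]
    linarith)
  linarith

/-- At interior points the Lipschitz constant bounds the derivative. A convex set with nonempty
interior lies in the closure of that interior, so continuity of the gradient carries the bound to
boundary points, which iterates may reach. -/
theorem norm_gradient_le_of_lipschitzOn {s : Set E} {h : E → ℝ} {ℓ : ℝ} (hℓ0 : 0 ≤ ℓ) (hs : Convex ℝ s)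
    (hi : (interior s).Nonempty) (hgc : Continuous (gradient h)) (hd : Differentiable ℝ h)
    (hl : ∀ x ∈ s, ∀ y ∈ s, |h x - h y| ≤ ℓ * ‖x - y‖) {x : E} (hx : x ∈ s) :
    ‖gradient h x‖ ≤ ℓ := by
  have hℓ : ∀ x ∈ interior s, ‖gradient h x‖ ≤ ℓ := by
    intro x hx
    have := (hd x).hasFDerivAt.le_of_lip' hℓ0 (by
      filter_upwards [mem_interior_iff_mem_nhds.1 hx] with y hy
      exact hl y hy x (interior_subset hx))
    rwa [gradient, LinearIsometryEquiv.norm_map]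
  have : s ⊆ {x | ‖gradient h x‖ ≤ ℓ} := by
    refine (subset_closure.trans (hs.closure_interior_eq_closure_of_nonempty_interior hi).ge).trans
      (closure_minimal hℓ (isClosed_le (by fun_prop) continuous_const))
  exact this hx

/-- The point of the complement's closure nearest to `x` lies on the frontier, so a ball of radius
the distance to the frontier does not meet the complement. Nontriviality of the space makes the
frontier nonempty; otherwise `infDist` would take its default value 0. -/
theorem closedBall_infDist_frontier_subset {V : Type*} [NormedAddCommGroup V] [NormedSpace ℝ V]
    [FiniteDimensional ℝ V] [Nontrivial V] {s : Set V} {x : V} (hs : IsCompact s)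
    (hx : x ∈ interior s) :
    Metric.closedBall x (Metric.infDist x (frontier s)) ⊆ s ∧
      0 < Metric.infDist x (frontier s) ∧
      ∃ b ∈ s, ‖x - b‖ = Metric.infDist x (frontier s) ∧ b ≠ x := by
  have hxs := interior_subset hx
  obtain ⟨y, hy, hd⟩ := hs.exists_mem_frontier_infDist_compl_eq_dist hxs
  have hyx : y ≠ x := by
    rintro rfl
    exact hy.2 hx
  have h1 : Metric.infDist x (frontier s) ≤ Metric.infDist x sᶜ :=
    hd ▸ Metric.infDist_le_dist_of_mem hy
  have hpos : 0 < Metric.infDist x (frontier s) :=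
    (isClosed_frontier.notMem_iff_infDist_pos ⟨y, hy⟩).1 fun h => h.2 hx
  refine ⟨?_, hpos, ?_⟩
  · rw [← closure_ball x hpos.ne']
    exact closure_minimal ((Metric.ball_subset_ball h1).trans Metric.ball_infDist_compl_subset)
      hs.isClosed
  · obtain ⟨b, hb, hbe⟩ := isClosed_frontier.exists_infDist_eq_dist ⟨y, hy⟩ x
    refine ⟨b, hs.isClosed.frontier_subset hb, by rw [hbe, dist_eq_norm], ?_⟩
    rintro rfl
    exact hb.2 hx

end Smooth

/-! ### Expectations of smooth random functions -/

section RandomSmooth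

variable {E : Type*} [NormedAddCommGroup E] [InnerProductSpace ℝ E] [CompleteSpace E]
  {Ξ : Type*} [MeasurableSpace Ξ] {P : Measure Ξ} [IsProbabilityMeasure P] {H : E → Ξ → ℝ} {L : ℝ}

theorem abs_integral_sub_sub_inner_le (hint : ∀ x, Integrable (H x) P)
    (hd : ∀ᵐ ξ ∂P, Differentiable ℝ fun x => H x ξ)
    (hL : ∀ᵐ ξ ∂P, ∀ x y, ‖gradient (fun x => H x ξ) x - gradient (fun x => H x ξ) y‖ ≤ L * ‖x - y‖)
    {x : E} (hg : Integrable (fun ξ => gradient (fun x => H x ξ) x) P) (y : E) :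
    |(∫ ξ, H y ξ ∂P) - (∫ ξ, H x ξ ∂P) -
      inner ℝ (∫ ξ, gradient (fun x => H x ξ) x ∂P) (y - x)| ≤ L / 2 * ‖y - x‖ ^ 2 := by
  have hi : Integrable (fun ξ => inner ℝ (gradient (fun x => H x ξ) x) (y - x)) P :=
    hg.inner_const _
  have e : (∫ ξ, H y ξ ∂P) - (∫ ξ, H x ξ ∂P) -
      inner ℝ (∫ ξ, gradient (fun x => H x ξ) x ∂P) (y - x) =
      ∫ ξ, (H y ξ - H x ξ - inner ℝ (gradient (fun x => H x ξ) x) (y - x)) ∂P := by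
    have hi2 : Integrable (fun ξ => H y ξ - H x ξ) P := (hint y).sub (hint x)
    rw [integral_sub hi2 hi, integral_sub (hint y) (hint x)]
    congr 1
    rw [real_inner_comm, ← integral_inner hg]
    simp_rw [real_inner_comm]
  rw [e]
  have := norm_integral_le_of_norm_le_const (μ := P)
    (f := fun ξ => H y ξ - H x ξ - inner ℝ (gradient (fun x => H x ξ) x) (y - x))
    (C := L / 2 * ‖y - x‖ ^ 2) (by
      filter_upwards [hd, hL] with ξ h1 h2
      exact abs_sub_sub_inner_gradient_le h1 h2 x y)
  simpa using this

/-- The quadratic remainder of the descent lemma is uniform in `ξ`, hence survives averaging and is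
`o(‖y - x‖)`. This differentiates under the integral without a dominating function for the
gradients. -/
theorem hasGradientAt_integral (hint : ∀ x, Integrable (H x) P)
    (hd : ∀ᵐ ξ ∂P, Differentiable ℝ fun x => H x ξ)
    (hL : ∀ᵐ ξ ∂P, ∀ x y, ‖gradient (fun x => H x ξ) x - gradient (fun x => H x ξ) y‖ ≤ L * ‖x - y‖)
    {x : E} (hg : Integrable (fun ξ => gradient (fun x => H x ξ) x) P) :
    HasGradientAt (fun x => ∫ ξ, H x ξ ∂P) (∫ ξ, gradient (fun x => H x ξ) x ∂P) x := by
  rw [hasGradientAt_iff_isLittleO]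
  refine Asymptotics.IsBigO.trans_isLittleO (g := fun y => ‖y - x‖ ^ 2) ?_ ?_
  · refine Asymptotics.IsBigO.of_bound (L / 2) (Filter.Eventually.of_forall fun y => ?_)
    rw [Real.norm_of_nonneg (sq_nonneg ‖y - x‖)]
    exact abs_integral_sub_sub_inner_le hint hd hL hg y
  · have := Asymptotics.isLittleO_pow_sub_sub x (m := 2) one_lt_two
    simpa using this

end RandomSmooth

/-! ### Mean square error of the zeroth-order gradient estimator -/

section Batch

variable {S Ω E : Type*} [MeasurableSpace S] {Q : Measure S} [MeasurableSpace Ω] {μ : Measure Ω}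
  [NormedAddCommGroup E] [InnerProductSpace ℝ E] [CompleteSpace E] {V : ℕ → Ω → S} {A B : S → E}

/-- Expanding the square, the off-diagonal inner products vanish because the summands are centered
and pairwise independent. -/
theorem integral_norm_sq_sum_of_indep [IsProbabilityMeasure Q] (hV : ∀ j, Measurable (V j))
    (hmap : ∀ j, μ.map (V j) = Q)
    (hind : ∀ i j, i ≠ j → IndepFun (V i) (V j) μ) (hA : MemLp A 2 Q) (hA0 : ∫ s, A s ∂Q = 0)
    (m : ℕ) :
    Integrable (fun ω => ‖∑ j ∈ Finset.range m, A (V j ω)‖ ^ 2) μ ∧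
      ∫ ω, ‖∑ j ∈ Finset.range m, A (V j ω)‖ ^ 2 ∂μ = m * ∫ s, ‖A s‖ ^ 2 ∂Q := by
  have hAV : ∀ j, MemLp (fun ω => A (V j ω)) 2 μ := fun j =>
    MemLp.comp_of_map (g := A) (by rw [hmap j]; exact hA) (hV j).aemeasurable
  have hsum : MemLp (fun ω => ∑ j ∈ Finset.range m, A (V j ω)) 2 μ :=
    memLp_finsetSum _ fun j _ => hAV j
  refine ⟨hsum.integrable_norm_pow (by norm_num), ?_⟩
  have hii : ∀ i j, Integrable (fun ω => inner ℝ (A (V i ω)) (A (V j ω))) μ := fun i j =>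
    (((hAV i).integrable_norm_pow (p := 2) (by norm_num)).add
      ((hAV j).integrable_norm_pow (p := 2) (by norm_num))).mono' ((hAV i).1.inner (hAV j).1)
      (Filter.Eventually.of_forall fun ω => (norm_inner_le_norm _ _).trans (by
        simp only [Pi.add_apply]
        nlinarith [sq_nonneg (‖A (V i ω)‖ - ‖A (V j ω)‖), sq_nonneg (‖A (V i ω)‖ + ‖A (V j ω)‖)]))
  have e1 : ∀ ω, ‖∑ j ∈ Finset.range m, A (V j ω)‖ ^ 2 =
      ∑ i ∈ Finset.range m, ∑ j ∈ Finset.range m, inner ℝ (A (V i ω)) (A (V j ω)) := by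
    intro ω
    rw [← real_inner_self_eq_norm_sq, sum_inner]
    simp_rw [inner_sum]
  simp_rw [e1]
  rw [integral_finsetSum _ fun i _ => integrable_finsetSum _ fun j _ => hii i j]
  have e2 : ∀ i ∈ Finset.range m,
      ∫ ω, ∑ j ∈ Finset.range m, inner ℝ (A (V i ω)) (A (V j ω)) ∂μ = ∫ s, ‖A s‖ ^ 2 ∂Q := by
    intro i hi
    rw [integral_finsetSum _ fun j _ => hii i j, Finset.sum_eq_single i]
    · simp_rw [real_inner_self_eq_norm_sq]
      rw [← hmap i, integral_map (hV i).aemeasurable]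
      rw [hmap i]
      exact hA.1.norm.pow 2
    · intro j _ hji
      have hAi : ∀ i, Integrable A (μ.map (V i)) := fun i => by
        rw [hmap i]; exact hA.integrable (by norm_num)
      have := (hind i j hji.symm).integral_bilin_comp_comp (𝕜 := ℝ) (hV i).aemeasurable
        (hV j).aemeasurable (hAi i) (hAi j) (innerSL ℝ)
      have h0 : ∫ ω, A (V i ω) ∂μ = 0 := by
        rw [← integral_map (hV i).aemeasurable (by rw [hmap i]; exact hA.1), hmap i, hA0]
      rw [h0] at this
      rw [map_zero, zero_apply] at this
      exact this
    · exact fun h => absurd hi h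
  rw [Finset.sum_congr rfl e2]
  simp

theorem norm_inv_smul_sum_sq_le {F : Type*} [NormedAddCommGroup F] [NormedSpace ℝ F] (m : ℕ)
    (b : ℕ → F) :
    ‖(m : ℝ)⁻¹ • ∑ j ∈ Finset.range m, b j‖ ^ 2 ≤ (m : ℝ)⁻¹ * ∑ j ∈ Finset.range m, ‖b j‖ ^ 2 := by
  rcases Nat.eq_zero_or_pos m with rfl | hm
  · simp
  have hm' : (0 : ℝ) < m := by exact_mod_cast hm
  have h1 : ‖∑ j ∈ Finset.range m, b j‖ ^ 2 ≤ m * ∑ j ∈ Finset.range m, ‖b j‖ ^ 2 := by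
    have := sq_sum_le_card_mul_sum_sq (s := Finset.range m) (f := fun j => ‖b j‖)
    rw [Finset.card_range] at this
    exact (pow_le_pow_left₀ (norm_nonneg _) (norm_sum_le _ _) 2).trans this
  rw [norm_smul, mul_pow, norm_inv, Real.norm_of_nonneg hm'.le]
  calc ((m : ℝ)⁻¹) ^ 2 * ‖∑ j ∈ Finset.range m, b j‖ ^ 2
      ≤ ((m : ℝ)⁻¹) ^ 2 * (m * ∑ j ∈ Finset.range m, ‖b j‖ ^ 2) := by gcongr
    _ = _ := by field_simp

/-- `A` is the centered noise, which gains the factor `1/m` from independence. `B` is the smoothing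
error, whose mean need not vanish, so only convexity of the square applies. The factors 2 come from
`(a + b)² ≤ 2 a² + 2 b²`. -/
theorem integral_norm_sq_batch_le [IsProbabilityMeasure Q] (hV : ∀ j, Measurable (V j))
    (hmap : ∀ j, μ.map (V j) = Q)
    (hind : ∀ i j, i ≠ j → IndepFun (V i) (V j) μ) (hA : MemLp A 2 Q) (hA0 : ∫ s, A s ∂Q = 0)
    (hB : MemLp B 2 Q) {m : ℕ} (hm : 0 < m) :
    Integrable (fun ω => ‖(m : ℝ)⁻¹ • ∑ j ∈ Finset.range m, (A (V j ω) + B (V j ω))‖ ^ 2) μ ∧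
      ∫ ω, ‖(m : ℝ)⁻¹ • ∑ j ∈ Finset.range m, (A (V j ω) + B (V j ω))‖ ^ 2 ∂μ ≤
        2 * (∫ s, ‖A s‖ ^ 2 ∂Q) / m + 2 * ∫ s, ‖B s‖ ^ 2 ∂Q := by
  have hm' : (0 : ℝ) < m := by exact_mod_cast hm
  obtain ⟨iA, eA⟩ := integral_norm_sq_sum_of_indep hV hmap hind hA hA0 m
  have hAV : ∀ j, MemLp (fun ω => A (V j ω)) 2 μ := fun j =>
    MemLp.comp_of_map (g := A) (by rw [hmap j]; exact hA) (hV j).aemeasurable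
  have hBV : ∀ j, MemLp (fun ω => B (V j ω)) 2 μ := fun j =>
    MemLp.comp_of_map (g := B) (by rw [hmap j]; exact hB) (hV j).aemeasurable
  have iB : ∀ j, Integrable (fun ω => ‖B (V j ω)‖ ^ 2) μ := fun j =>
    (hBV j).integrable_norm_pow (by norm_num)
  have eB : ∀ j, ∫ ω, ‖B (V j ω)‖ ^ 2 ∂μ = ∫ s, ‖B s‖ ^ 2 ∂Q := fun j => by
    rw [← hmap j, integral_map (hV j).aemeasurable]
    rw [hmap j]
    exact hB.1.norm.pow 2
  have hL : MemLp (fun ω => (m : ℝ)⁻¹ • ∑ j ∈ Finset.range m, (A (V j ω) + B (V j ω))) 2 μ :=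
    (memLp_finsetSum _ fun j _ => (hAV j).add (hBV j)).const_smul _
  refine ⟨hL.integrable_norm_pow (by norm_num), ?_⟩
  have hpt : ∀ ω, ‖(m : ℝ)⁻¹ • ∑ j ∈ Finset.range m, (A (V j ω) + B (V j ω))‖ ^ 2 ≤
      2 * ((m : ℝ)⁻¹) ^ 2 * ‖∑ j ∈ Finset.range m, A (V j ω)‖ ^ 2 +
        2 * (m : ℝ)⁻¹ * ∑ j ∈ Finset.range m, ‖B (V j ω)‖ ^ 2 := by
    intro ω
    have h2 := norm_inv_smul_sum_sq_le m fun j => B (V j ω)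
    rw [Finset.sum_add_distrib, smul_add]
    have h3 := norm_add_le ((m : ℝ)⁻¹ • ∑ j ∈ Finset.range m, A (V j ω))
      ((m : ℝ)⁻¹ • ∑ j ∈ Finset.range m, B (V j ω))
    have h4 : ‖(m : ℝ)⁻¹ • ∑ j ∈ Finset.range m, A (V j ω)‖ ^ 2 =
        ((m : ℝ)⁻¹) ^ 2 * ‖∑ j ∈ Finset.range m, A (V j ω)‖ ^ 2 := by
      rw [norm_smul, mul_pow, norm_inv, Real.norm_of_nonneg hm'.le]
    have h5 := pow_le_pow_left₀ (norm_nonneg _) h3 2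
    have h6 := add_sq_le (a := ‖(m : ℝ)⁻¹ • ∑ j ∈ Finset.range m, A (V j ω)‖)
      (b := ‖(m : ℝ)⁻¹ • ∑ j ∈ Finset.range m, B (V j ω)‖)
    linarith
  refine (integral_mono (hL.integrable_norm_pow (by norm_num))
    ((iA.const_mul _).add ((integrable_finsetSum _ fun j _ => iB j).const_mul _)) hpt).trans ?_
  simp only [Pi.add_apply]
  rw [integral_add (iA.const_mul _) ((integrable_finsetSum _ fun j _ => iB j).const_mul _),
    integral_const_mul, integral_const_mul, eA, integral_finsetSum _ fun j _ => iB j]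
  simp_rw [eB]
  rw [Finset.sum_const, Finset.card_range, nsmul_eq_mul]
  apply le_of_eq
  field_simp

end Batch

/-! ### Variance and smoothing error of one sample -/

section Estimator

variable {d : ℕ} {Ξ : Type*} [MeasurableSpace Ξ] {P : Measure Ξ} [IsProbabilityMeasure P]

/-- Dominated by `ℓ ‖w‖²`, which is square integrable since the Gaussian has a fourth moment. -/
theorem memLp_inner_smul {a : Ξ → Euc d} {ℓ : ℝ} (ha : AEStronglyMeasurable a P)
    (hb : ∀ᵐ ξ ∂P, ‖a ξ‖ ≤ ℓ) :
    MemLp (fun s : Euc d × Ξ => inner ℝ (a s.2) s.1 • s.1) 2 ((stdGaussian (Euc d)).prod P) := by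
  have hf : AEStronglyMeasurable (fun s : Euc d × Ξ => s.1) ((stdGaussian (Euc d)).prod P) :=
    measurable_fst.aestronglyMeasurable
  have hm : AEStronglyMeasurable (fun s : Euc d × Ξ => inner ℝ (a s.2) s.1 • s.1)
      ((stdGaussian (Euc d)).prod P) :=
    (AEStronglyMeasurable.inner (𝕜 := ℝ) ha.comp_snd hf).smul hf
  rw [← memLp_norm_iff hm]
  have h4 : MemLp (fun w : Euc d => ‖w‖ ^ 2) 2 (stdGaussian (Euc d)) := by
    have := (IsGaussian.memLp_id (stdGaussian (Euc d)) 4 (by norm_num)).norm_rpow_div 2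
    convert this using 1
    · ext x; simp
    · rw [ENNReal.eq_div_iff (by norm_num) (by norm_num)]; norm_num
  have h4' : MemLp (fun s : Euc d × Ξ => ℓ * ‖s.1‖ ^ 2) 2 ((stdGaussian (Euc d)).prod P) :=
    (h4.comp_fst P).const_mul ℓ
  refine h4'.mono hm.norm ?_
  have hb' : ∀ᵐ s : Euc d × Ξ ∂(stdGaussian (Euc d)).prod P, ‖a s.2‖ ≤ ℓ :=
    Measure.quasiMeasurePreserving_snd.ae hb
  filter_upwards [hb'] with s hs
  rw [norm_norm, norm_smul]
  refine le_trans ?_ (le_abs_self _)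
  have := norm_inner_le_norm (𝕜 := ℝ) (a s.2) s.1
  have h0 := norm_nonneg s.1
  nlinarith [mul_le_mul_of_nonneg_right this h0, mul_le_mul_of_nonneg_right hs (sq_nonneg ‖s.1‖)]

theorem integral_inner_smul_stdGaussian {a : Ξ → Euc d} {ℓ : ℝ} (ha : Integrable a P)
    (hb : ∀ᵐ ξ ∂P, ‖a ξ‖ ≤ ℓ) :
    ∫ s : Euc d × Ξ, inner ℝ (a s.2) s.1 • s.1 ∂(stdGaussian (Euc d)).prod P = ∫ ξ, a ξ ∂P := by
  have hi := (memLp_inner_smul ha.1 hb).integrable (by norm_num)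
  refine ext_inner_left ℝ fun b => ?_
  rw [← integral_inner hi, ← integral_inner ha]
  simp_rw [real_inner_smul_right]
  have hi2 : Integrable (fun s : Euc d × Ξ => inner ℝ (a s.2) s.1 * inner ℝ b s.1)
      ((stdGaussian (Euc d)).prod P) := by
    refine (hi.const_inner b).congr (Filter.Eventually.of_forall fun s => ?_)
    simp only [real_inner_smul_right]
  rw [integral_prod_symm _ hi2]
  refine integral_congr_ae (Filter.Eventually.of_forall fun ξ => ?_)
  simp only [stdGaussian_inner_mul_inner]
  exact real_inner_comm _ _

theorem integral_norm_sq_inner_smul_le {a : Ξ → Euc d} {ℓ : ℝ} (ha : Integrable a P)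
    (hb : ∀ᵐ ξ ∂P, ‖a ξ‖ ≤ ℓ) :
    ∫ s : Euc d × Ξ, ‖inner ℝ (a s.2) s.1 • s.1‖ ^ 2 ∂(stdGaussian (Euc d)).prod P ≤
      (d + 2) * ℓ ^ 2 := by
  have hi := (memLp_inner_smul ha.1 hb).integrable_norm_pow (by norm_num)
  rw [integral_prod_symm _ hi]
  have e : ∀ ξ, ∫ w : Euc d, ‖inner ℝ (a ξ) w • w‖ ^ 2 ∂stdGaussian (Euc d) =
      (d + 2) * ‖a ξ‖ ^ 2 := by
    intro ξ
    rw [← (stdGaussian_inner_sq_mul_norm_sq (a ξ)).2]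
    refine integral_congr_ae (Filter.Eventually.of_forall fun w => ?_)
    simp only [norm_smul, mul_pow, Real.norm_eq_abs, sq_abs]
  simp_rw [e]
  have := integral_mono_of_nonneg (μ := P) (f := fun ξ => ((d : ℝ) + 2) * ‖a ξ‖ ^ 2)
    (g := fun _ => ((d : ℝ) + 2) * ℓ ^ 2) (Filter.Eventually.of_forall fun ξ => by positivity)
    (integrable_const _) (by filter_upwards [hb] with ξ hξ; gcongr)
  simpa using this

variable {H : Euc d → Ξ → ℝ} {L : ℝ}

/-- The descent lemma at step `ν w`, divided by `ν`: one factor `ν` of the quadratic remainder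
survives. -/
theorem norm_finite_difference_sub_le {h : Euc d → ℝ} (hd : Differentiable ℝ h)
    (hL : ∀ x y, ‖gradient h x - gradient h y‖ ≤ L * ‖x - y‖) {ν : ℝ} (hν : 0 < ν) (x w : Euc d) :
    ‖((h (x + ν • w) - h x) / ν) • w - inner ℝ (gradient h x) w • w‖ ≤ ν * L / 2 * ‖w‖ ^ 3 := by
  have h1 := abs_sub_sub_inner_gradient_le hd hL x (x + ν • w)
  rw [add_sub_cancel_left, real_inner_smul_right, norm_smul, Real.norm_of_nonneg hν.le] at h1
  rw [← sub_smul, norm_smul, Real.norm_eq_abs]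
  have e : (h (x + ν • w) - h x) / ν - inner ℝ (gradient h x) w =
      (h (x + ν • w) - h x - ν * inner ℝ (gradient h x) w) / ν := by field_simp
  rw [e, abs_div, abs_of_pos hν]
  have h2 : |h (x + ν • w) - h x - ν * inner ℝ (gradient h x) w| / ν ≤ ν * L / 2 * ‖w‖ ^ 2 := by
    rw [div_le_iff₀ hν]; linarith
  have := mul_le_mul_of_nonneg_right h2 (norm_nonneg w)
  linarith

/-- Mean square error of the minibatch zeroth-order gradient estimator. -/
theorem estimator_mse (hHm : Measurable fun q : Euc d × Ξ => H q.1 q.2)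
    (hd : ∀ᵐ ξ ∂P, Differentiable ℝ fun x => H x ξ)
    (hL : ∀ᵐ ξ ∂P, ∀ x y, ‖gradient (fun x => H x ξ) x - gradient (fun x => H x ξ) y‖ ≤ L * ‖x - y‖)
    {x : Euc d} (hg : Integrable (fun ξ => gradient (fun x => H x ξ) x) P) {ℓ : ℝ}
    (hℓ : ∀ᵐ ξ ∂P, ‖gradient (fun x => H x ξ) x‖ ≤ ℓ)
    {Ω : Type*} [MeasurableSpace Ω] {μ : Measure Ω} {V : ℕ → Ω → Euc d × Ξ}
    (hV : ∀ j, Measurable (V j)) (hmap : ∀ j, μ.map (V j) = (stdGaussian (Euc d)).prod P)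
    (hind : ∀ i j, i ≠ j → IndepFun (V i) (V j) μ) {m : ℕ} (hm : 0 < m) {ν : ℝ} (hν : 0 < ν) :
    Integrable (fun ω => ‖(m : ℝ)⁻¹ • ∑ j ∈ Finset.range m,
      ((H (x + ν • (V j ω).1) (V j ω).2 - H x (V j ω).2) / ν) • (V j ω).1 -
        ∫ ξ, gradient (fun x => H x ξ) x ∂P‖ ^ 2) μ ∧
    ∫ ω, ‖(m : ℝ)⁻¹ • ∑ j ∈ Finset.range m,
      ((H (x + ν • (V j ω).1) (V j ω).2 - H x (V j ω).2) / ν) • (V j ω).1 -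
        ∫ ξ, gradient (fun x => H x ξ) x ∂P‖ ^ 2 ∂μ ≤
      4 * (d + 5) * ℓ ^ 2 / m + 3 * ν ^ 2 / 2 * L ^ 2 * (d + 6) ^ 3 := by
  set Q := (stdGaussian (Euc d)).prod P with hQ
  have hm' : (0 : ℝ) < m := by exact_mod_cast hm
  set a : Ξ → Euc d := fun ξ => gradient (fun x => H x ξ) x with ha
  -- `Z` is the linearized sample and `G` the finite difference. The error of `G` splits into the
  -- centered part `Z - E Z` and the smoothing error `G - Z`.
  set Z : Euc d × Ξ → Euc d := fun s => inner ℝ (a s.2) s.1 • s.1 with hZ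
  set G : Euc d × Ξ → Euc d := fun s => ((H (x + ν • s.1) s.2 - H x s.2) / ν) • s.1 with hG
  have hZL : MemLp Z 2 Q := memLp_inner_smul hg.1 hℓ
  have hZi : ∫ s, Z s ∂Q = ∫ ξ, a ξ ∂P := integral_inner_smul_stdGaussian hg hℓ
  have hGm : Measurable G := by
    have h1 : Measurable fun s : Euc d × Ξ => H (x + ν • s.1) s.2 :=
      hHm.comp (f := fun s : Euc d × Ξ => (x + ν • s.1, s.2)) (by fun_prop)
    have h2 : Measurable fun s : Euc d × Ξ => H x s.2 :=
      hHm.comp (f := fun s : Euc d × Ξ => (x, s.2)) (by fun_prop)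
    exact ((h1.sub h2).div_const ν).smul measurable_fst
  have hA : MemLp (fun s => Z s - ∫ ξ, a ξ ∂P) 2 Q := hZL.sub (memLp_const _)
  have hA0 : ∫ s, (Z s - ∫ ξ, a ξ ∂P) ∂Q = 0 := by
    rw [integral_sub (hZL.integrable (by norm_num)) (integrable_const _), hZi]; simp
  have hbd : ∀ᵐ s ∂Q, ‖G s - Z s‖ ≤ ν * L / 2 * ‖s.1‖ ^ 3 := by
    have h1 : ∀ᵐ s ∂Q, Differentiable ℝ fun x => H x s.2 :=
      Measure.quasiMeasurePreserving_snd.ae hd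
    have h2 : ∀ᵐ s ∂Q, ∀ x y, ‖gradient (fun x => H x s.2) x - gradient (fun x => H x s.2) y‖ ≤
        L * ‖x - y‖ := Measure.quasiMeasurePreserving_snd.ae hL
    filter_upwards [h1, h2] with s h1 h2
    exact norm_finite_difference_sub_le h1 h2 hν x s.1
  have h6 : Integrable (fun s : Euc d × Ξ => (ν * L / 2) ^ 2 * ‖s.1‖ ^ 6) Q :=
    (stdGaussian_norm_pow_six.1.comp_fst P).const_mul _
  have hbd2 : ∀ᵐ s ∂Q, ‖G s - Z s‖ ^ 2 ≤ (ν * L / 2) ^ 2 * ‖s.1‖ ^ 6 := by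
    filter_upwards [hbd] with s hs
    refine (pow_le_pow_left₀ (norm_nonneg _) hs 2).trans (le_of_eq (by ring))
  have hBm : AEStronglyMeasurable (fun s => G s - Z s) Q := hGm.aestronglyMeasurable.sub hZL.1
  have hB : MemLp (fun s => G s - Z s) 2 Q := by
    rw [memLp_two_iff_integrable_sq_norm hBm]
    refine h6.mono' (hBm.norm.pow 2) ?_
    filter_upwards [hbd2] with s hs
    rwa [Real.norm_of_nonneg (sq_nonneg _)]
  have hBint : ∫ s, ‖G s - Z s‖ ^ 2 ∂Q ≤ (ν * L / 2) ^ 2 * (d * (d + 2) * (d + 4)) := by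
    refine (integral_mono_ae (hB.integrable_norm_pow (by norm_num)) h6 hbd2).trans ?_
    rw [integral_const_mul, integral_fun_fst (fun w : Euc d => ‖w‖ ^ 6),
      stdGaussian_norm_pow_six.2]
    simp
  -- The variance is at most the second moment.
  have hAint : ∫ s, ‖Z s - ∫ ξ, a ξ ∂P‖ ^ 2 ∂Q ≤ (d + 2) * ℓ ^ 2 := by
    have hZ2 := hZL.integrable_norm_pow (p := 2) (by norm_num)
    have hZin : Integrable (fun s => inner ℝ (Z s) (∫ ξ, a ξ ∂P)) Q :=
      (hZL.integrable (by norm_num)).inner_const _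
    have e : ∀ s, ‖Z s - ∫ ξ, a ξ ∂P‖ ^ 2 =
        ‖Z s‖ ^ 2 - 2 * inner ℝ (Z s) (∫ ξ, a ξ ∂P) + ‖∫ ξ, a ξ ∂P‖ ^ 2 := fun s =>
      norm_sub_sq_real _ _
    have e2 : ∫ s, inner ℝ (Z s) (∫ ξ, a ξ ∂P) ∂Q = ‖∫ ξ, a ξ ∂P‖ ^ 2 := by
      simp_rw [real_inner_comm]
      rw [integral_inner (hZL.integrable (by norm_num)), hZi, real_inner_self_eq_norm_sq]
    have h1 : Integrable (fun s => ‖Z s‖ ^ 2 - 2 * inner ℝ (Z s) (∫ ξ, a ξ ∂P)) Q :=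
      hZ2.sub (hZin.const_mul 2)
    simp_rw [e]
    rw [integral_add h1 (integrable_const _), integral_sub hZ2 (hZin.const_mul 2),
      integral_const_mul, e2]
    have := integral_norm_sq_inner_smul_le hg hℓ
    simp only [integral_const, probReal_univ, one_smul]
    linarith [sq_nonneg ‖∫ ξ, a ξ ∂P‖]
  obtain ⟨hI, hle⟩ := integral_norm_sq_batch_le hV hmap hind hA hA0 hB hm
  have e : ∀ ω, (m : ℝ)⁻¹ • ∑ j ∈ Finset.range m,
      ((Z (V j ω) - ∫ ξ, a ξ ∂P) + (G (V j ω) - Z (V j ω))) =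
      (m : ℝ)⁻¹ • ∑ j ∈ Finset.range m, G (V j ω) - ∫ ξ, a ξ ∂P := by
    intro ω
    have : ∀ j ∈ Finset.range m, (Z (V j ω) - ∫ ξ, a ξ ∂P) + (G (V j ω) - Z (V j ω)) =
        G (V j ω) - ∫ ξ, a ξ ∂P := fun j _ => by abel
    rw [Finset.sum_congr rfl this, Finset.sum_sub_distrib, smul_sub, Finset.sum_const,
      Finset.card_range, ← Nat.cast_smul_eq_nsmul ℝ, smul_smul, inv_mul_cancel₀ hm'.ne', one_smul]
  simp_rw [e] at hI hle
  refine ⟨hI, hle.trans ?_⟩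
  have hd0 : (0 : ℝ) ≤ d := Nat.cast_nonneg d
  -- The Gaussian moments give `2 (d + 2) ℓ² / m` and `ν² L² d (d + 2) (d + 4) / 2`; the stated
  -- constants are larger.
  have t1 : 2 * (∫ s, ‖Z s - ∫ ξ, a ξ ∂P‖ ^ 2 ∂Q) / m ≤ 4 * (d + 5) * ℓ ^ 2 / m := by
    refine div_le_div_of_nonneg_right ?_ hm'.le
    nlinarith [sq_nonneg ℓ, mul_nonneg hd0 (sq_nonneg ℓ)]
  have t2 : 2 * ((ν * L / 2) ^ 2 * ((d : ℝ) * (d + 2) * (d + 4))) ≤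
      3 * ν ^ 2 / 2 * L ^ 2 * (d + 6) ^ 3 := by
    have : (d : ℝ) * (d + 2) * (d + 4) ≤ 3 * (d + 6) ^ 3 := by
      nlinarith [pow_nonneg hd0 3, sq_nonneg (d : ℝ)]
    nlinarith [mul_le_mul_of_nonneg_left this (by positivity : 0 ≤ ν ^ 2 * L ^ 2)]
  linarith

end Estimator

theorem strongConvexOn_integral {E : Type*} [NormedAddCommGroup E] [NormedSpace ℝ E] {Ξ : Type*}
    [MeasurableSpace Ξ] {P : Measure Ξ} [IsProbabilityMeasure P] {H : E → Ξ → ℝ} {s : Set E} {m : ℝ}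
    (hs : Convex ℝ s) (hint : ∀ x, Integrable (H x) P)
    (hH : ∀ᵐ ξ ∂P, StrongConvexOn s m fun x => H x ξ) :
    StrongConvexOn s m fun x => ∫ ξ, H x ξ ∂P := by
  refine ⟨hs, fun x hx y hy a b ha hb hab => ?_⟩
  have i1 : Integrable (fun ξ => a * H x ξ + b * H y ξ) P :=
    ((hint x).const_mul a).add ((hint y).const_mul b)
  have h1 : ∫ ξ, H (a • x + b • y) ξ ∂P ≤
      ∫ ξ, (a * H x ξ + b * H y ξ - a * b * (m / 2 * ‖x - y‖ ^ 2)) ∂P := by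
    refine integral_mono_ae (hint _) (i1.sub (integrable_const _)) ?_
    filter_upwards [hH] with ξ hξ
    simpa using hξ.2 hx hy ha hb hab
  rw [integral_sub i1 (integrable_const _), integral_add ((hint x).const_mul a)
    ((hint y).const_mul b), integral_const_mul, integral_const_mul] at h1
  simpa using h1

theorem Constants.two_mul_C1 (c : Constants) : 2 * c.C1 = c.LG * (c.DX ^ 2 + c.DY ^ 2) := by
  rw [Constants.C1]; ring

namespace SaddleProblem

variable {c : Constants} (p : SaddleProblem.{u} c)

/-! ### The objective of a saddle-point problem -/

theorem differentiable_F_X :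
    ∀ᵐ ξ ∂p.P, ∀ y, Differentiable ℝ fun x => p.F x y ξ := by
  filter_upwards [p.contDiff_F] with ξ h y
  have h1 := h.differentiable one_ne_zero
  exact h1.comp (f := fun x : Euc p.dX => (x, y)) (by fun_prop)

theorem differentiable_F_Y :
    ∀ᵐ ξ ∂p.P, ∀ x, Differentiable ℝ fun y => p.F x y ξ := by
  filter_upwards [p.contDiff_F] with ξ h x
  have h1 := h.differentiable one_ne_zero
  exact h1.comp (f := fun y : Euc p.dY => (x, y)) (by fun_prop)

theorem integral_gradient_X {x : Euc p.dX} {y : Euc p.dY} (hx : x ∈ p.X) (hy : y ∈ p.Y) :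
    ∫ ξ, gradient (fun x' => p.F x' y ξ) x ∂p.P = p.gradX (x, y) := p.unbiased_gradX x hx y hy

theorem integral_gradient_Y {x : Euc p.dX} {y : Euc p.dY} (hx : x ∈ p.X) (hy : y ∈ p.Y) :
    ∫ ξ, gradient (fun y' => p.F x y' ξ) y ∂p.P = p.gradY (x, y) := p.unbiased_gradY x hx y hy

section Basic

variable {x x₁ x₂ : Euc p.dX} {y y₁ y₂ : Euc p.dY}

theorem hasGradientAt_X (hx : x ∈ p.X) (hy : y ∈ p.Y) :
    HasGradientAt (fun x => p.f x y) (p.gradX (x, y)) x := by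
  rw [← p.integral_gradient_X hx hy]
  exact hasGradientAt_integral (H := fun x ξ => p.F x y ξ) (L := c.LGX)
    (fun x => p.integrable_F x y) (by filter_upwards [p.differentiable_F_X] with ξ h using h y)
    (by filter_upwards [p.lipGrad_X] with ξ h x₁ x₂ using h x₁ x₂ y hy)
    (p.integrable_gradX x hx y hy)

theorem hasGradientAt_Y (hx : x ∈ p.X) (hy : y ∈ p.Y) :
    HasGradientAt (fun y => p.f x y) (p.gradY (x, y)) y := by
  rw [← p.integral_gradient_Y hx hy]
  exact hasGradientAt_integral (H := fun y ξ => p.F x y ξ) (L := c.LGY)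
    (fun y => p.integrable_F x y) (by filter_upwards [p.differentiable_F_Y] with ξ h using h x)
    (by filter_upwards [p.lipGrad_Y] with ξ h y₁ y₂ using h x hx y₁ y₂)
    (p.integrable_gradY x hx y hy)

theorem smooth_X (hx : x₁ ∈ p.X) (hy : y ∈ p.Y) :
    |p.f x₂ y - p.f x₁ y - inner ℝ (p.gradX (x₁, y)) (x₂ - x₁)| ≤ c.LGX / 2 * ‖x₂ - x₁‖ ^ 2 := by
  rw [← p.integral_gradient_X hx hy]
  exact abs_integral_sub_sub_inner_le (H := fun x ξ => p.F x y ξ)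
    (fun x => p.integrable_F x y) (by filter_upwards [p.differentiable_F_X] with ξ h using h y)
    (by filter_upwards [p.lipGrad_X] with ξ h x₁ x₂ using h x₁ x₂ y hy)
    (p.integrable_gradX x₁ hx y hy) x₂

theorem smooth_Y (hx : x ∈ p.X) (hy : y₁ ∈ p.Y) :
    |p.f x y₂ - p.f x y₁ - inner ℝ (p.gradY (x, y₁)) (y₂ - y₁)| ≤ c.LGY / 2 * ‖y₂ - y₁‖ ^ 2 := by
  rw [← p.integral_gradient_Y hx hy]
  exact abs_integral_sub_sub_inner_le (H := fun y ξ => p.F x y ξ)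
    (fun y => p.integrable_F x y) (by filter_upwards [p.differentiable_F_Y] with ξ h using h x)
    (by filter_upwards [p.lipGrad_Y] with ξ h y₁ y₂ using h x hx y₁ y₂)
    (p.integrable_gradY x hx y₁ hy) y₂

theorem strongConvex_lower (hx₁ : x₁ ∈ p.X) (hx₂ : x₂ ∈ p.X) (hy : y ∈ p.Y) :
    p.f x₁ y + inner ℝ (p.gradX (x₁, y)) (x₂ - x₁) + c.μX / 2 * ‖x₂ - x₁‖ ^ 2 ≤ p.f x₂ y := by
  have h : StrongConvexOn p.X c.μX fun x => p.f x y :=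
    strongConvexOn_integral (H := fun x ξ => p.F x y ξ) p.convex_X (fun x => p.integrable_F x y)
      (by filter_upwards [p.strongConvex] with ξ h using h y hy)
  exact h.add_inner_add_le hx₁ hx₂ (p.hasGradientAt_X hx₁ hy)

theorem strongConcave_upper (hx : x ∈ p.X) (hy₁ : y₁ ∈ p.Y) (hy₂ : y₂ ∈ p.Y) :
    p.f x y₂ ≤ p.f x y₁ + inner ℝ (p.gradY (x, y₁)) (y₂ - y₁) - c.μY / 2 * ‖y₂ - y₁‖ ^ 2 := by
  have h : StrongConvexOn p.Y c.μY fun y => ∫ ξ, -p.F x y ξ ∂p.P :=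
    strongConvexOn_integral (H := fun y ξ => -p.F x y ξ) p.convex_Y
      (fun y => (p.integrable_F x y).neg)
      (by filter_upwards [p.strongConcave] with ξ h using (h x hx).neg)
  simp_rw [integral_neg] at h
  have hg : HasGradientAt (fun y => -∫ ξ, p.F x y ξ ∂p.P) (-p.gradY (x, y₁)) y₁ := by
    have h1 := (p.hasGradientAt_Y hx hy₁).hasFDerivAt.neg
    rw [hasGradientAt_iff_hasFDerivAt, map_neg]
    exact h1
  have h2 := h.add_inner_add_le hy₁ hy₂ hg
  rw [inner_neg_left] at h2
  simp only [f]
  linarith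

theorem norm_gradX_sub_X (hx₁ : x₁ ∈ p.X) (hx₂ : x₂ ∈ p.X) (hy : y ∈ p.Y) :
    ‖p.gradX (x₁, y) - p.gradX (x₂, y)‖ ≤ c.LGX * ‖x₁ - x₂‖ := by
  rw [← p.integral_gradient_X hx₁ hy, ← p.integral_gradient_X hx₂ hy,
    ← integral_sub (p.integrable_gradX x₁ hx₁ y hy) (p.integrable_gradX x₂ hx₂ y hy)]
  simpa using norm_integral_le_of_norm_le_const (μ := p.P)
    (by filter_upwards [p.lipGrad_X] with ξ h using h x₁ x₂ y hy)

theorem norm_gradX_sub_Y (hx : x ∈ p.X) (hy₁ : y₁ ∈ p.Y) (hy₂ : y₂ ∈ p.Y) :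
    ‖p.gradX (x, y₁) - p.gradX (x, y₂)‖ ≤ c.LXY * ‖y₁ - y₂‖ := by
  rw [← p.integral_gradient_X hx hy₁, ← p.integral_gradient_X hx hy₂,
    ← integral_sub (p.integrable_gradX x hx y₁ hy₁) (p.integrable_gradX x hx y₂ hy₂)]
  simpa using norm_integral_le_of_norm_le_const (μ := p.P)
    (by filter_upwards [p.lipGrad_XY] with ξ h using h x hx y₁ hy₁ y₂ hy₂)

theorem norm_gradY_sub_X (hx₁ : x₁ ∈ p.X) (hx₂ : x₂ ∈ p.X) (hy : y ∈ p.Y) :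
    ‖p.gradY (x₁, y) - p.gradY (x₂, y)‖ ≤ c.LYX * ‖x₁ - x₂‖ := by
  rw [← p.integral_gradient_Y hx₁ hy, ← p.integral_gradient_Y hx₂ hy,
    ← integral_sub (p.integrable_gradY x₁ hx₁ y hy) (p.integrable_gradY x₂ hx₂ y hy)]
  simpa using norm_integral_le_of_norm_le_const (μ := p.P)
    (by filter_upwards [p.lipGrad_YX] with ξ h using h x₁ hx₁ x₂ hx₂ y hy)

theorem norm_gradY_sub_Y (hx : x ∈ p.X) (hy₁ : y₁ ∈ p.Y) (hy₂ : y₂ ∈ p.Y) :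
    ‖p.gradY (x, y₁) - p.gradY (x, y₂)‖ ≤ c.LGY * ‖y₁ - y₂‖ := by
  rw [← p.integral_gradient_Y hx hy₁, ← p.integral_gradient_Y hx hy₂,
    ← integral_sub (p.integrable_gradY x hx y₁ hy₁) (p.integrable_gradY x hx y₂ hy₂)]
  simpa using norm_integral_le_of_norm_le_const (μ := p.P)
    (by filter_upwards [p.lipGrad_Y] with ξ h using h x hx y₁ y₂)

theorem abs_f_sub_X (hx₁ : x₁ ∈ p.X) (hx₂ : x₂ ∈ p.X) (hy : y ∈ p.Y) :
    |p.f x₁ y - p.f x₂ y| ≤ c.LX * ‖x₁ - x₂‖ := by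
  rw [f, f, ← integral_sub (p.integrable_F x₁ y) (p.integrable_F x₂ y)]
  simpa using norm_integral_le_of_norm_le_const (μ := p.P) (f := fun ξ => p.F x₁ y ξ - p.F x₂ y ξ)
    (by filter_upwards [p.lipschitz_X] with ξ h using h x₁ hx₁ x₂ hx₂ y hy)

theorem abs_f_sub_Y (hx : x ∈ p.X) (hy₁ : y₁ ∈ p.Y) (hy₂ : y₂ ∈ p.Y) :
    |p.f x y₁ - p.f x y₂| ≤ c.LY * ‖y₁ - y₂‖ := by
  rw [f, f, ← integral_sub (p.integrable_F x y₁) (p.integrable_F x y₂)]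
  simpa using norm_integral_le_of_norm_le_const (μ := p.P) (f := fun ξ => p.F x y₁ ξ - p.F x y₂ ξ)
    (by filter_upwards [p.lipschitz_Y] with ξ h using h x hx y₁ hy₁ y₂ hy₂)

end Basic

/-! ### The constants of a problem -/

theorem xs_mem_X : p.xs ∈ p.X := interior_subset p.xs_mem

theorem ys_mem_Y : p.ys ∈ p.Y := interior_subset p.ys_mem

theorem nontrivial_euc {d : ℕ} (hd : 0 < d) : Nontrivial (Euc d) := by
  have : Nonempty (Fin d) := ⟨⟨0, hd⟩⟩
  infer_instance

theorem δX_pos (p : SaddleProblem.{u} c) : 0 < c.δX := by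
  have := nontrivial_euc p.dX_pos
  rw [← p.border_X]
  exact (closedBall_infDist_frontier_subset p.compact_X p.xs_mem).2.1

theorem δY_pos (p : SaddleProblem.{u} c) : 0 < c.δY := by
  have := nontrivial_euc p.dY_pos
  rw [← p.border_Y]
  exact (closedBall_infDist_frontier_subset p.compact_Y p.ys_mem).2.1

theorem closedBall_subset_X : Metric.closedBall p.xs c.δX ⊆ p.X := by
  have := nontrivial_euc p.dX_pos
  rw [← p.border_X]
  exact (closedBall_infDist_frontier_subset p.compact_X p.xs_mem).1

theorem closedBall_subset_Y : Metric.closedBall p.ys c.δY ⊆ p.Y := by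
  have := nontrivial_euc p.dY_pos
  rw [← p.border_Y]
  exact (closedBall_infDist_frontier_subset p.compact_Y p.ys_mem).1

/-- Provides two distinct points of `X`. Comparing the Lipschitz bounds along this segment forces
the signs of the constants, which are not part of the data. -/
theorem exists_norm_eq_δX : ∃ b ∈ p.X, ‖p.xs - b‖ = c.δX := by
  have := nontrivial_euc p.dX_pos
  obtain ⟨b, hb, h, _⟩ := (closedBall_infDist_frontier_subset p.compact_X p.xs_mem).2.2
  exact ⟨b, hb, h.trans p.border_X⟩

theorem exists_norm_eq_δY : ∃ b ∈ p.Y, ‖p.ys - b‖ = c.δY := by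
  have := nontrivial_euc p.dY_pos
  obtain ⟨b, hb, h, _⟩ := (closedBall_infDist_frontier_subset p.compact_Y p.ys_mem).2.2
  exact ⟨b, hb, h.trans p.border_Y⟩

theorem δX_le (p : SaddleProblem.{u} c) : c.δX ≤ c.DX := by
  obtain ⟨b, hb, h⟩ := p.exists_norm_eq_δX
  exact h ▸ p.dist_X _ p.xs_mem_X _ hb

theorem δY_le (p : SaddleProblem.{u} c) : c.δY ≤ c.DY := by
  obtain ⟨b, hb, h⟩ := p.exists_norm_eq_δY
  exact h ▸ p.dist_Y _ p.ys_mem_Y _ hb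

theorem DX_pos (p : SaddleProblem.{u} c) : 0 < c.DX := p.δX_pos.trans_le p.δX_le

theorem DY_pos (p : SaddleProblem.{u} c) : 0 < c.DY := p.δY_pos.trans_le p.δY_le

theorem LX_nonneg (p : SaddleProblem.{u} c) : 0 ≤ c.LX := by
  obtain ⟨b, hb, h⟩ := p.exists_norm_eq_δX
  have := (abs_nonneg _).trans (p.abs_f_sub_X p.xs_mem_X hb p.ys_mem_Y)
  exact nonneg_of_mul_nonneg_left this (h ▸ p.δX_pos)

theorem LY_nonneg (p : SaddleProblem.{u} c) : 0 ≤ c.LY := by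
  obtain ⟨b, hb, h⟩ := p.exists_norm_eq_δY
  have := (abs_nonneg _).trans (p.abs_f_sub_Y p.xs_mem_X p.ys_mem_Y hb)
  exact nonneg_of_mul_nonneg_left this (h ▸ p.δY_pos)

theorem LXY_nonneg (p : SaddleProblem.{u} c) : 0 ≤ c.LXY := by
  obtain ⟨b, hb, h⟩ := p.exists_norm_eq_δY
  have := (norm_nonneg _).trans (p.norm_gradX_sub_Y p.xs_mem_X p.ys_mem_Y hb)
  exact nonneg_of_mul_nonneg_left this (h ▸ p.δY_pos)

theorem LYX_nonneg (p : SaddleProblem.{u} c) : 0 ≤ c.LYX := by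
  obtain ⟨b, hb, h⟩ := p.exists_norm_eq_δX
  have := (norm_nonneg _).trans (p.norm_gradY_sub_X p.xs_mem_X hb p.ys_mem_Y)
  exact nonneg_of_mul_nonneg_left this (h ▸ p.δX_pos)

/-- Strong convexity from below and smoothness from above, on one segment of length `δX`. Positivity
of `LGX`, and through it of `LG` and `C1`, rests on this. -/
theorem μX_le (p : SaddleProblem.{u} c) : c.μX ≤ c.LGX := by
  obtain ⟨b, hb, h⟩ := p.exists_norm_eq_δX
  have h1 := (abs_le.1 (p.smooth_X (x₂ := p.xs) hb p.ys_mem_Y)).2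
  have h2 := p.strongConvex_lower hb p.xs_mem_X p.ys_mem_Y
  rw [h] at h1 h2
  have := pow_pos p.δX_pos 2
  by_contra hlt
  nlinarith [mul_pos (sub_pos.2 (not_le.1 hlt)) this]

theorem μY_le (p : SaddleProblem.{u} c) : c.μY ≤ c.LGY := by
  obtain ⟨b, hb, h⟩ := p.exists_norm_eq_δY
  have h1 := (abs_le.1 (p.smooth_Y (y₂ := p.ys) p.xs_mem_X hb)).1
  have h2 := p.strongConcave_upper p.xs_mem_X hb p.ys_mem_Y
  rw [h] at h1 h2
  have := pow_pos p.δY_pos 2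
  by_contra hlt
  nlinarith [mul_pos (sub_pos.2 (not_le.1 hlt)) this]

theorem LGX_pos (p : SaddleProblem.{u} c) : 0 < c.LGX := p.μX_pos.trans_le p.μX_le

theorem LGY_pos (p : SaddleProblem.{u} c) : 0 < c.LGY := p.μY_pos.trans_le p.μY_le

theorem LG_pos (p : SaddleProblem.{u} c) : 0 < c.LG := p.LGX_pos.trans_le (le_max_left _ _)

theorem C1_pos (p : SaddleProblem.{u} c) : 0 < c.C1 := by
  have h := p.LG_pos
  have h1 := mul_pos h (pow_pos p.DX_pos 2)
  have h2 := mul_pos h (pow_pos p.DY_pos 2)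
  rw [Constants.C1]; linarith

theorem δμ_pos (p : SaddleProblem.{u} c) : 0 < c.δμ :=
  Real.sqrt_pos.2 (lt_min (mul_pos p.μX_pos (pow_pos p.δX_pos 2))
    (mul_pos p.μY_pos (pow_pos p.δY_pos 2)))

theorem δμ_sq (p : SaddleProblem.{u} c) : c.δμ ^ 2 = min (c.μX * c.δX ^ 2) (c.μY * c.δY ^ 2) :=
  Real.sq_sqrt (le_min (mul_pos p.μX_pos (pow_pos p.δX_pos 2)).le
    (mul_pos p.μY_pos (pow_pos p.δY_pos 2)).le)

/-- The definition of `C0` solved for the cross-Lipschitz constant. The modulus is `μY` because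
`LXY` multiplies a distance in `y`. -/
theorem coupling_X (p : SaddleProblem.{u} c) : c.DX * c.LXY ≤ (1 - c.C0) * c.δμ / √2 * √c.μY := by
  have h1 := Real.sqrt_pos.2 p.μY_pos
  have h2 := p.δμ_pos
  have h := le_max_left (c.DX * c.LXY / √c.μY) (c.DY * c.LYX / √c.μX)
  have h3 : √(2 : ℝ) ≠ 0 := by positivity
  rw [Constants.C0]
  rw [div_le_iff₀ h1] at h
  refine h.trans (le_of_eq ?_)
  field_simp
  ring

theorem coupling_Y (p : SaddleProblem.{u} c) : c.DY * c.LYX ≤ (1 - c.C0) * c.δμ / √2 * √c.μX := by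
  have h1 := Real.sqrt_pos.2 p.μX_pos
  have h2 := p.δμ_pos
  have h := le_max_right (c.DX * c.LXY / √c.μY) (c.DY * c.LYX / √c.μX)
  have h3 : √(2 : ℝ) ≠ 0 := by positivity
  rw [Constants.C0]
  rw [div_le_iff₀ h1] at h
  refine h.trans (le_of_eq ?_)
  field_simp
  ring

theorem C0_le_one (p : SaddleProblem.{u} c) : c.C0 ≤ 1 := by
  have h0 : 0 ≤ √2 / c.δμ * max (c.DX * c.LXY / √c.μY) (c.DY * c.LYX / √c.μX) := by
    have h1 := p.δμ_pos
    have h2 := p.DX_pos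
    have h3 := p.LXY_nonneg
    exact mul_nonneg (by positivity) (le_max_of_le_left (by positivity))
  rw [Constants.C0]; linarith

theorem gradX_saddle : p.gradX (p.xs, p.ys) = 0 := by
  have h : IsLocalMin (fun x => p.f x p.ys) p.xs := by
    filter_upwards [mem_interior_iff_mem_nhds.1 p.xs_mem] with x hx using p.saddle_X x hx
  have := h.hasFDerivAt_eq_zero (p.hasGradientAt_X p.xs_mem_X p.ys_mem_Y).hasFDerivAt
  simpa using this

theorem gradY_saddle : p.gradY (p.xs, p.ys) = 0 := by
  have h : IsLocalMax (fun y => p.f p.xs y) p.ys := by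
    filter_upwards [mem_interior_iff_mem_nhds.1 p.ys_mem] with y hy using p.saddle_Y y hy
  have := h.hasFDerivAt_eq_zero (p.hasGradientAt_Y p.xs_mem_X p.ys_mem_Y).hasFDerivAt
  simpa using this

theorem norm_gradient_F_X_le {x : Euc p.dX} {y : Euc p.dY} (hx : x ∈ p.X) (hy : y ∈ p.Y) :
    ∀ᵐ ξ ∂p.P, ‖gradient (fun x' => p.F x' y ξ) x‖ ≤ c.LX := by
  filter_upwards [p.differentiable_F_X, p.lipGrad_X, p.lipschitz_X] with ξ h1 h2 h3
  have hc : LipschitzWith c.LGX.toNNReal (gradient fun x' => p.F x' y ξ) :=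
    LipschitzWith.of_dist_le_mul fun a b => by
      rw [dist_eq_norm, dist_eq_norm, Real.coe_toNNReal _ p.LGX_pos.le]
      exact h2 a b y hy
  exact norm_gradient_le_of_lipschitzOn p.LX_nonneg p.convex_X ⟨_, p.xs_mem⟩ hc.continuous (h1 y)
    (fun a ha b hb => h3 a ha b hb y hy) hx

theorem norm_gradient_F_Y_le {x : Euc p.dX} {y : Euc p.dY} (hx : x ∈ p.X) (hy : y ∈ p.Y) :
    ∀ᵐ ξ ∂p.P, ‖gradient (fun y' => p.F x y' ξ) y‖ ≤ c.LY := by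
  filter_upwards [p.differentiable_F_Y, p.lipGrad_Y, p.lipschitz_Y] with ξ h1 h2 h3
  have hc : LipschitzWith c.LGY.toNNReal (gradient fun y' => p.F x y' ξ) :=
    LipschitzWith.of_dist_le_mul fun a b => by
      rw [dist_eq_norm, dist_eq_norm, Real.coe_toNNReal _ p.LGY_pos.le]
      exact h2 x hx a b
  exact norm_gradient_le_of_lipschitzOn p.LY_nonneg p.convex_Y ⟨_, p.ys_mem⟩ hc.continuous (h1 x)
    (fun a ha b hb => h3 x hx a ha b hb) hy

end SaddleProblem

theorem Constants.LGX_le_LG (c : Constants) : c.LGX ≤ c.LG := le_max_left _ _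

theorem Constants.LGY_le_LG (c : Constants) : c.LGY ≤ c.LG := le_max_right _ _

namespace SaddleProblem

variable {c : Constants} (p : SaddleProblem.{u} c)

/-! ### The merit function and the Frank-Wolfe gap -/

/-- The monotone operator `(∇ₓ f, -∇_y f)`. -/
def op (z : p.Point) : p.Point := (p.gradX z, -p.gradY z)

theorem pairing_add_left (w₁ w₂ r : p.Point) :
    p.pairing (w₁ + w₂) r = p.pairing w₁ r + p.pairing w₂ r := by
  simp only [pairing, Prod.fst_add, Prod.snd_add, inner_add_left]; ring

theorem pairing_sub_left (w₁ w₂ r : p.Point) :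
    p.pairing (w₁ - w₂) r = p.pairing w₁ r - p.pairing w₂ r := by
  simp only [pairing, Prod.fst_sub, Prod.snd_sub, inner_sub_left]; ring

theorem pairing_sub_right (w r₁ r₂ : p.Point) :
    p.pairing w (r₁ - r₂) = p.pairing w r₁ - p.pairing w r₂ := by
  simp only [pairing, Prod.fst_sub, Prod.snd_sub, inner_sub_right]; ring

theorem continuous_pairing : Continuous fun q : p.Point × p.Point => p.pairing q.1 q.2 := by
  unfold pairing; fun_prop

theorem isCompact_domain : IsCompact (p.X ×ˢ p.Y) := p.compact_X.prod p.compact_Y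

theorem domain_nonempty : (p.X ×ˢ p.Y).Nonempty := ⟨(p.xs, p.ys), p.xs_mem_X, p.ys_mem_Y⟩

/-- Distances in the domain, measured against a direction. -/
theorem pairing_sub_le {w₁ w₂ : p.Point} (h₁ : w₁ ∈ p.X ×ˢ p.Y) (h₂ : w₂ ∈ p.X ×ˢ p.Y)
    (r : p.Point) : p.pairing (w₁ - w₂) r ≤ c.DX * ‖r.1‖ + c.DY * ‖r.2‖ := by
  refine add_le_add ((real_inner_le_norm _ _).trans ?_) ((real_inner_le_norm _ _).trans ?_)
  · exact mul_le_mul_of_nonneg_right (p.dist_X _ h₁.1 _ h₂.1) (norm_nonneg _)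
  · exact mul_le_mul_of_nonneg_right (p.dist_Y _ h₁.2 _ h₂.2) (norm_nonneg _)

variable {z : p.Point}

theorem le_merit (hz : z ∈ p.X ×ˢ p.Y) :
    c.μX / 2 * ‖z.1 - p.xs‖ ^ 2 + c.μY / 2 * ‖z.2 - p.ys‖ ^ 2 ≤ p.merit z := by
  have h1 := p.strongConvex_lower p.xs_mem_X hz.1 p.ys_mem_Y
  have h2 := p.strongConcave_upper p.xs_mem_X p.ys_mem_Y hz.2
  rw [gradX_saddle, inner_zero_left] at h1
  rw [gradY_saddle, inner_zero_left] at h2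
  rw [merit]; linarith

theorem merit_nonneg (hz : z ∈ p.X ×ˢ p.Y) : 0 ≤ p.merit z := by
  have h1 := p.μX_pos
  have h2 := p.μY_pos
  exact le_trans (by positivity) (p.le_merit hz)

/-- Smoothness expanded at the saddle point, where the linear terms vanish. This bound removes the
starting point from the complexity estimates and settles full adaptive steps. -/
theorem merit_le_C1 (hz : z ∈ p.X ×ˢ p.Y) : p.merit z ≤ c.C1 := by
  have h1 := (abs_le.1 (p.smooth_X (x₂ := z.1) p.xs_mem_X p.ys_mem_Y)).2
  have h2 := (abs_le.1 (p.smooth_Y (y₂ := z.2) p.xs_mem_X p.ys_mem_Y)).1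
  rw [gradX_saddle, inner_zero_left] at h1
  rw [gradY_saddle, inner_zero_left] at h2
  have h3 : c.LGX / 2 * ‖z.1 - p.xs‖ ^ 2 ≤ c.LG / 2 * c.DX ^ 2 := by
    have := p.LGX_pos
    have := p.dist_X _ hz.1 _ p.xs_mem_X
    have := p.LG_pos
    have := c.LGX_le_LG
    gcongr
  have h4 : c.LGY / 2 * ‖z.2 - p.ys‖ ^ 2 ≤ c.LG / 2 * c.DY ^ 2 := by
    have := p.LGY_pos
    have := p.dist_Y _ hz.2 _ p.ys_mem_Y
    have := p.LG_pos
    have := c.LGY_le_LG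
    gcongr
  rw [merit, Constants.C1]; linarith

theorem continuous_pairing_sub (z r : p.Point) :
    Continuous fun w : p.Point => p.pairing (z - w) r :=
  p.continuous_pairing.comp (f := fun w : p.Point => (z - w, r)) (by fun_prop)

theorem pairing_le_fwGap (z : p.Point) {w : p.Point} (hw : w ∈ p.X ×ˢ p.Y) :
    p.pairing (z - w) (p.op z) ≤ p.fwGap z :=
  le_csSup (p.isCompact_domain.bddAbove_image (p.continuous_pairing_sub z _).continuousOn)
    (Set.mem_image_of_mem _ hw)

theorem exists_fwGap_eq (z : p.Point) :
    ∃ w ∈ p.X ×ˢ p.Y, p.fwGap z = p.pairing (z - w) (p.op z) :=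
  p.isCompact_domain.exists_sSup_image_eq p.domain_nonempty
    (p.continuous_pairing_sub z _).continuousOn

/-- Sum of the first order bounds in `x` and in `y` from `z` to the saddle point; the two
occurrences of `f(z)` cancel. -/
theorem merit_add_le_pairing (hz : z ∈ p.X ×ˢ p.Y) :
    p.merit z + c.μX / 2 * ‖z.1 - p.xs‖ ^ 2 + c.μY / 2 * ‖z.2 - p.ys‖ ^ 2 ≤
      p.pairing (z - (p.xs, p.ys)) (p.op z) := by
  have h1 := p.strongConvex_lower hz.1 p.xs_mem_X hz.2
  have h2 := p.strongConcave_upper hz.1 hz.2 p.ys_mem_Y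
  rw [norm_sub_rev, ← neg_sub z.1 p.xs, inner_neg_right, real_inner_comm] at h1
  rw [norm_sub_rev, ← neg_sub z.2 p.ys, inner_neg_right, real_inner_comm] at h2
  simp only [pairing, op, merit, Prod.fst_sub, Prod.snd_sub, inner_neg_right]
  linarith

theorem exists_inner_eq_mul_norm {d : ℕ} (g : Euc d) {δ : ℝ} (hδ : 0 ≤ δ) :
    ∃ v : Euc d, ‖v‖ ≤ δ ∧ inner ℝ v g = δ * ‖g‖ := by
  by_cases hg : g = 0
  · exact ⟨0, by simpa using hδ, by simp [hg]⟩
  have hn : 0 < ‖g‖ := norm_pos_iff.2 hg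
  refine ⟨(δ / ‖g‖) • g, ?_, ?_⟩
  · rw [norm_smul, Real.norm_of_nonneg (by positivity), div_mul_cancel₀ _ hn.ne']
  · rw [real_inner_smul_left, real_inner_self_eq_norm_sq]; field_simp

/-- Interior saddle point: the gap exceeds the gradient norms scaled by the border distances. -/
theorem pairing_add_le_fwGap (z : p.Point) :
    p.pairing (z - (p.xs, p.ys)) (p.op z) + (c.δX * ‖p.gradX z‖ + c.δY * ‖p.gradY z‖) ≤
      p.fwGap z := by
  obtain ⟨v, hv, hvg⟩ := exists_inner_eq_mul_norm (p.gradX z) p.δX_pos.le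
  obtain ⟨v', hv', hvg'⟩ := exists_inner_eq_mul_norm (-p.gradY z) p.δY_pos.le
  -- The competitor in the gap: the saddle point displaced by `δX`, `δY` against the components of
  -- the operator at `z`.
  have hw : ((p.xs - v, p.ys - v') : p.Point) ∈ p.X ×ˢ p.Y :=
    ⟨p.closedBall_subset_X (by simpa using hv), p.closedBall_subset_Y (by simpa using hv')⟩
  refine le_trans (le_of_eq ?_) (p.pairing_le_fwGap z hw)
  have e : z - (p.xs - v, p.ys - v') = (z - (p.xs, p.ys)) + (v, v') := by
    ext <;> simp <;> ring
  rw [e, pairing_add_left]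
  congr 1
  simp only [pairing, op, hvg, hvg', norm_neg]

/-- With `a`, `b` the partial gradient norms, maximizing `‖x - x*‖ a - μX/2 ‖x - x*‖²` and its
analogue in `y` gives `w ≤ a²/(2 μX) + b²/(2 μY)`. Then `δX a + δY b ≥ √(δX² a² + δY² b²) ≥ √2 δμ
√w`, and `pairing_add_le_fwGap` adds this to the pairing, which is at least `w`. -/
theorem merit_add_sqrt_le_fwGap (hz : z ∈ p.X ×ˢ p.Y) :
    p.merit z + √2 * c.δμ * √(p.merit z) ≤ p.fwGap z := by
  have h1 := p.merit_add_le_pairing hz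
  have h2 := p.pairing_add_le_fwGap z
  have hμX := p.μX_pos
  have hμY := p.μY_pos
  have hw := p.merit_nonneg hz
  have hδ := p.δμ_pos
  set a := ‖p.gradX z‖ with ha
  set b := ‖p.gradY z‖ with hb
  have ha0 : 0 ≤ a := norm_nonneg _
  have hb0 : 0 ≤ b := norm_nonneg _
  have h3 : p.pairing (z - (p.xs, p.ys)) (p.op z) ≤ ‖z.1 - p.xs‖ * a + ‖z.2 - p.ys‖ * b := by
    refine add_le_add (real_inner_le_norm _ _) ((real_inner_le_norm _ _).trans ?_)
    simp [op, hb]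
  have h4 : p.merit z ≤ a ^ 2 / (2 * c.μX) + b ^ 2 / (2 * c.μY) := by
    have e1 : ‖z.1 - p.xs‖ * a - c.μX / 2 * ‖z.1 - p.xs‖ ^ 2 ≤ a ^ 2 / (2 * c.μX) := by
      rw [le_div_iff₀ (by positivity)]
      nlinarith [sq_nonneg (a - c.μX * ‖z.1 - p.xs‖)]
    have e2 : ‖z.2 - p.ys‖ * b - c.μY / 2 * ‖z.2 - p.ys‖ ^ 2 ≤ b ^ 2 / (2 * c.μY) := by
      rw [le_div_iff₀ (by positivity)]
      nlinarith [sq_nonneg (b - c.μY * ‖z.2 - p.ys‖)]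
    linarith
  have h5 : √2 * c.δμ * √(p.merit z) ≤ c.δX * a + c.δY * b := by
    have hX := p.δX_pos
    have hY := p.δY_pos
    refine le_of_sq_le_sq ?_ (by positivity)
    have e1 : (√2 * c.δμ * √(p.merit z)) ^ 2 = 2 * c.δμ ^ 2 * p.merit z := by
      rw [mul_pow, mul_pow, Real.sq_sqrt hw, Real.sq_sqrt (by norm_num)]
    have e2 : c.δμ ^ 2 * (a ^ 2 / c.μX) ≤ c.δX ^ 2 * a ^ 2 := by
      have : c.δμ ^ 2 ≤ c.μX * c.δX ^ 2 := by rw [p.δμ_sq]; exact min_le_left _ _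
      calc c.δμ ^ 2 * (a ^ 2 / c.μX) ≤ c.μX * c.δX ^ 2 * (a ^ 2 / c.μX) := by gcongr
        _ = _ := by field_simp
    have e3 : c.δμ ^ 2 * (b ^ 2 / c.μY) ≤ c.δY ^ 2 * b ^ 2 := by
      have : c.δμ ^ 2 ≤ c.μY * c.δY ^ 2 := by rw [p.δμ_sq]; exact min_le_right _ _
      calc c.δμ ^ 2 * (b ^ 2 / c.μY) ≤ c.μY * c.δY ^ 2 * (b ^ 2 / c.μY) := by gcongr
        _ = _ := by field_simp
    have e4 : 2 * c.δμ ^ 2 * p.merit z ≤ c.δμ ^ 2 * (a ^ 2 / c.μX) + c.δμ ^ 2 * (b ^ 2 / c.μY) := by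
      have := mul_le_mul_of_nonneg_left h4 (by positivity : 0 ≤ 2 * c.δμ ^ 2)
      refine this.trans (le_of_eq ?_)
      field_simp
    rw [e1]
    nlinarith [mul_nonneg (mul_nonneg hX.le ha0) (mul_nonneg hY.le hb0)]
  have h6 : 0 ≤ c.μX / 2 * ‖z.1 - p.xs‖ ^ 2 := by positivity
  have h7 : 0 ≤ c.μY / 2 * ‖z.2 - p.ys‖ ^ 2 := by positivity
  linarith

theorem fwGap_nonneg (hz : z ∈ p.X ×ˢ p.Y) : 0 ≤ p.fwGap z := by
  have := p.δμ_pos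
  have := p.merit_nonneg hz
  exact le_trans (by positivity) (p.merit_add_sqrt_le_fwGap hz)

/-- Quadratic growth of the merit bounds the sum of the distances, weighted by `√μ`, by `2 √w`. This
explains the form of `C0`: the coupling between the variables uses at most the share `1 - C0` of `√2
δμ √w`. -/
theorem coupling_le (hz : z ∈ p.X ×ˢ p.Y) :
    c.DX * c.LXY * ‖z.2 - p.ys‖ + c.DY * c.LYX * ‖z.1 - p.xs‖ ≤
      (1 - c.C0) * (√2 * c.δμ * √(p.merit z)) := by
  have h1 := mul_le_mul_of_nonneg_right p.coupling_X (norm_nonneg (z.2 - p.ys))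
  have h2 := mul_le_mul_of_nonneg_right p.coupling_Y (norm_nonneg (z.1 - p.xs))
  have hC := p.C0_le_one
  have hδ := p.δμ_pos
  have hw := p.merit_nonneg hz
  have h3 : √c.μY * ‖z.2 - p.ys‖ + √c.μX * ‖z.1 - p.xs‖ ≤ 2 * √(p.merit z) := by
    refine le_of_sq_le_sq ?_ (by positivity)
    have e := p.le_merit hz
    have e1 := Real.sq_sqrt p.μX_pos.le
    have e2 := Real.sq_sqrt p.μY_pos.le
    rw [mul_pow, Real.sq_sqrt hw]
    have e3 := add_sq_le (a := √c.μY * ‖z.2 - p.ys‖) (b := √c.μX * ‖z.1 - p.xs‖)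
    rw [mul_pow, mul_pow, e1, e2] at e3
    linarith
  have h4 : 0 ≤ (1 - c.C0) * c.δμ / √2 := by
    have := sub_nonneg.2 hC
    positivity
  have h5 := mul_le_mul_of_nonneg_left h3 h4
  have h6 : (1 - c.C0) * c.δμ / √2 * (2 * √(p.merit z)) =
      (1 - c.C0) * (√2 * c.δμ * √(p.merit z)) := by
    have : √(2 : ℝ) ≠ 0 := by positivity
    have h2 : √(2 : ℝ) ^ 2 = 2 := Real.sq_sqrt (by norm_num)
    field_simp
    rw [h2]
  linarith

/-- Gradients are measured from their zero at the saddle point. The Lipschitz bounds in the own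
variable contribute `LG (DX² + DY²) = 2 C1`, those in the other variable at most `1 - C0` times
that, through `δμ √μ ≤ μ δ ≤ LG D`. -/
theorem fwGap_le (hz : z ∈ p.X ×ˢ p.Y) : p.fwGap z ≤ 2 * c.C1 * (2 - c.C0) := by
  obtain ⟨w, hw, hg⟩ := p.exists_fwGap_eq z
  rw [hg]
  refine (p.pairing_sub_le hz hw _).trans ?_
  have hC := sub_nonneg.2 p.C0_le_one
  have hδ := p.δμ_pos
  have hX := p.DX_pos
  have hY := p.DY_pos
  have a1 : ‖p.gradX z‖ ≤ c.LG * c.DX + c.LXY * c.DY := by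
    have e : p.gradX z = (p.gradX (z.1, z.2) - p.gradX (p.xs, z.2)) +
        (p.gradX (p.xs, z.2) - p.gradX (p.xs, p.ys)) := by rw [gradX_saddle]; abel
    rw [e]
    refine (norm_add_le _ _).trans (add_le_add ?_ ?_)
    · refine (p.norm_gradX_sub_X hz.1 p.xs_mem_X hz.2).trans ?_
      exact mul_le_mul (le_max_left _ _) (p.dist_X _ hz.1 _ p.xs_mem_X) (norm_nonneg _) p.LG_pos.le
    · refine (p.norm_gradX_sub_Y p.xs_mem_X hz.2 p.ys_mem_Y).trans ?_
      exact mul_le_mul_of_nonneg_left (p.dist_Y _ hz.2 _ p.ys_mem_Y) p.LXY_nonneg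
  have a2 : ‖p.gradY z‖ ≤ c.LG * c.DY + c.LYX * c.DX := by
    have e : p.gradY z = (p.gradY (z.1, z.2) - p.gradY (z.1, p.ys)) +
        (p.gradY (z.1, p.ys) - p.gradY (p.xs, p.ys)) := by rw [gradY_saddle]; abel
    rw [e]
    refine (norm_add_le _ _).trans (add_le_add ?_ ?_)
    · refine (p.norm_gradY_sub_Y hz.1 hz.2 p.ys_mem_Y).trans ?_
      exact mul_le_mul (le_max_right _ _) (p.dist_Y _ hz.2 _ p.ys_mem_Y) (norm_nonneg _) p.LG_pos.le
    · refine (p.norm_gradY_sub_X hz.1 p.xs_mem_X p.ys_mem_Y).trans ?_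
      exact mul_le_mul_of_nonneg_left (p.dist_X _ hz.1 _ p.xs_mem_X) p.LYX_nonneg
  have hs2 : (1 : ℝ) ≤ √2 := Real.one_le_sqrt.2 (by norm_num)
  have b1 : c.DX * c.LXY ≤ (1 - c.C0) * (c.LG * c.DY) := by
    refine p.coupling_X.trans ?_
    have e : c.δμ * √c.μY ≤ c.LG * c.DY := by
      have e1 : c.δμ ≤ √c.μY * c.δY := by
        rw [Constants.δμ]
        refine (Real.sqrt_le_sqrt (min_le_right _ _)).trans (le_of_eq ?_)
        rw [Real.sqrt_mul p.μY_pos.le, Real.sqrt_sq p.δY_pos.le]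
      calc c.δμ * √c.μY ≤ √c.μY * c.δY * √c.μY := by gcongr
        _ = √c.μY ^ 2 * c.δY := by ring
        _ = c.μY * c.δY := by rw [Real.sq_sqrt p.μY_pos.le]
        _ ≤ _ := mul_le_mul (p.μY_le.trans (le_max_right _ _)) p.δY_le p.δY_pos.le p.LG_pos.le
    calc (1 - c.C0) * c.δμ / √2 * √c.μY = (1 - c.C0) * (c.δμ * √c.μY) / √2 := by ring
      _ ≤ (1 - c.C0) * (c.δμ * √c.μY) := div_le_self (by positivity) hs2
      _ ≤ _ := by gcongr
  have b2 : c.DY * c.LYX ≤ (1 - c.C0) * (c.LG * c.DX) := by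
    refine p.coupling_Y.trans ?_
    have e : c.δμ * √c.μX ≤ c.LG * c.DX := by
      have e1 : c.δμ ≤ √c.μX * c.δX := by
        rw [Constants.δμ]
        refine (Real.sqrt_le_sqrt (min_le_left _ _)).trans (le_of_eq ?_)
        rw [Real.sqrt_mul p.μX_pos.le, Real.sqrt_sq p.δX_pos.le]
      calc c.δμ * √c.μX ≤ √c.μX * c.δX * √c.μX := by gcongr
        _ = √c.μX ^ 2 * c.δX := by ring
        _ = c.μX * c.δX := by rw [Real.sq_sqrt p.μX_pos.le]
        _ ≤ _ := mul_le_mul (p.μX_le.trans (le_max_left _ _)) p.δX_le p.δX_pos.le p.LG_pos.le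
    calc (1 - c.C0) * c.δμ / √2 * √c.μX = (1 - c.C0) * (c.δμ * √c.μX) / √2 := by ring
      _ ≤ (1 - c.C0) * (c.δμ * √c.μX) := div_le_self (by positivity) hs2
      _ ≤ _ := by gcongr
  have d1 := mul_le_mul_of_nonneg_left a1 hX.le
  have d2 := mul_le_mul_of_nonneg_left a2 hY.le
  have d3 := mul_le_mul_of_nonneg_right b1 hY.le
  have d4 := mul_le_mul_of_nonneg_right b2 hX.le
  simp only [op, norm_neg]
  rw [c.two_mul_C1]
  linarith

theorem nashGap_le_fwGap (hz : z ∈ p.X ×ˢ p.Y) : p.nashGap z ≤ p.fwGap z := by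
  refine csSup_le (p.domain_nonempty.image _) ?_
  rintro _ ⟨w, hw, rfl⟩
  refine le_trans ?_ (p.pairing_le_fwGap z hw)
  have h1 := p.strongConvex_lower hz.1 hw.1 hz.2
  have h2 := p.strongConcave_upper hz.1 hz.2 hw.2
  have h3 : 0 ≤ c.μX / 2 * ‖w.1 - z.1‖ ^ 2 := by have := p.μX_pos; positivity
  have h4 : 0 ≤ c.μY / 2 * ‖w.2 - z.2‖ ^ 2 := by have := p.μY_pos; positivity
  rw [← neg_sub z.1 w.1, inner_neg_right, real_inner_comm, norm_neg] at h1
  rw [← neg_sub z.2 w.2, inner_neg_right, real_inner_comm, norm_neg] at h2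
  rw [← neg_sub z.1 w.1, norm_neg] at h3
  rw [← neg_sub z.2 w.2, norm_neg] at h4
  simp only [pairing, op, Prod.fst_sub, Prod.snd_sub, inner_neg_right]
  linarith

/-! ### One iteration -/

variable {s G : p.Point} {γ : ℝ}

theorem step_mem (hz : z ∈ p.X ×ˢ p.Y) (hs : s ∈ p.X ×ˢ p.Y) (h0 : 0 ≤ γ) (h1 : γ ≤ 1) :
    (1 - γ) • z + γ • s ∈ p.X ×ˢ p.Y :=
  p.convex_X.prod p.convex_Y hz hs (sub_nonneg.2 h1) h0 (by ring)

/-- The descent lemma for `f(·, y*)` and `f(x*, ·)` separately. Their gradients at `z` differ from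
those of `f` by the cross-Lipschitz terms, which `coupling_le` absorbs. -/
theorem merit_step_le (hz : z ∈ p.X ×ˢ p.Y) (hs : s ∈ p.X ×ˢ p.Y) (h0 : 0 ≤ γ) :
    p.merit ((1 - γ) • z + γ • s) ≤ p.merit z - γ * (p.pairing (z - s) (p.op z) -
      (1 - c.C0) * (√2 * c.δμ * √(p.merit z))) + γ ^ 2 * c.C1 := by
  have hc := mul_le_mul_of_nonneg_left (p.coupling_le hz) h0
  set z' := (1 - γ) • z + γ • s with hz'
  have ex : z'.1 - z.1 = γ • (s.1 - z.1) := by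
    simp only [hz', Prod.fst_add, Prod.smul_fst]; module
  have ey : z'.2 - z.2 = γ • (s.2 - z.2) := by
    simp only [hz', Prod.snd_add, Prod.smul_snd]; module
  have h1 := (abs_le.1 (p.smooth_X (x₂ := z'.1) hz.1 p.ys_mem_Y)).2
  have h2 := (abs_le.1 (p.smooth_Y (y₂ := z'.2) p.xs_mem_X hz.2)).1
  rw [ex, real_inner_smul_right, norm_smul, Real.norm_of_nonneg h0, mul_pow] at h1
  rw [ey, real_inner_smul_right, norm_smul, Real.norm_of_nonneg h0, mul_pow] at h2
  have h3 : c.LGX / 2 * (γ ^ 2 * ‖s.1 - z.1‖ ^ 2) ≤ c.LG / 2 * (γ ^ 2 * c.DX ^ 2) := by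
    have := p.LGX_pos
    have := p.dist_X _ hs.1 _ hz.1
    have := p.LG_pos
    have := c.LGX_le_LG
    gcongr
  have h4 : c.LGY / 2 * (γ ^ 2 * ‖s.2 - z.2‖ ^ 2) ≤ c.LG / 2 * (γ ^ 2 * c.DY ^ 2) := by
    have := p.LGY_pos
    have := p.dist_Y _ hs.2 _ hz.2
    have := p.LG_pos
    have := c.LGY_le_LG
    gcongr
  have h5 : inner ℝ (p.gradX (z.1, p.ys)) (s.1 - z.1) ≤
      inner ℝ (p.gradX z) (s.1 - z.1) + c.DX * c.LXY * ‖z.2 - p.ys‖ := by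
    have e := real_inner_le_norm (p.gradX (z.1, p.ys) - p.gradX (z.1, z.2)) (s.1 - z.1)
    rw [inner_sub_left] at e
    have e1 := p.norm_gradX_sub_Y hz.1 p.ys_mem_Y hz.2
    rw [norm_sub_rev p.ys] at e1
    have e2 := p.dist_X _ hs.1 _ hz.1
    have e3 := mul_le_mul e1 e2 (norm_nonneg _) ((norm_nonneg _).trans e1)
    change inner ℝ (p.gradX (z.1, p.ys)) (s.1 - z.1) ≤
      inner ℝ (p.gradX (z.1, z.2)) (s.1 - z.1) + c.DX * c.LXY * ‖z.2 - p.ys‖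
    linarith
  have h6 : inner ℝ (p.gradY z) (s.2 - z.2) - c.DY * c.LYX * ‖z.1 - p.xs‖ ≤
      inner ℝ (p.gradY (p.xs, z.2)) (s.2 - z.2) := by
    have e := real_inner_le_norm (p.gradY (z.1, z.2) - p.gradY (p.xs, z.2)) (s.2 - z.2)
    rw [inner_sub_left] at e
    have e1 := p.norm_gradY_sub_X hz.1 p.xs_mem_X hz.2
    have e2 := p.dist_Y _ hs.2 _ hz.2
    have e3 := mul_le_mul e1 e2 (norm_nonneg _) ((norm_nonneg _).trans e1)
    change inner ℝ (p.gradY (z.1, z.2)) (s.2 - z.2) - c.DY * c.LYX * ‖z.1 - p.xs‖ ≤ _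
    linarith
  have h7 : p.pairing (z - s) (p.op z) =
      -inner ℝ (p.gradX z) (s.1 - z.1) + inner ℝ (p.gradY z) (s.2 - z.2) := by
    simp only [pairing, op, Prod.fst_sub, Prod.snd_sub, inner_neg_right]
    rw [← neg_sub s.1 z.1, ← neg_sub s.2 z.2, inner_neg_left, inner_neg_left, real_inner_comm,
      real_inner_comm (p.gradY z)]
    ring
  have h8 := mul_le_mul_of_nonneg_left h5 h0
  have h9 := mul_le_mul_of_nonneg_left h6 h0
  rw [h7, Constants.C1]
  simp only [merit] at hc ⊢
  linarith

/-- Weighted error of a gradient estimate `G` at `z`. -/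
def err (z G : p.Point) : ℝ := c.DX * ‖(p.op z - G).1‖ + c.DY * ‖(p.op z - G).2‖

theorem err_nonneg (z G : p.Point) : 0 ≤ p.err z G := by
  have := p.DX_pos
  have := p.DY_pos
  unfold err; positivity

theorem pairing_op_ge (hz : z ∈ p.X ×ˢ p.Y) (hs : s ∈ p.X ×ˢ p.Y) :
    p.pairing (z - s) G - p.err z G ≤ p.pairing (z - s) (p.op z) := by
  have h := p.pairing_sub_le hs hz (p.op z - G)
  rw [← neg_sub z s] at h
  have e : p.pairing (-(z - s)) (p.op z - G) =
      p.pairing (z - s) G - p.pairing (z - s) (p.op z) := by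
    rw [pairing_sub_right]
    simp only [pairing, Prod.fst_neg, Prod.snd_neg, inner_neg_left]; ring
  rw [e] at h
  have : p.err z G = c.DX * ‖(p.op z - G).1‖ + c.DY * ‖(p.op z - G).2‖ := rfl
  linarith

theorem fwGap_le_estimated (hz : z ∈ p.X ×ˢ p.Y)
    (hmin : ∀ w ∈ p.X ×ˢ p.Y, p.pairing s G ≤ p.pairing w G) :
    p.fwGap z ≤ p.pairing (z - s) G + p.err z G := by
  obtain ⟨w, hw, hg⟩ := p.exists_fwGap_eq z
  have h := p.pairing_sub_le hz hw (p.op z - G)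
  rw [pairing_sub_right] at h
  have h2 := hmin w hw
  rw [pairing_sub_left p z s]
  rw [pairing_sub_left p z w G] at h
  have : p.err z G = c.DX * ‖(p.op z - G).1‖ + c.DY * ‖(p.op z - G).2‖ := rfl
  linarith

/-- If `w` attains the gap, the loss is the pairing of `s - w` with the operator; since `s`
minimizes against `G`, it is at most the pairing with `op z - G`. The error is thus paid only once.
-/
theorem fwGap_sub_le_pairing (hs : s ∈ p.X ×ˢ p.Y)
    (hmin : ∀ w ∈ p.X ×ˢ p.Y, p.pairing s G ≤ p.pairing w G) :
    p.fwGap z - p.err z G ≤ p.pairing (z - s) (p.op z) := by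
  obtain ⟨w, hw, hg⟩ := p.exists_fwGap_eq z
  have h := p.pairing_sub_le hs hw (p.op z - G)
  have h2 := hmin w hw
  rw [pairing_sub_right, pairing_sub_left, pairing_sub_left] at h
  rw [pairing_sub_left] at hg ⊢
  have : p.err z G = c.DX * ‖(p.op z - G).1‖ + c.DY * ‖(p.op z - G).2‖ := rfl
  linarith

/-- Decrease of the merit function for an arbitrary step size. -/
theorem merit_step_nonadaptive (hC : 0 < c.C0) (hz : z ∈ p.X ×ˢ p.Y) (hs : s ∈ p.X ×ˢ p.Y)
    (hmin : ∀ w ∈ p.X ×ˢ p.Y, p.pairing s G ≤ p.pairing w G) (h0 : 0 ≤ γ) :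
    p.merit ((1 - γ) • z + γ • s) ≤ (1 - γ / 2) * p.merit z - γ * (c.C0 / 2) * p.fwGap z +
      γ ^ 2 * c.C1 + γ * p.err z G := by
  have h1 := p.merit_step_le hz hs h0
  have h2 := p.fwGap_sub_le_pairing (z := z) hs hmin
  have h3 := p.merit_add_sqrt_le_fwGap hz
  have hC1 := p.C0_le_one
  have hw := p.merit_nonneg hz
  -- From `S ≤ ĝ - w` the right side is at least `C0 ĝ + (1 - C0) w` minus the error. Half of `C0 ĝ`
  -- is kept; the other half is at least `C0 w / 2`, and `1 - C0 / 2 ≥ 1 / 2`.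
  have h4 : p.merit z / 2 + c.C0 / 2 * p.fwGap z - p.err z G ≤ p.pairing (z - s) (p.op z) -
      (1 - c.C0) * (√2 * c.δμ * √(p.merit z)) := by
    have := mul_le_mul_of_nonneg_left h3 (sub_nonneg.2 hC1)
    have hg := p.fwGap_nonneg hz
    have hS : 0 ≤ √2 * c.δμ * √(p.merit z) := by have := p.δμ_pos; positivity
    nlinarith
  have := mul_le_mul_of_nonneg_left h4 h0
  linarith

theorem ρ_pos (p : SaddleProblem.{u} c) (hC : 0 < c.C0) : 0 < c.ρ := by
  have := p.δμ_pos
  have := p.C1_pos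
  exact lt_min (by positivity) (by positivity)

theorem ρ_le_half (p : SaddleProblem.{u} c) : c.ρ ≤ 1 / 2 := by
  have := p.C0_le_one
  exact (min_le_right _ _).trans (by linarith)

/-- Decrease of the merit function for the adaptive step size. -/
theorem merit_step_adaptive (hC : 0 < c.C0) (hz : z ∈ p.X ×ˢ p.Y) (hs : s ∈ p.X ×ˢ p.Y)
    (hmin : ∀ w ∈ p.X ×ˢ p.Y, p.pairing s G ≤ p.pairing w G)
    (hγ : γ = min (c.C0 / (4 * c.C1) * p.pairing (z - s) G) 1) :
    0 ≤ γ ∧ γ ≤ 1 ∧ p.merit ((1 - γ) • z + γ • s) ≤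
      (1 - c.ρ) * p.merit z + p.err z G ^ 2 / (2 * c.C1) := by
  have hC1 := p.C1_pos
  have hCle := p.C0_le_one
  have hw := p.merit_nonneg hz
  have hn := p.err_nonneg z G
  have hgap := p.fwGap_le_estimated hz hmin
  have hg0 : 0 ≤ p.pairing (z - s) G := by
    rw [pairing_sub_left]; linarith [hmin z hz]
  have hγ0 : 0 ≤ γ := by rw [hγ]; exact le_min (by positivity) zero_le_one
  have hγ1 : γ ≤ 1 := hγ ▸ min_le_right _ _
  refine ⟨hγ0, hγ1, ?_⟩
  have h1 := p.merit_step_le hz hs hγ0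
  have h2 := p.pairing_op_ge (G := G) hz hs
  have h3 := p.merit_add_sqrt_le_fwGap hz
  have hρ := p.ρ_le_half
  have hS0 : 0 ≤ √2 * c.δμ * √(p.merit z) := by have := p.δμ_pos; positivity
  have hS2 : (√2 * c.δμ * √(p.merit z)) ^ 2 = 2 * c.δμ ^ 2 * p.merit z := by
    rw [mul_pow, mul_pow, Real.sq_sqrt hw, Real.sq_sqrt (by norm_num)]
  set g := p.pairing (z - s) G
  set n := p.err z G
  set S := √2 * c.δμ * √(p.merit z)
  set w := p.merit z
  rcases le_total (c.C0 / (4 * c.C1) * g) 1 with hle | hle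
  · rw [min_eq_left hle] at hγ
    -- `S² = 2 δμ² w` together with `S ≤ ĝ ≤ g + n`: a squared gap pays for a multiple of `w`. This
    -- gives the first entry of `ρ`.
    have hρw : c.ρ * w ≤ c.C0 ^ 2 * (g + n) ^ 2 / (16 * c.C1) := by
      have e1 : c.ρ * w ≤ c.C0 ^ 2 * c.δμ ^ 2 / (8 * c.C1) * w :=
        mul_le_mul_of_nonneg_right (min_le_left _ _) hw
      have e2 : S ^ 2 ≤ (g + n) ^ 2 := pow_le_pow_left₀ hS0 (by linarith) 2
      have e3 : c.C0 ^ 2 * c.δμ ^ 2 / (8 * c.C1) * w = c.C0 ^ 2 * S ^ 2 / (16 * c.C1) := by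
        rw [hS2]; field_simp; ring
      rw [e3] at e1
      refine e1.trans ?_
      gcongr
    have h4 : γ * (c.C0 * g - (2 - c.C0) * n) ≤
        γ * (p.pairing (z - s) (p.op z) - (1 - c.C0) * S) := by
      refine mul_le_mul_of_nonneg_left ?_ hγ0
      have : (1 - c.C0) * S ≤ (1 - c.C0) * (g + n) :=
        mul_le_mul_of_nonneg_left (by linarith) (sub_nonneg.2 hCle)
      linarith
    have h5 : γ ^ 2 * c.C1 - γ * (c.C0 * g - (2 - c.C0) * n) +
        c.C0 ^ 2 * (g + n) ^ 2 / (16 * c.C1) ≤ n ^ 2 / (2 * c.C1) := by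
      rw [hγ]
      have e : (c.C0 / (4 * c.C1) * g) ^ 2 * c.C1 -
          c.C0 / (4 * c.C1) * g * (c.C0 * g - (2 - c.C0) * n) +
          c.C0 ^ 2 * (g + n) ^ 2 / (16 * c.C1) =
          (-2 * (c.C0 * g) ^ 2 + (8 - 2 * c.C0) * (c.C0 * g) * n + c.C0 ^ 2 * n ^ 2) /
            (16 * c.C1) := by
        field_simp; ring
      rw [e, div_le_div_iff₀ (by positivity) (by positivity)]
      -- Completing the square in `C0 g` leaves `(8 - 4 C0 + 3/2 C0²) n²`, which is at most `8 n²`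
      -- because `C0 ≤ 1`.
      have e2 : -2 * (c.C0 * g) ^ 2 + (8 - 2 * c.C0) * (c.C0 * g) * n + c.C0 ^ 2 * n ^ 2 ≤
          8 * n ^ 2 := by
        have q1 := sq_nonneg (2 * (c.C0 * g) - (4 - c.C0) * n)
        have q2 : 0 ≤ (c.C0 * (8 - 3 * c.C0)) * n ^ 2 :=
          mul_nonneg (mul_nonneg hC.le (by linarith)) (sq_nonneg n)
        linarith
      have := mul_le_mul_of_nonneg_right e2 (by positivity : 0 ≤ 2 * c.C1)
      linarith
    linarith
  -- Full step. Then `C0 g ≥ 4 C1`, although the true gap is at most `2 C1 (2 - C0)`; so the error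
  -- is at least `2 C1`, and the a priori bound `w ≤ C1` suffices.
  · rw [min_eq_right hle] at hγ
    have hg : 4 * c.C1 ≤ c.C0 * g := by
      rw [div_mul_eq_mul_div, le_div_iff₀ (by positivity)] at hle; linarith
    have hfw := p.fwGap_le hz
    have hn2 : g ≤ p.fwGap z + n := by
      have h := p.pairing_sub_le hs hz (p.op z - G)
      have h' := p.pairing_op_ge (G := G) hz hs
      have h'' := p.pairing_le_fwGap z hs
      linarith
    have hn3 : 2 * c.C1 ≤ n := by
      have e1 : c.C0 * g ≤ c.C0 * (2 * c.C1 * (2 - c.C0) + n) :=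
        mul_le_mul_of_nonneg_left (by linarith) hC.le
      have e2 : c.C0 * (2 * c.C1) ≤ c.C0 * n := by
        have q : 0 ≤ c.C1 * ((1 - c.C0) * (2 - c.C0)) :=
          mul_nonneg hC1.le (mul_nonneg (by linarith) (by linarith))
        linarith
      exact le_of_mul_le_mul_left e2 hC
    have h4 := p.merit_le_C1 (p.step_mem hz hs hγ0 hγ1)
    have h5 : c.C1 ≤ n ^ 2 / (2 * c.C1) := by
      rw [le_div_iff₀ (by positivity)]
      have := pow_le_pow_left₀ (by positivity) hn3 2
      have := pow_pos hC1 2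
      linarith
    have h6 : 0 ≤ (1 - c.ρ) * w := mul_nonneg (by linarith) hw
    linarith

end SaddleProblem

namespace SaddleProblem

variable {c : Constants} (p : SaddleProblem.{u} c)

/-! ### Continuity on the domain and measurability of the iterates -/

theorem continuousOn_of_lipschitz {E : Type*} [NormedAddCommGroup E] {φ : p.Point → E} {A B : ℝ}
    (hA : 0 ≤ A) (hB : 0 ≤ B)
    (h₁ : ∀ x₁ ∈ p.X, ∀ x₂ ∈ p.X, ∀ y ∈ p.Y, ‖φ (x₁, y) - φ (x₂, y)‖ ≤ A * ‖x₁ - x₂‖)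
    (h₂ : ∀ x ∈ p.X, ∀ y₁ ∈ p.Y, ∀ y₂ ∈ p.Y, ‖φ (x, y₁) - φ (x, y₂)‖ ≤ B * ‖y₁ - y₂‖) :
    ContinuousOn φ (p.X ×ˢ p.Y) := by
  have : LipschitzOnWith (A + B).toNNReal φ (p.X ×ˢ p.Y) := by
    refine LipschitzOnWith.of_dist_le_mul fun z hz w hw => ?_
    rw [Real.coe_toNNReal _ (add_nonneg hA hB), dist_eq_norm, dist_eq_norm]
    have e : φ z - φ w = (φ (z.1, z.2) - φ (w.1, z.2)) + (φ (w.1, z.2) - φ (w.1, w.2)) := by abel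
    rw [e, add_mul]
    refine (norm_add_le _ _).trans (add_le_add ?_ ?_)
    · exact (h₁ _ hz.1 _ hw.1 _ hz.2).trans
        (mul_le_mul_of_nonneg_left (norm_fst_le (z - w)) hA)
    · exact (h₂ _ hw.1 _ hz.2 _ hw.2).trans
        (mul_le_mul_of_nonneg_left (norm_snd_le (z - w)) hB)
  exact this.continuousOn

theorem continuousOn_f : ContinuousOn (fun z : p.Point => p.f z.1 z.2) (p.X ×ˢ p.Y) :=
  p.continuousOn_of_lipschitz p.LX_nonneg p.LY_nonneg
    (fun _ h₁ _ h₂ _ hy => p.abs_f_sub_X h₁ h₂ hy) (fun _ hx _ h₁ _ h₂ => p.abs_f_sub_Y hx h₁ h₂)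

theorem continuousOn_gradX : ContinuousOn p.gradX (p.X ×ˢ p.Y) :=
  p.continuousOn_of_lipschitz p.LGX_pos.le p.LXY_nonneg
    (fun _ h₁ _ h₂ _ hy => p.norm_gradX_sub_X h₁ h₂ hy)
    (fun _ hx _ h₁ _ h₂ => p.norm_gradX_sub_Y hx h₁ h₂)

theorem continuousOn_gradY : ContinuousOn p.gradY (p.X ×ˢ p.Y) :=
  p.continuousOn_of_lipschitz p.LYX_nonneg p.LGY_pos.le
    (fun _ h₁ _ h₂ _ hy => p.norm_gradY_sub_X h₁ h₂ hy)
    (fun _ hx _ h₁ _ h₂ => p.norm_gradY_sub_Y hx h₁ h₂)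

theorem continuousOn_merit : ContinuousOn p.merit (p.X ×ˢ p.Y) := by
  refine ContinuousOn.sub ?_ ?_
  · exact p.continuousOn_f.comp (f := fun z : p.Point => (z.1, p.ys))
      (by fun_prop) fun z hz => ⟨hz.1, p.ys_mem_Y⟩
  · exact p.continuousOn_f.comp (f := fun z : p.Point => (p.xs, z.2))
      (by fun_prop) fun z hz => ⟨p.xs_mem_X, hz.2⟩

theorem continuousOn_fwGap : ContinuousOn p.fwGap (p.X ×ˢ p.Y) := by
  rw [continuousOn_iff_continuous_domRestrict]
  have hX := continuousOn_iff_continuous_domRestrict.1 p.continuousOn_gradX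
  have hY := continuousOn_iff_continuous_domRestrict.1 p.continuousOn_gradY
  refine IsCompact.continuous_sSup (K := p.X ×ˢ p.Y)
    (f := fun (z : (p.X ×ˢ p.Y : Set p.Point)) w => p.pairing (z - w) (p.op z))
    p.isCompact_domain ?_
  refine p.continuous_pairing.comp
    (f := fun q : (p.X ×ˢ p.Y : Set p.Point) × p.Point => ((q.1 : p.Point) - q.2, p.op q.1))
    ((by fun_prop : Continuous fun q : (p.X ×ˢ p.Y : Set p.Point) × p.Point =>
      ((q.1 : p.Point) - q.2)).prodMk ?_)
  exact (hX.comp continuous_fst).prodMk (hY.comp continuous_fst).neg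

theorem continuousOn_nashGap : ContinuousOn p.nashGap (p.X ×ˢ p.Y) := by
  rw [continuousOn_iff_continuous_domRestrict]
  have hf := continuousOn_iff_continuous_domRestrict.1 p.continuousOn_f
  have : CompactSpace (p.X ×ˢ p.Y : Set p.Point) := isCompact_iff_compactSpace.1 p.isCompact_domain
  have h := IsCompact.continuous_sSup (K := (Set.univ : Set (p.X ×ˢ p.Y : Set p.Point)))
    (f := fun (z w : (p.X ×ˢ p.Y : Set p.Point)) => p.f z.1.1 w.1.2 - p.f w.1.1 z.1.2)
    isCompact_univ (by
      refine Continuous.sub ?_ ?_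
      · exact hf.comp (f := fun q : (p.X ×ˢ p.Y : Set p.Point) × (p.X ×ˢ p.Y : Set p.Point) =>
          ⟨(q.1.1.1, q.2.1.2), q.1.2.1, q.2.2.2⟩) (by fun_prop)
      · exact hf.comp (f := fun q : (p.X ×ˢ p.Y : Set p.Point) × (p.X ×ˢ p.Y : Set p.Point) =>
          ⟨(q.2.1.1, q.1.1.2), q.2.2.1, q.1.2.2⟩) (by fun_prop))
  refine h.congr fun z => ?_
  rw [Set.domRestrict_apply, nashGap]
  congr 1
  ext r
  simp

/-- Regularity of the merit and the gaps is known only on the domain. Extending by 0 outside changes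
nothing along maps that stay inside. -/
theorem measurable_comp_of_continuousOn {α E : Type*} [MeasurableSpace α] [TopologicalSpace E]
    [MeasurableSpace E] [BorelSpace E] [Zero E] {φ : p.Point → E}
    (hφ : ContinuousOn φ (p.X ×ˢ p.Y)) {Z : α → p.Point} (hZ : Measurable Z)
    (hmem : ∀ a, Z a ∈ p.X ×ˢ p.Y) : Measurable fun a => φ (Z a) := by
  classical
  have h : Measurable ((p.X ×ˢ p.Y).piecewise φ fun _ => 0) :=
    hφ.measurable_piecewise continuousOn_const p.isCompact_domain.isClosed.measurableSet
  have e : (fun a => φ (Z a)) = (p.X ×ˢ p.Y).piecewise φ (fun _ => 0) ∘ Z :=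
    funext fun a => (Set.piecewise_eq_of_mem _ _ _ (hmem a)).symm
  rw [e]
  exact h.comp hZ

theorem measurable_estX (m : ℕ) (ν : ℝ) :
    Measurable fun q : p.Point × (ℕ → p.Sample) => p.estX m ν q.1 q.2 := by
  have h : ∀ j, Measurable fun q : p.Point × (ℕ → p.Sample) =>
      ((p.F (q.1.1 + ν • (q.2 j).1) q.1.2 (q.2 j).2.1 - p.F q.1.1 q.1.2 (q.2 j).2.1) / ν) •
        (q.2 j).1 := by
    intro j
    have h1 : Measurable fun q : p.Point × (ℕ → p.Sample) =>
        p.F (q.1.1 + ν • (q.2 j).1) q.1.2 (q.2 j).2.1 :=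
      p.measurable_F.comp (f := fun q : p.Point × (ℕ → p.Sample) =>
        (q.1.1 + ν • (q.2 j).1, q.1.2, (q.2 j).2.1)) (by fun_prop)
    have h2 : Measurable fun q : p.Point × (ℕ → p.Sample) => p.F q.1.1 q.1.2 (q.2 j).2.1 :=
      p.measurable_F.comp (f := fun q : p.Point × (ℕ → p.Sample) =>
        (q.1.1, q.1.2, (q.2 j).2.1)) (by fun_prop)
    exact ((h1.sub h2).div_const ν).smul (by fun_prop)
  exact (Finset.measurable_sum (Finset.range m) fun j _ => h j).const_smul (m : ℝ)⁻¹

theorem measurable_estY (m : ℕ) (ν : ℝ) :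
    Measurable fun q : p.Point × (ℕ → p.Sample) => p.estY m ν q.1 q.2 := by
  have h : ∀ j, Measurable fun q : p.Point × (ℕ → p.Sample) =>
      ((p.F q.1.1 (q.1.2 + ν • (q.2 j).2.2.1) (q.2 j).2.2.2 - p.F q.1.1 q.1.2 (q.2 j).2.2.2) / ν) •
        (q.2 j).2.2.1 := by
    intro j
    have h1 : Measurable fun q : p.Point × (ℕ → p.Sample) =>
        p.F q.1.1 (q.1.2 + ν • (q.2 j).2.2.1) (q.2 j).2.2.2 :=
      p.measurable_F.comp (f := fun q : p.Point × (ℕ → p.Sample) =>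
        (q.1.1, q.1.2 + ν • (q.2 j).2.2.1, (q.2 j).2.2.2)) (by fun_prop)
    have h2 : Measurable fun q : p.Point × (ℕ → p.Sample) => p.F q.1.1 q.1.2 (q.2 j).2.2.2 :=
      p.measurable_F.comp (f := fun q : p.Point × (ℕ → p.Sample) =>
        (q.1.1, q.1.2, (q.2 j).2.2.2)) (by fun_prop)
    exact ((h1.sub h2).div_const ν).smul (by fun_prop)
  exact (Finset.measurable_sum (Finset.range m) fun j _ => h j).const_smul (m : ℝ)⁻¹

/-- The gradient estimate of iteration `k` at `z`. -/
def est (T : Tuning) (k : ℕ) (z : p.Point) (s : ℕ → p.Sample) : p.Point :=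
  (p.estX (T.mX k) T.νX z s, -p.estY (T.mY k) T.νY z s)

theorem measurable_est (T : Tuning) (k : ℕ) :
    Measurable fun q : p.Point × (ℕ → p.Sample) => p.est T k q.1 q.2 :=
  (p.measurable_estX _ _).prodMk (p.measurable_estY _ _).neg

/-- The point reached from `z` in iteration `k` with the batch `b`. -/
def next (lmo : p.Point → p.Point) (T : Tuning) (k : ℕ) (z : p.Point) (b : ℕ → p.Sample) :
    p.Point :=
  (1 - T.γ k (p.pairing (z - lmo (p.est T k z b)) (p.est T k z b))) • z +
    T.γ k (p.pairing (z - lmo (p.est T k z b)) (p.est T k z b)) • lmo (p.est T k z b)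

theorem run_succ_z (lmo : p.Point → p.Point) (T : Tuning) (z0 : p.Point) (s : ℕ → ℕ → p.Sample)
    (k : ℕ) : (p.run lmo T z0 s (k + 1)).z =
      p.next lmo T (k + 1) (p.run lmo T z0 s k).z (s (k + 1)) := rfl

theorem measurable_pairing {α : Type*} [MeasurableSpace α] {w r : α → p.Point} (hw : Measurable w)
    (hr : Measurable r) : Measurable fun a => p.pairing (w a) (r a) :=
  (hw.fst.inner hr.fst).add (hw.snd.inner hr.snd)

theorem measurable_combination {α E : Type*} [MeasurableSpace α] [NormedAddCommGroup E]
    [NormedSpace ℝ E] [MeasurableSpace E] [BorelSpace E] [SecondCountableTopology E] {z t : α → E}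
    {g : α → ℝ} (hz : Measurable z) (ht : Measurable t) (hg : Measurable g) :
    Measurable fun a => (1 - g a) • z a + g a • t a :=
  ((measurable_const.sub hg).smul hz).add (hg.smul ht)

theorem measurable_next {lmo : p.Point → p.Point} (hlmo : Measurable lmo) {T : Tuning} {k : ℕ}
    (hT : Measurable (T.γ k)) :
    Measurable fun q : p.Point × (ℕ → p.Sample) => p.next lmo T k q.1 q.2 := by
  have hG := p.measurable_est T k
  have ht : Measurable fun q : p.Point × (ℕ → p.Sample) => lmo (p.est T k q.1 q.2) := hlmo.comp hG
  have hd : Measurable fun q : p.Point × (ℕ → p.Sample) => q.1 - lmo (p.est T k q.1 q.2) :=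
    measurable_fst.sub ht
  have hg : Measurable fun q : p.Point × (ℕ → p.Sample) =>
      T.γ k (p.pairing (q.1 - lmo (p.est T k q.1 q.2)) (p.est T k q.1 q.2)) :=
    hT.comp (p.measurable_pairing hd hG)
  unfold next
  exact measurable_combination measurable_fst ht hg

theorem measurable_run {lmo : p.Point → p.Point} (hlmo : Measurable lmo) {T : Tuning}
    (hT : ∀ k, Measurable (T.γ k)) (z0 : p.Point) (k : ℕ) :
    Measurable fun s : ℕ → ℕ → p.Sample => (p.run lmo T z0 s k).z := by
  induction k with
  | zero => exact measurable_const
  | succ k ih =>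
    have hs : Measurable fun s : ℕ → ℕ → p.Sample => s (k + 1) := measurable_pi_apply (k + 1)
    have hn := p.measurable_next hlmo (hT (k + 1))
    have h := hn.comp (ih.prodMk hs)
    exact h

theorem run_congr {lmo : p.Point → p.Point} {T : Tuning} {z0 : p.Point} {s s' : ℕ → ℕ → p.Sample}
    {k : ℕ} (h : ∀ i ≤ k, s i = s' i) : p.run lmo T z0 s k = p.run lmo T z0 s' k := by
  induction k with
  | zero => rfl
  | succ k ih =>
    simp only [run]
    rw [ih fun i hi => h i (hi.trans k.le_succ), h (k + 1) le_rfl]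

theorem run_calls (lmo : p.Point → p.Point) {T : Tuning} {a b : ℕ} (hX : ∀ k, T.mX k = a)
    (hY : ∀ k, T.mY k = b) (z0 : p.Point) (s : ℕ → ℕ → p.Sample) (k : ℕ) :
    (p.run lmo T z0 s k).zoCalls = k * (2 * a + 2 * b) ∧ (p.run lmo T z0 s k).loCalls = k := by
  induction k with
  | zero => simp [run]
  | succ k ih => simp only [run, step, ih.1, ih.2, hX, hY, and_true]; ring

end SaddleProblem

/-- Step sizes that are measurable functions of the estimated gap with values in `[0, 1]`. -/
structure SaddleProblem.Tuning.Admissible (T : SaddleProblem.Tuning) : Prop where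
  measurable : ∀ k, Measurable (T.γ k)
  nonneg : ∀ k g, 0 ≤ g → 0 ≤ T.γ (k + 1) g
  le_one : ∀ k g, T.γ (k + 1) g ≤ 1

namespace Execution

variable {c : Constants} {p : SaddleProblem.{u} c} (e : Execution.{u, v} p) {T : SaddleProblem.Tuning}

/-! ### Random iterates -/

/-- The batch of samples of iteration `k`. -/
def batch (k : ℕ) (ω : e.Ω) : ℕ → p.Sample := fun j => e.sample k j ω

theorem measurable_batch (k : ℕ) : Measurable (e.batch k) :=
  measurable_pi_lambda _ fun j => e.measurable_sample k j

theorem measurable_samples : Measurable fun ω k j => e.sample k j ω :=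
  measurable_pi_lambda _ fun k => e.measurable_batch k

theorem estimated_gap_nonneg {z : p.Point} (hz : z ∈ p.X ×ˢ p.Y) (G : p.Point) :
    0 ≤ p.pairing (z - e.lmo G) G := by
  rw [p.pairing_sub_left]
  exact sub_nonneg.2 (e.lmo_min G z hz)

theorem run_mem (hT : T.Admissible) (s : ℕ → ℕ → p.Sample) (k : ℕ) :
    (p.run e.lmo T e.z0 s k).z ∈ p.X ×ˢ p.Y := by
  induction k with
  | zero => exact e.z0_mem
  | succ k ih =>
    rw [p.run_succ_z]
    exact p.step_mem ih (e.lmo_mem _) (hT.nonneg k _ (e.estimated_gap_nonneg ih _)) (hT.le_one k _)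

theorem iter_mem (hT : T.Admissible) (k : ℕ) (ω : e.Ω) : e.iter T k ω ∈ p.X ×ˢ p.Y :=
  e.run_mem hT _ k

theorem measurable_run (hT : T.Admissible) (k : ℕ) :
    Measurable fun s : ℕ → ℕ → p.Sample => (p.run e.lmo T e.z0 s k).z :=
  p.measurable_run e.measurable_lmo hT.measurable e.z0 k

theorem measurable_iter (hT : T.Admissible) (k : ℕ) : Measurable (e.iter T k) := by
  have h := (e.measurable_run hT k).comp e.measurable_samples
  exact h

/-- Iterate `k` is determined by the samples of rows at most `k`, the batch by row `k + 1`;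
independent families over disjoint index sets generate independent σ-algebras. -/
theorem indepFun_iter_batch (hT : T.Admissible) (k : ℕ) :
    IndepFun (e.iter T k) (e.batch (k + 1)) e.μ := by
  set m : ℕ × ℕ → MeasurableSpace e.Ω :=
    fun q => MeasurableSpace.comap (e.sample q.1 q.2) inferInstance with hm
  have hI : iIndep m e.μ := e.indep_sample
  have hdisj : Disjoint {q : ℕ × ℕ | q.1 ≤ k} {q : ℕ × ℕ | q.1 = k + 1} := by
    rw [Set.disjoint_left]
    intro q hq hq'
    simp only [Set.mem_ofPred_eq] at hq hq'
    omega
  have hind : Indep (⨆ q ∈ {q : ℕ × ℕ | q.1 ≤ k}, m q) (⨆ q ∈ {q : ℕ × ℕ | q.1 = k + 1}, m q) e.μ :=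
    indep_iSup_of_disjoint (m := m) (fun q => (e.measurable_sample q.1 q.2).comap_le) hI hdisj
  refine indep_of_indep_of_le_left (indep_of_indep_of_le_right hind ?_) ?_
  · rw [← measurable_iff_comap_le]
    refine @measurable_pi_lambda _ _ _ (_) _ _ fun j => ?_
    rw [measurable_iff_comap_le]
    exact le_iSup₂ (f := fun (q : ℕ × ℕ) (_ : q ∈ {q : ℕ × ℕ | q.1 = k + 1}) => m q)
      (k + 1, j) rfl
  · rw [← measurable_iff_comap_le]
    -- Replacing row `i` by row `min i k` leaves the first `k` iterations unchanged and shows that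
    -- only rows up to `k` are read.
    have e1 : e.iter T k = (fun s : ℕ → ℕ → p.Sample => (p.run e.lmo T e.z0 s k).z) ∘
        fun ω i j => e.sample (min i k) j ω := by
      funext ω
      refine congrArg SaddleProblem.State.z (p.run_congr fun i hi => ?_)
      funext j
      show e.sample i j ω = e.sample (min i k) j ω
      rw [min_eq_left hi]
    rw [e1]
    refine (e.measurable_run hT k).comp ?_
    refine @measurable_pi_lambda _ _ _ (_) _ _ fun i => @measurable_pi_lambda _ _ _ (_) _ _ fun j => ?_
    rw [measurable_iff_comap_le]
    exact le_iSup₂ (f := fun (q : ℕ × ℕ) (_ : q ∈ {q : ℕ × ℕ | q.1 ≤ k}) => m q)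
      (min i k, j) (min_le_right i k)

/-- An expectation over an iterate and a fresh batch is at most the supremum over fixed points. -/
theorem lintegral_iter_batch_le (hT : T.Admissible) (k : ℕ)
    {h : p.Point × (ℕ → p.Sample) → ENNReal} (hh : Measurable h) {C : ENNReal}
    (hC : ∀ z ∈ p.X ×ˢ p.Y, ∫⁻ ω, h (z, e.batch (k + 1) ω) ∂e.μ ≤ C) :
    ∫⁻ ω, h (e.iter T k ω, e.batch (k + 1) ω) ∂e.μ ≤ C := by
  have hZ := e.measurable_iter hT k
  have hB := e.measurable_batch (k + 1)
  have h1 := (indepFun_iff_map_prod_eq_prod_map_map hZ.aemeasurable hB.aemeasurable).1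
    (e.indepFun_iter_batch hT k)
  have : IsProbabilityMeasure (e.μ.map (e.batch (k + 1))) :=
    Measure.isProbabilityMeasure_map hB.aemeasurable
  rw [← lintegral_map hh (hZ.prodMk hB), h1, lintegral_prod _ hh.aemeasurable,
    lintegral_map (hh.lintegral_prod_right') hZ]
  calc ∫⁻ ω, ∫⁻ b, h (e.iter T k ω, b) ∂e.μ.map (e.batch (k + 1)) ∂e.μ ≤ ∫⁻ _, C ∂e.μ := by
        refine lintegral_mono fun ω => ?_
        have hh' : Measurable fun b => h (e.iter T k ω, b) := hh.comp measurable_prodMk_left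
        rw [lintegral_map hh' hB]
        exact hC _ (e.iter_mem hT k ω)
    _ = C := by simp

theorem indepFun_sample (k : ℕ) {i j : ℕ} (hij : i ≠ j) :
    IndepFun (e.sample k i) (e.sample k j) e.μ :=
  e.indep_sample.indepFun (i := (k, i)) (j := (k, j)) (by simpa using hij)

theorem map_sample_X (k j : ℕ) :
    e.μ.map (fun ω => ((e.sample k j ω).1, (e.sample k j ω).2.1)) =
      (stdGaussian (Euc p.dX)).prod p.P := by
  have h := (e.law_sample k j).map_eq
  have h1 : Measurable fun s : p.Sample => (s.1, s.2.1) := by fun_prop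
  have h2 : e.μ.map (fun ω => ((e.sample k j ω).1, (e.sample k j ω).2.1)) =
      (e.μ.map (e.sample k j)).map fun s : p.Sample => (s.1, s.2.1) :=
    (Measure.map_map h1 (e.measurable_sample k j)).symm
  rw [h2, h]
  exact ((MeasurePreserving.id (stdGaussian (Euc p.dX))).prod measurePreserving_fst).map_eq

theorem map_sample_Y (k j : ℕ) :
    e.μ.map (fun ω => (e.sample k j ω).2.2) = (stdGaussian (Euc p.dY)).prod p.P := by
  have h := (e.law_sample k j).map_eq
  have h1 : Measurable fun s : p.Sample => s.2.2 := by fun_prop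
  have h2 : e.μ.map (fun ω => (e.sample k j ω).2.2) =
      (e.μ.map (e.sample k j)).map fun s : p.Sample => s.2.2 :=
    (Measure.map_map h1 (e.measurable_sample k j)).symm
  rw [h2, h]
  exact ((measurePreserving_snd (μ := p.P)).comp
    (measurePreserving_snd (μ := stdGaussian (Euc p.dX)))).map_eq

theorem mse_X {z : p.Point} (hz : z ∈ p.X ×ˢ p.Y) (k : ℕ) {m : ℕ} (hm : 0 < m) {ν : ℝ}
    (hν : 0 < ν) :
    Integrable (fun ω => ‖p.estX m ν z (e.batch k ω) - p.gradX z‖ ^ 2) e.μ ∧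
      ∫ ω, ‖p.estX m ν z (e.batch k ω) - p.gradX z‖ ^ 2 ∂e.μ ≤ c.errX p.dX m ν := by
  have h := estimator_mse (P := p.P) (H := fun x ξ => p.F x z.2 ξ) (L := c.LGX) (x := z.1)
    (p.measurable_F.comp (f := fun q : Euc p.dX × p.Ξ => (q.1, z.2, q.2)) (by fun_prop))
    (by filter_upwards [p.differentiable_F_X] with ξ h using h z.2)
    (by filter_upwards [p.lipGrad_X] with ξ h x₁ x₂ using h x₁ x₂ z.2 hz.2)
    (p.integrable_gradX z.1 hz.1 z.2 hz.2) (p.norm_gradient_F_X_le hz.1 hz.2)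
    (V := fun j ω => ((e.sample k j ω).1, (e.sample k j ω).2.1))
    (fun j => (by fun_prop : Measurable fun s : p.Sample => (s.1, s.2.1)).comp
      (e.measurable_sample k j)) (fun j => e.map_sample_X k j)
    (fun i j hij => (e.indepFun_sample k hij).comp
      (φ := fun s : p.Sample => (s.1, s.2.1)) (ψ := fun s : p.Sample => (s.1, s.2.1))
      (by fun_prop) (by fun_prop)) hm hν
  rw [p.integral_gradient_X hz.1 hz.2] at h
  refine ⟨h.1, h.2.trans ?_⟩
  -- The almost sure gradient bound `LX` gives the estimate with `LX²` alone; adding `σ²` enlarges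
  -- it.
  rw [Constants.errX]
  gcongr
  exact le_add_of_nonneg_right (sq_nonneg _)

theorem mse_Y {z : p.Point} (hz : z ∈ p.X ×ˢ p.Y) (k : ℕ) {m : ℕ} (hm : 0 < m) {ν : ℝ}
    (hν : 0 < ν) :
    Integrable (fun ω => ‖p.estY m ν z (e.batch k ω) - p.gradY z‖ ^ 2) e.μ ∧
      ∫ ω, ‖p.estY m ν z (e.batch k ω) - p.gradY z‖ ^ 2 ∂e.μ ≤ c.errY p.dY m ν := by
  have h := estimator_mse (P := p.P) (H := fun y ξ => p.F z.1 y ξ) (L := c.LGY) (x := z.2)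
    (p.measurable_F.comp (f := fun q : Euc p.dY × p.Ξ => (z.1, q.1, q.2)) (by fun_prop))
    (by filter_upwards [p.differentiable_F_Y] with ξ h using h z.1)
    (by filter_upwards [p.lipGrad_Y] with ξ h y₁ y₂ using h z.1 hz.1 y₁ y₂)
    (p.integrable_gradY z.1 hz.1 z.2 hz.2) (p.norm_gradient_F_Y_le hz.1 hz.2)
    (V := fun j ω => (e.sample k j ω).2.2)
    (fun j => (by fun_prop : Measurable fun s : p.Sample => s.2.2).comp
      (e.measurable_sample k j)) (fun j => e.map_sample_Y k j)
    (fun i j hij => (e.indepFun_sample k hij).comp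
      (φ := fun s : p.Sample => s.2.2) (ψ := fun s : p.Sample => s.2.2)
      (by fun_prop) (by fun_prop)) hm hν
  rw [p.integral_gradient_Y hz.1 hz.2] at h
  refine ⟨h.1, h.2.trans ?_⟩
  rw [Constants.errY]
  gcongr
  exact le_add_of_nonneg_right (sq_nonneg _)

/-- A uniform bound for frozen `z` passes to the iterate by Fubini, in place of conditional
expectations. Lower integrals yield integrability and the bound at once; `φ` is extended by 0 to
make the integrand measurable everywhere. -/
theorem integral_iter_batch_le {E : Type*} [NormedAddCommGroup E] [MeasurableSpace E] [BorelSpace E]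
    [SecondCountableTopology E] (hT : T.Admissible) (k : ℕ)
    {g : p.Point × (ℕ → p.Sample) → E} (hg : Measurable g) {φ : p.Point → E}
    (hφ : ContinuousOn φ (p.X ×ˢ p.Y)) {C : ℝ}
    (hi : ∀ z ∈ p.X ×ˢ p.Y, Integrable (fun ω => ‖g (z, e.batch (k + 1) ω) - φ z‖ ^ 2) e.μ ∧
      ∫ ω, ‖g (z, e.batch (k + 1) ω) - φ z‖ ^ 2 ∂e.μ ≤ C) :
    Integrable (fun ω => ‖g (e.iter T k ω, e.batch (k + 1) ω) - φ (e.iter T k ω)‖ ^ 2) e.μ ∧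
      ∫ ω, ‖g (e.iter T k ω, e.batch (k + 1) ω) - φ (e.iter T k ω)‖ ^ 2 ∂e.μ ≤ C := by
  classical
  set ψ : p.Point → E := (p.X ×ˢ p.Y).piecewise φ fun _ => 0 with hψ
  have hψm : Measurable ψ :=
    hφ.measurable_piecewise continuousOn_const p.isCompact_domain.isClosed.measurableSet
  have hψe : ∀ z ∈ p.X ×ˢ p.Y, ψ z = φ z := fun z hz => Set.piecewise_eq_of_mem _ _ _ hz
  set D : p.Point × (ℕ → p.Sample) → ℝ := fun q => ‖g q - ψ q.1‖ ^ 2 with hD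
  have hDm : Measurable D := (hg.sub (hψm.comp measurable_fst)).norm.pow_const 2
  have hC0 : 0 ≤ C := (integral_nonneg fun ω => sq_nonneg _).trans (hi _ e.z0_mem).2
  have hle := e.lintegral_iter_batch_le hT k (h := fun q => ENNReal.ofReal (D q))
    hDm.ennreal_ofReal (C := ENNReal.ofReal C) (fun z hz => by
      obtain ⟨h1, h2⟩ := hi z hz
      simp only [hD, hψe z hz]
      rw [← ofReal_integral_eq_lintegral_ofReal h1 (Filter.Eventually.of_forall fun ω => sq_nonneg _)]
      exact ENNReal.ofReal_le_ofReal h2)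
  have hZB := (e.measurable_iter hT k).prodMk (e.measurable_batch (k + 1))
  have heq : (fun ω => ‖g (e.iter T k ω, e.batch (k + 1) ω) - φ (e.iter T k ω)‖ ^ 2) =
      fun ω => D (e.iter T k ω, e.batch (k + 1) ω) := by
    funext ω
    simp only [hD, hψe _ (e.iter_mem hT k ω)]
  have hm : Measurable fun ω => D (e.iter T k ω, e.batch (k + 1) ω) := hDm.comp hZB
  have hnn : ∀ ω, 0 ≤ D (e.iter T k ω, e.batch (k + 1) ω) := fun ω => sq_nonneg _
  rw [heq]
  refine ⟨⟨hm.aestronglyMeasurable, ?_⟩, ?_⟩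
  · rw [hasFiniteIntegral_iff_ofReal (Filter.Eventually.of_forall hnn)]
    exact hle.trans_lt ENNReal.ofReal_lt_top
  · rw [integral_eq_lintegral_of_nonneg_ae (Filter.Eventually.of_forall hnn)
      hm.aestronglyMeasurable]
    exact ENNReal.toReal_le_of_le_ofReal hC0 hle

/-- Mean square errors of the gradient estimates along a run. -/
theorem mse_iter_X (hT : T.Admissible) (k : ℕ) (hm : 0 < T.mX (k + 1)) (hν : 0 < T.νX) :
    Integrable (fun ω => ‖(p.op (e.iter T k ω) -
      p.est T (k + 1) (e.iter T k ω) (e.batch (k + 1) ω)).1‖ ^ 2) e.μ ∧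
    ∫ ω, ‖(p.op (e.iter T k ω) -
      p.est T (k + 1) (e.iter T k ω) (e.batch (k + 1) ω)).1‖ ^ 2 ∂e.μ ≤
        c.errX p.dX (T.mX (k + 1)) T.νX := by
  have h := e.integral_iter_batch_le hT k (p.measurable_estX (T.mX (k + 1)) T.νX)
    p.continuousOn_gradX (fun z hz => e.mse_X hz (k + 1) hm hν)
  simp_rw [norm_sub_rev] at h
  exact h

theorem mse_iter_Y (hT : T.Admissible) (k : ℕ) (hm : 0 < T.mY (k + 1)) (hν : 0 < T.νY) :
    Integrable (fun ω => ‖(p.op (e.iter T k ω) -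
      p.est T (k + 1) (e.iter T k ω) (e.batch (k + 1) ω)).2‖ ^ 2) e.μ ∧
    ∫ ω, ‖(p.op (e.iter T k ω) -
      p.est T (k + 1) (e.iter T k ω) (e.batch (k + 1) ω)).2‖ ^ 2 ∂e.μ ≤
        c.errY p.dY (T.mY (k + 1)) T.νY := by
  have h := e.integral_iter_batch_le hT k (p.measurable_estY (T.mY (k + 1)) T.νY)
    p.continuousOn_gradY (fun z hz => e.mse_Y hz (k + 1) hm hν)
  have heq : ∀ ω, (p.op (e.iter T k ω) -
      p.est T (k + 1) (e.iter T k ω) (e.batch (k + 1) ω)).2 =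
      p.estY (T.mY (k + 1)) T.νY (e.iter T k ω) (e.batch (k + 1) ω) - p.gradY (e.iter T k ω) := by
    intro ω
    simp only [SaddleProblem.op, SaddleProblem.est, Prod.snd_sub]
    abel
  simp_rw [heq]
  exact h

theorem integrable_comp_iter (hT : T.Admissible) {φ : p.Point → ℝ}
    (hφ : ContinuousOn φ (p.X ×ˢ p.Y)) (k : ℕ) : Integrable (fun ω => φ (e.iter T k ω)) e.μ := by
  obtain ⟨C, hC⟩ := p.isCompact_domain.exists_bound_of_continuousOn hφ
  exact Integrable.of_bound (p.measurable_comp_of_continuousOn hφ (e.measurable_iter hT k)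
    (e.iter_mem hT k)).aestronglyMeasurable C (Filter.Eventually.of_forall fun ω =>
      hC _ (e.iter_mem hT k ω))

/-- Expectation at a random index that is independent of the samples. -/
theorem integral_comp_iter_outputIndex (hT : T.Admissible) {φ : p.Point → ℝ}
    (hφ : ContinuousOn φ (p.X ×ˢ p.Y)) {N : ℕ} {R : e.Ω → ℕ} (hR : e.IsOutputIndex N R) :
    Integrable (fun ω => φ (e.iter T (R ω) ω)) e.μ ∧
      ∫ ω, φ (e.iter T (R ω) ω) ∂e.μ =
        ∑ k ∈ Finset.Icc 1 N, outputProb N k * ∫ ω, φ (e.iter T k ω) ∂e.μ := by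
  obtain ⟨hRm, hRN, hRP, hRI⟩ := hR
  have hset : ∀ k, MeasurableSet {ω | R ω = k} := fun k => hRm (measurableSet_singleton k)
  have heq : (fun ω => φ (e.iter T (R ω) ω)) = fun ω => ∑ k ∈ Finset.Icc 1 N,
      {ω | R ω = k}.indicator (fun _ => (1 : ℝ)) ω * φ (e.iter T k ω) := by
    funext ω
    rw [Finset.sum_eq_single (R ω)]
    · simp
    · intro k _ hk
      rw [Set.indicator_of_notMem (fun h => hk h.symm), zero_mul]
    · exact fun h => absurd (hRN ω) h
  -- The iterate is a measurable function of the whole sample array, from which `R` is independent.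
  have hind : ∀ k, IndepFun ({ω | R ω = k}.indicator fun _ => (1 : ℝ))
      (fun ω => φ (e.iter T k ω)) e.μ := by
    intro k
    have hψ : Measurable fun s : ℕ → ℕ → p.Sample => φ (p.run e.lmo T e.z0 s k).z :=
      p.measurable_comp_of_continuousOn hφ (e.measurable_run hT k) fun s => e.run_mem hT s k
    have h := hRI.comp (φ := ({k} : Set ℕ).indicator fun _ => (1 : ℝ)) (by fun_prop) hψ
    exact h
  have hi1 : ∀ k, Integrable ({ω | R ω = k}.indicator fun _ => (1 : ℝ)) e.μ := fun k =>
    (integrable_const 1).indicator (hset k)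
  have hi2 := fun k => e.integrable_comp_iter hT hφ k
  have hi : ∀ k, Integrable (fun ω => {ω | R ω = k}.indicator (fun _ => (1 : ℝ)) ω *
      φ (e.iter T k ω)) e.μ := fun k => (hind k).integrable_mul (hi1 k) (hi2 k)
  rw [heq]
  refine ⟨integrable_finsetSum _ fun k _ => hi k, ?_⟩
  rw [integral_finsetSum _ fun k _ => hi k]
  refine Finset.sum_congr rfl fun k hk => ?_
  rw [(hind k).integral_fun_mul_eq_mul_integral (hi1 k).1 (hi2 k).1,
    integral_indicator_const _ (hset k), hRP k hk]
  simp

end Execution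

/-! ### Scalar recursions -/

theorem le_of_geometric_recursion {u : ℕ → ℝ} {ρ A : ℝ} (hρ : 0 < ρ) (hρ1 : ρ ≤ 1)
    (h : ∀ k, u (k + 1) ≤ (1 - ρ) * u k + A) (k : ℕ) :
    u k ≤ (1 - ρ) ^ k * (u 0 - 1 / ρ * A) + 1 / ρ * A := by
  induction k with
  | zero => simp
  | succ k ih =>
    calc u (k + 1) ≤ (1 - ρ) * u k + A := h k
      _ ≤ (1 - ρ) * ((1 - ρ) ^ k * (u 0 - 1 / ρ * A) + 1 / ρ * A) + A :=
          add_le_add_left (mul_le_mul_of_nonneg_left ih (sub_nonneg.2 hρ1)) _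
      _ = _ := by field_simp; ring

theorem stepSize_nonneg (k : ℕ) : 0 ≤ stepSize k := by unfold stepSize; positivity

theorem stepSize_succ_le_one (k : ℕ) : stepSize (k + 1) ≤ 1 := by
  rw [stepSize, div_le_one (by positivity)]
  push_cast
  linarith [k.cast_nonneg (α := ℝ)]

/-- The factors are `(i + 2) / (i + 5)`, so the product telescopes to three factors, with `60 = 3 ·
4 · 5`. -/
theorem Gam_eq (k : ℕ) : Gam k = 60 / (((k : ℝ) + 3) * (k + 4) * (k + 5)) := by
  induction k with
  | zero => norm_num [Gam]
  | succ k ih =>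
    have : Gam (k + 1) = Gam k * (1 - stepSize (k + 1) / 2) := by
      rw [Gam, Gam, Finset.prod_Icc_succ_top (by omega)]
    rw [this, ih, stepSize]
    push_cast
    field_simp
    ring

theorem outputProb_eq {N k : ℕ} (hN : 1 ≤ N) (hk : 1 ≤ k) :
    outputProb N k = 3 * (((k : ℝ) + 3) * (k + 4)) / (N * ((N : ℝ) ^ 2 + 12 * N + 47)) := by
  have hN' : (1 : ℝ) ≤ N := by exact_mod_cast hN
  have h1 : 1 - Gam N = (N * ((N : ℝ) ^ 2 + 12 * N + 47)) / (((N : ℝ) + 3) * (N + 4) * (N + 5)) := by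
    rw [Gam_eq]; field_simp; ring
  rw [outputProb, h1, Gam_eq, Gam_eq, stepSize]
  field_simp
  ring

/-- Multiplying step `k + 1` by `(k + 4) (k + 5) (k + 6) = 60 / Γ_{k+1}` makes the `w` terms
telescope. -/
theorem weighted_sum_le_of_recursion {w g : ℕ → ℝ} {a C η : ℝ} (hC : 0 ≤ C)
    (h : ∀ k, w (k + 1) ≤ (1 - stepSize (k + 1) / 2) * w k - stepSize (k + 1) * (a / 2) * g k +
      stepSize (k + 1) ^ 2 * C + stepSize (k + 1) * η) (N : ℕ) :
    ((N : ℝ) + 3) * (N + 4) * (N + 5) * w N +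
        3 * a * ∑ k ∈ Finset.range N, ((k : ℝ) + 4) * (k + 5) * g k ≤
      60 * w 0 + C * (18 * (N : ℝ) ^ 2 + 102 * N) + 2 * η * (N * ((N : ℝ) ^ 2 + 12 * N + 47)) := by
  induction N with
  | zero => norm_num
  | succ N ih =>
    rw [Finset.sum_range_succ]
    have h1 := mul_le_mul_of_nonneg_left (h N)
      (by positivity : 0 ≤ ((N : ℝ) + 4) * (N + 5) * (N + 6))
    have e1 : stepSize (N + 1) = 6 / ((N : ℝ) + 6) := by
      rw [stepSize]; push_cast; ring
    rw [e1] at h1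
    have e2 : ((N : ℝ) + 4) * (N + 5) * (N + 6) * ((1 - 6 / ((N : ℝ) + 6) / 2) * w N -
        6 / ((N : ℝ) + 6) * (a / 2) * g N + (6 / ((N : ℝ) + 6)) ^ 2 * C + 6 / ((N : ℝ) + 6) * η) =
        ((N : ℝ) + 3) * (N + 4) * (N + 5) * w N - 3 * a * (((N : ℝ) + 4) * (N + 5) * g N) +
        36 * (((N : ℝ) + 4) * (N + 5) / (N + 6)) * C + 6 * η * (((N : ℝ) + 4) * (N + 5)) := by
      field_simp; ring
    -- Equality at `N = 0`. Summing `36 (k + 10/3)` over `k < N` gives `18 N² + 102 N`.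
    have h2 : ((N : ℝ) + 4) * (N + 5) / (N + 6) ≤ N + 10 / 3 := by
      rw [div_le_iff₀ (by positivity)]
      nlinarith [N.cast_nonneg (α := ℝ)]
    have h3 := mul_le_mul_of_nonneg_right h2 hC
    rw [e2] at h1
    push_cast
    nlinarith [h1, h3, ih]

/-- The recursion gives `g k` the weight of index `k + 1`, whereas the output `R = k` is `z_k`. The
weights increase, so realigning them costs only the last term. -/
theorem sum_shift_le {g : ℕ → ℝ} (hg : ∀ k, 0 ≤ g k) (N : ℕ) :
    ∑ k ∈ Finset.Icc 1 N, ((k : ℝ) + 3) * (k + 4) * g k ≤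
      ∑ k ∈ Finset.range N, ((k : ℝ) + 4) * (k + 5) * g k + ((N : ℝ) + 3) * (N + 4) * g N := by
  induction N with
  | zero => simpa using by linarith [hg 0]
  | succ N ih =>
    rw [Finset.sum_Icc_succ_top (by omega), Finset.sum_range_succ]
    have h : ((N : ℝ) + 3) * (N + 4) * g N ≤ ((N : ℝ) + 4) * (N + 5) * g N := by
      refine mul_le_mul_of_nonneg_right ?_ (hg N)
      nlinarith [N.cast_nonneg (α := ℝ)]
    push_cast
    nlinarith [ih, h]

theorem merit_add_gap_le_of_recursion {w g : ℕ → ℝ} {a C b : ℝ} {N : ℕ} (hN : 1 ≤ N) (ha : 0 < a)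
    (ha1 : a ≤ 1) (hC : 0 ≤ C) (hb : 0 ≤ b) (hw : ∀ k, 0 ≤ w k) (hwC : ∀ k, w k ≤ C)
    (hg : ∀ k, 0 ≤ g k) (hgC : ∀ k, a * g k ≤ 2 * C)
    (h : ∀ k, w (k + 1) ≤ (1 - stepSize (k + 1) / 2) * w k - stepSize (k + 1) * (a / 2) * g k +
      stepSize (k + 1) ^ 2 * C + stepSize (k + 1) * ((19 / 11 * C + 11 / 2 * b) / (2 * N))) :
    w N + ∑ k ∈ Finset.Icc 1 N, outputProb N k * g k ≤
      36 * C / (a * ((N : ℝ) + 5)) + 11 * b / (2 * N * a) := by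
  have hN' : (1 : ℝ) ≤ N := by exact_mod_cast hN
  set Q : ℝ := (N : ℝ) ^ 2 + 12 * N + 47 with hQ
  have hQ0 : 0 < Q := by positivity
  have hsum : ∑ k ∈ Finset.Icc 1 N, outputProb N k * g k =
      3 / (N * Q) * ∑ k ∈ Finset.Icc 1 N, ((k : ℝ) + 3) * (k + 4) * g k := by
    rw [Finset.mul_sum]
    refine Finset.sum_congr rfl fun k hk => ?_
    rw [outputProb_eq hN (Finset.mem_Icc.1 hk).1]
    ring
  have hfin : 36 * C / (a * ((N : ℝ) + 5)) + 11 * b / (2 * N * a) =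
      (36 * C / ((N : ℝ) + 5) + 11 * b / (2 * N)) / a := by
    field_simp
  rw [hfin, le_div_iff₀ ha, hsum]
  -- The polynomial inequality `hpoly` fails at `N = 1`. There `R = 1`, and the a priori bounds give
  -- `3 C` against `6 C`.
  rcases hN.eq_or_lt with rfl | hN2
  · have h1 : w 1 * a ≤ w 1 := mul_le_of_le_one_right (hw 1) ha1
    have h2 := hwC 1
    have h3 := hgC 1
    simp only [hQ, Finset.Icc_self, Finset.sum_singleton, Nat.cast_one]
    norm_num
    linarith
  · have hN2' : (2 : ℝ) ≤ N := by exact_mod_cast hN2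
    have h1 := weighted_sum_le_of_recursion hC h N
    have h2 := sum_shift_le hg N
    set S := ∑ k ∈ Finset.Icc 1 N, ((k : ℝ) + 3) * (k + 4) * g k
    set S' := ∑ k ∈ Finset.range N, ((k : ℝ) + 4) * (k + 5) * g k
    have e1 : 2 * ((19 / 11 * C + 11 / 2 * b) / (2 * N)) * (N * ((N : ℝ) ^ 2 + 12 * N + 47)) =
        (19 / 11 * C + 11 / 2 * b) * Q := by
      rw [hQ]; field_simp
    rw [e1] at h1
    have h3 : 3 * a * S ≤ 3 * a * S' + 6 * C * (((N : ℝ) + 3) * (N + 4)) := by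
      have := mul_le_mul_of_nonneg_left h2 (by positivity : 0 ≤ 3 * a)
      have := mul_le_mul_of_nonneg_left (hgC N) (by positivity : 0 ≤ 3 * (((N : ℝ) + 3) * (N + 4)))
      linarith
    have h4 : w N * a * (N * Q) ≤ ((N : ℝ) + 3) * (N + 4) * (N + 5) * w N := by
      have h5 : w N * a ≤ w N := mul_le_of_le_one_right (hw N) ha1
      have h6 := mul_le_mul_of_nonneg_right h5 (by positivity : 0 ≤ N * Q)
      have h7 := mul_le_mul_of_nonneg_left
        (show N * Q ≤ ((N : ℝ) + 3) * (N + 4) * (N + 5) by rw [hQ]; nlinarith) (hw N)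
      linarith
    -- On the left, in units of `C`: the initial merit, the squared step sizes, the noise, and the
    -- boundary term of the index shift.
    have hpoly : 60 + (18 * (N : ℝ) ^ 2 + 102 * N) + 19 / 11 * Q + 6 * (((N : ℝ) + 3) * (N + 4)) ≤
        36 * (N * Q) / (N + 5) := by
      rw [le_div_iff₀ (by positivity), hQ]
      obtain ⟨n, hn⟩ : ∃ n : ℝ, (N : ℝ) = n + 2 := ⟨N - 2, by ring⟩
      have hn0 : 0 ≤ n := by linarith
      rw [hn]
      nlinarith [pow_nonneg hn0 2, pow_nonneg hn0 3]
    have hpoly' := mul_le_mul_of_nonneg_left hpoly hC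
    have h8 := hwC 0
    have h9 : (w N + 3 / (N * Q) * S) * a * (N * Q) ≤
        (36 * C / ((N : ℝ) + 5) + 11 * b / (2 * N)) * (N * Q) := by
      have e2 : (w N + 3 / (N * Q) * S) * a * (N * Q) = w N * a * (N * Q) + 3 * a * S := by
        field_simp
      have e3 : (36 * C / ((N : ℝ) + 5) + 11 * b / (2 * N)) * (N * Q) =
          C * (36 * (N * Q) / (N + 5)) + 11 / 2 * b * Q := by
        field_simp
      rw [e2, e3]
      linarith
    exact le_of_mul_le_mul_right h9 (by positivity)

/-! ### Mean square error bounds for the tunings -/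

/-- Here `s` is the target scale (`1/N²` or `ε²`) and `a` the factor by which the batch is reduced.
One `B` of `(B l)²` cancels against the batch size; smoothing contributes the `3/4`. -/
theorem mse_bound_le {d m : ℕ} {ν v l B s a : ℝ} (hB : 1 ≤ B) (hv : v ≤ (B * l) ^ 2) (hs : 0 < s)
    (ha : 0 < a) (hm : B * (d + 5) / (s * a) ≤ m) (hν : ν ^ 2 = B * s / (2 * ((d : ℝ) + 6) ^ 3)) :
    4 * (d + 5) * v / m + 3 * ν ^ 2 / 2 * l ^ 2 * (d + 6) ^ 3 ≤ l ^ 2 * B * s * (4 * a + 3 / 4) := by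
  have hB0 : 0 < B := by linarith
  have hm0 : (0 : ℝ) < m := lt_of_lt_of_le (by positivity) hm
  rw [div_le_iff₀ (by positivity)] at hm
  have h1 : 4 * (d + 5) * v / m ≤ 4 * (l ^ 2 * B * s * a) := by
    rw [div_le_iff₀ hm0]
    have h2 := mul_le_mul_of_nonneg_left hv (by positivity : (0 : ℝ) ≤ 4 * (d + 5))
    have h3 := mul_le_mul_of_nonneg_left hm (by positivity : (0 : ℝ) ≤ 4 * (l ^ 2 * B))
    nlinarith
  have h2 : 3 * ν ^ 2 / 2 * l ^ 2 * (d + 6) ^ 3 = l ^ 2 * B * s * (3 / 4) := by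
    rw [hν]; field_simp; ring
  linarith

namespace Constants

variable (c : Constants)

theorem one_le_BX : 1 ≤ c.BX := le_max_right _ _

theorem one_le_BY : 1 ≤ c.BY := le_max_right _ _

theorem sq_add_sq_le_BX (h : 0 < c.LGX) : c.LX ^ 2 + c.σ ^ 2 ≤ (c.BX * c.LGX) ^ 2 := by
  have h1 := (div_le_iff₀ h).1 (le_max_left (√(c.LX ^ 2 + c.σ ^ 2) / c.LGX) 1)
  exact (Real.sqrt_le_iff.1 h1).2

theorem sq_add_sq_le_BY (h : 0 < c.LGY) : c.LY ^ 2 + c.σ ^ 2 ≤ (c.BY * c.LGY) ^ 2 := by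
  have h1 := (div_le_iff₀ h).1 (le_max_left (√(c.LY ^ 2 + c.σ ^ 2) / c.LGY) 1)
  exact (Real.sqrt_le_iff.1 h1).2

theorem nonadaptive_admissible (dX dY N : ℕ) : (c.nonadaptive dX dY N).Admissible where
  measurable _ := measurable_const
  nonneg _ _ _ := stepSize_nonneg _
  le_one _ _ := stepSize_succ_le_one _

theorem adaptive_admissible (hC0 : 0 < c.C0) (hC1 : 0 < c.C1) (mX mY : ℕ) (νX νY : ℝ) :
    (c.adaptive mX mY νX νY).Admissible where
  measurable _ := (measurable_id.const_mul _).min measurable_const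
  nonneg _ _ hg := le_min (by positivity) zero_le_one
  le_one _ _ := min_le_right _ _

theorem errX_nonadaptive_le (h : 0 < c.LGX) (dX dY : ℕ) {N : ℕ} (hN : 1 ≤ N) (k : ℕ) :
    c.errX dX ((c.nonadaptive dX dY N).mX k) (c.nonadaptive dX dY N).νX ≤
      19 / 4 * (c.LGX ^ 2 * c.BX / (N : ℝ) ^ 2) := by
  have hN' : (1 : ℝ) ≤ N := by exact_mod_cast hN
  have hB := c.one_le_BX
  refine (mse_bound_le (s := 1 / (N : ℝ) ^ 2) (a := 1) hB (c.sq_add_sq_le_BX h) (by positivity)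
    one_pos ?_ ?_).trans (le_of_eq (by ring))
  · refine le_trans (le_of_eq ?_) (Nat.le_ceil _)
    field_simp
  · simp only [nonadaptive]
    rw [Real.sq_sqrt (by positivity)]
    field_simp

theorem errY_nonadaptive_le (h : 0 < c.LGY) (dX dY : ℕ) {N : ℕ} (hN : 1 ≤ N) (k : ℕ) :
    c.errY dY ((c.nonadaptive dX dY N).mY k) (c.nonadaptive dX dY N).νY ≤
      19 / 4 * (c.LGY ^ 2 * c.BY / (N : ℝ) ^ 2) := by
  have hN' : (1 : ℝ) ≤ N := by exact_mod_cast hN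
  have hB := c.one_le_BY
  refine (mse_bound_le (s := 1 / (N : ℝ) ^ 2) (a := 1) hB (c.sq_add_sq_le_BY h) (by positivity)
    one_pos ?_ ?_).trans (le_of_eq (by ring))
  · refine le_trans (le_of_eq ?_) (Nat.le_ceil _)
    field_simp
  · simp only [nonadaptive]
    rw [Real.sq_sqrt (by positivity)]
    field_simp

theorem errX_adaptive_le (h : 0 < c.LGX) (d : ℕ) {ε a : ℝ} (hε : 0 < ε) (ha : 0 < a) :
    c.errX d ⌈c.BX * (d + 5) / (ε ^ 2 * a)⌉₊ (√(c.BX * ε ^ 2 / (2 * ((d : ℝ) + 6) ^ 3))) ≤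
      c.LGX ^ 2 * c.BX * ε ^ 2 * (4 * a + 3 / 4) := by
  have hB := c.one_le_BX
  exact mse_bound_le hB (c.sq_add_sq_le_BX h) (by positivity) ha (Nat.le_ceil _)
    (Real.sq_sqrt (by positivity))

theorem errY_adaptive_le (h : 0 < c.LGY) (d : ℕ) {ε a : ℝ} (hε : 0 < ε) (ha : 0 < a) :
    c.errY d ⌈c.BY * (d + 5) / (ε ^ 2 * a)⌉₊ (√(c.BY * ε ^ 2 / (2 * ((d : ℝ) + 6) ^ 3))) ≤
      c.LGY ^ 2 * c.BY * ε ^ 2 * (4 * a + 3 / 4) := by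
  have hB := c.one_le_BY
  exact mse_bound_le hB (c.sq_add_sq_le_BY h) (by positivity) ha (Nat.le_ceil _)
    (Real.sq_sqrt (by positivity))

end Constants

namespace Execution

variable {c : Constants} {p : SaddleProblem.{u} c} (e : Execution.{u, v} p)

/-! ### Expected decrease and convergence bounds -/

theorem integral_merit_nonadaptive_succ_le (hC : 0 < c.C0) {N : ℕ} (hN : 1 ≤ N) (k : ℕ) :
    ∫ ω, p.merit (e.iter (c.nonadaptive p.dX p.dY N) (k + 1) ω) ∂e.μ ≤
      (1 - stepSize (k + 1) / 2) * ∫ ω, p.merit (e.iter (c.nonadaptive p.dX p.dY N) k ω) ∂e.μ -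
        stepSize (k + 1) * (c.C0 / 2) *
          ∫ ω, p.fwGap (e.iter (c.nonadaptive p.dX p.dY N) k ω) ∂e.μ +
        stepSize (k + 1) ^ 2 * c.C1 + stepSize (k + 1) *
          ((19 / 11 * c.C1 + 11 / 2 * (c.LGX * c.BX + c.LGY * c.BY)) / (2 * N)) := by
  have hN' : (1 : ℝ) ≤ N := by exact_mod_cast hN
  have hLX := p.LGX_pos
  have hLY := p.LGY_pos
  have hBX := c.one_le_BX
  have hBY := c.one_le_BY
  set T := c.nonadaptive p.dX p.dY N with hTdef
  have hT : T.Admissible := c.nonadaptive_admissible _ _ _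
  obtain ⟨hXi, hX⟩ := e.mse_iter_X hT k (Nat.ceil_pos.2 (by positivity))
    (Real.sqrt_pos.2 (by positivity))
  obtain ⟨hYi, hY⟩ := e.mse_iter_Y hT k (Nat.ceil_pos.2 (by positivity))
    (Real.sqrt_pos.2 (by positivity))
  have hX' := hX.trans (c.errX_nonadaptive_le hLX p.dX p.dY hN (k + 1))
  have hY' := hY.trans (c.errY_nonadaptive_le hLY p.dX p.dY hN (k + 1))
  have hwi := fun k => e.integrable_comp_iter hT p.continuousOn_merit k
  have hgi := e.integrable_comp_iter hT p.continuousOn_fwGap k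
  set A : e.Ω → ℝ := fun ω => ‖(p.op (e.iter T k ω) -
      p.est T (k + 1) (e.iter T k ω) (e.batch (k + 1) ω)).1‖ with hA
  set B : e.Ω → ℝ := fun ω => ‖(p.op (e.iter T k ω) -
      p.est T (k + 1) (e.iter T k ω) (e.batch (k + 1) ω)).2‖ with hB
  set γ := stepSize (k + 1) with hγ
  have hγ0 : 0 ≤ γ := stepSize_nonneg _
  -- Parameter in Young's inequality, chosen so that the mean square error `19/4 · L² B / N²` yields
  -- exactly the coefficient `11/2`. The other half gives `19/11 · C1`, which fits into the slack of
  -- `merit_add_gap_le_of_recursion`.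
  set t : ℝ := 19 / (22 * N) with ht
  have ht0 : 0 < t := by positivity
  have young : ∀ {D L x : ℝ}, 0 < L → D * x ≤ (t * (L * D ^ 2) + (t * L)⁻¹ * x ^ 2) / 2 := by
    intro D L x hL
    have h1 : 0 ≤ (t * L)⁻¹ * (t * L * D - x) ^ 2 := by positivity
    have h2 : (t * L)⁻¹ * (t * L * D - x) ^ 2 =
        t * (L * D ^ 2) - 2 * (D * x) + (t * L)⁻¹ * x ^ 2 := by field_simp; ring
    linarith
  have hpt : ∀ ω, p.merit (e.iter T (k + 1) ω) ≤ (1 - γ / 2) * p.merit (e.iter T k ω) -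
      γ * (c.C0 / 2) * p.fwGap (e.iter T k ω) + (γ ^ 2 * c.C1 + γ * (t * c.C1)) +
      (γ / 2 * (t * c.LGX)⁻¹ * A ω ^ 2 + γ / 2 * (t * c.LGY)⁻¹ * B ω ^ 2) := by
    intro ω
    have hz := e.iter_mem hT k ω
    have h1 := p.merit_step_nonadaptive hC hz
      (e.lmo_mem (p.est T (k + 1) (e.iter T k ω) (e.batch (k + 1) ω))) (e.lmo_min _) hγ0
    have h2 : p.err (e.iter T k ω) (p.est T (k + 1) (e.iter T k ω) (e.batch (k + 1) ω)) ≤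
        t * c.C1 + ((t * c.LGX)⁻¹ * A ω ^ 2 + (t * c.LGY)⁻¹ * B ω ^ 2) / 2 := by
      have hYX := young (D := c.DX) (x := A ω) hLX
      have hYY := young (D := c.DY) (x := B ω) hLY
      have h3 : c.LGX * c.DX ^ 2 + c.LGY * c.DY ^ 2 ≤ 2 * c.C1 := by
        rw [c.two_mul_C1]
        have := mul_le_mul_of_nonneg_right c.LGX_le_LG (sq_nonneg c.DX)
        have := mul_le_mul_of_nonneg_right c.LGY_le_LG (sq_nonneg c.DY)
        linarith
      have h4 := mul_le_mul_of_nonneg_left h3 ht0.le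
      have h5 : p.err (e.iter T k ω) (p.est T (k + 1) (e.iter T k ω) (e.batch (k + 1) ω)) =
        c.DX * A ω + c.DY * B ω := rfl
      linarith
    have h3 := mul_le_mul_of_nonneg_left h2 hγ0
    have h4 : p.merit (e.iter T (k + 1) ω) = p.merit ((1 - γ) • e.iter T k ω +
      γ • e.lmo (p.est T (k + 1) (e.iter T k ω) (e.batch (k + 1) ω))) := rfl
    rw [h4]
    linarith
  have hi1 := (hwi k).const_mul (1 - γ / 2)
  have hi2 := hgi.const_mul (γ * (c.C0 / 2))
  have hi3 := hXi.const_mul (γ / 2 * (t * c.LGX)⁻¹)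
  have hi4 := hYi.const_mul (γ / 2 * (t * c.LGY)⁻¹)
  have hi5 : Integrable (fun _ : e.Ω => γ ^ 2 * c.C1 + γ * (t * c.C1)) e.μ := integrable_const _
  have hint := integral_mono (hwi (k + 1)) (((hi1.sub hi2).add hi5).add (hi3.add hi4)) hpt
  rw [integral_add' ((hi1.sub hi2).add hi5) (hi3.add hi4), integral_add' (hi1.sub hi2) hi5,
    integral_sub' hi1 hi2, integral_add' hi3 hi4, integral_const_mul, integral_const_mul,
    integral_const_mul, integral_const_mul, integral_const, probReal_univ, one_smul] at hint
  have key : ∀ {L b I : ℝ}, 0 < L → I ≤ 19 / 4 * (L ^ 2 * b / (N : ℝ) ^ 2) →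
      γ / 2 * (t * L)⁻¹ * I ≤ γ * (11 / 2 * (L * b) / (2 * N)) := by
    intro L b I hL hI
    refine (mul_le_mul_of_nonneg_left hI (by positivity)).trans (le_of_eq ?_)
    rw [ht]; field_simp; ring
  have h1 := key hLX hX'
  have h2 := key hLY hY'
  have h3 : γ * (t * c.C1) = γ * (19 / 11 * c.C1 / (2 * N)) := by
    rw [ht]; field_simp; ring
  have h4 : γ * ((19 / 11 * c.C1 + 11 / 2 * (c.LGX * c.BX + c.LGY * c.BY)) / (2 * N)) =
      γ * (19 / 11 * c.C1 / (2 * N)) + γ * (11 / 2 * (c.LGX * c.BX) / (2 * N)) +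
      γ * (11 / 2 * (c.LGY * c.BY) / (2 * N)) := by ring
  rw [h4]
  linarith

theorem integral_merit_le_C1 {T : SaddleProblem.Tuning} (hT : T.Admissible) (k : ℕ) :
    ∫ ω, p.merit (e.iter T k ω) ∂e.μ ≤ c.C1 := by
  have h := integral_mono (e.integrable_comp_iter hT p.continuousOn_merit k)
    (integrable_const c.C1) fun ω => p.merit_le_C1 (e.iter_mem hT k ω)
  simpa using h

theorem integral_merit_nonneg {T : SaddleProblem.Tuning} (hT : T.Admissible) (k : ℕ) :
    0 ≤ ∫ ω, p.merit (e.iter T k ω) ∂e.μ :=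
  integral_nonneg fun ω => p.merit_nonneg (e.iter_mem hT k ω)

/-- Convergence of the non-adaptive method. -/
theorem integral_merit_add_integral_fwGap_le (hC : 0 < c.C0) {N : ℕ} (hN : 1 ≤ N) {R : e.Ω → ℕ}
    (hR : e.IsOutputIndex N R) :
    (∫ ω, p.merit (e.iter (c.nonadaptive p.dX p.dY N) N ω) ∂e.μ) +
        (∫ ω, p.fwGap (e.iter (c.nonadaptive p.dX p.dY N) (R ω) ω) ∂e.μ) ≤
      36 * c.C1 / (c.C0 * ((N : ℝ) + 5)) +
        11 * (c.LGX * c.BX + c.LGY * c.BY) / (2 * N * c.C0) := by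
  have hT := c.nonadaptive_admissible p.dX p.dY N
  have hLX := p.LGX_pos
  have hLY := p.LGY_pos
  have hBX := c.one_le_BX
  have hBY := c.one_le_BY
  have hC1 := p.C1_pos
  rw [(e.integral_comp_iter_outputIndex hT p.continuousOn_fwGap hR).2]
  refine merit_add_gap_le_of_recursion
    (w := fun k => ∫ ω, p.merit (e.iter (c.nonadaptive p.dX p.dY N) k ω) ∂e.μ)
    (g := fun k => ∫ ω, p.fwGap (e.iter (c.nonadaptive p.dX p.dY N) k ω) ∂e.μ)
    hN hC p.C0_le_one hC1.le (by positivity) (e.integral_merit_nonneg hT)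
    (e.integral_merit_le_C1 hT) (fun k => integral_nonneg fun ω => p.fwGap_nonneg (e.iter_mem hT k ω))
    (fun k => ?_) (e.integral_merit_nonadaptive_succ_le hC hN)
  have h := integral_mono (e.integrable_comp_iter hT p.continuousOn_fwGap k)
    (integrable_const (2 * c.C1 * (2 - c.C0))) fun ω => p.fwGap_le (e.iter_mem hT k ω)
  rw [integral_const, probReal_univ, one_smul] at h
  have h2 := mul_le_mul_of_nonneg_left h hC.le
  -- `C0 (2 - C0) = 1 - (1 - C0)² ≤ 1`.
  nlinarith [mul_nonneg hC1.le (sq_nonneg (1 - c.C0))]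

theorem integral_merit_adaptive_succ_le (hC : 0 < c.C0) {mX mY : ℕ} {νX νY : ℝ} (hmX : 0 < mX)
    (hmY : 0 < mY) (hνX : 0 < νX) (hνY : 0 < νY) (k : ℕ) :
    ∫ ω, p.merit (e.iter (c.adaptive mX mY νX νY) (k + 1) ω) ∂e.μ ≤
      (1 - c.ρ) * ∫ ω, p.merit (e.iter (c.adaptive mX mY νX νY) k ω) ∂e.μ +
        c.C4 p.dX p.dY mX mY νX νY := by
  have hC1 := p.C1_pos
  have hLG := p.LG_pos
  set T := c.adaptive mX mY νX νY with hTdef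
  have hT : T.Admissible := c.adaptive_admissible hC hC1 _ _ _ _
  obtain ⟨hXi, hX⟩ := e.mse_iter_X hT k hmX hνX
  obtain ⟨hYi, hY⟩ := e.mse_iter_Y hT k hmY hνY
  have hwi := fun k => e.integrable_comp_iter hT p.continuousOn_merit k
  set A : e.Ω → ℝ := fun ω => ‖(p.op (e.iter T k ω) -
      p.est T (k + 1) (e.iter T k ω) (e.batch (k + 1) ω)).1‖ with hA
  set B : e.Ω → ℝ := fun ω => ‖(p.op (e.iter T k ω) -
      p.est T (k + 1) (e.iter T k ω) (e.batch (k + 1) ω)).2‖ with hB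
  have hpt : ∀ ω, p.merit (e.iter T (k + 1) ω) ≤
      (1 - c.ρ) * p.merit (e.iter T k ω) + c.LG⁻¹ * (A ω ^ 2 + B ω ^ 2) := by
    intro ω
    have h1 := (p.merit_step_adaptive hC (e.iter_mem hT k ω)
      (e.lmo_mem (p.est T (k + 1) (e.iter T k ω) (e.batch (k + 1) ω))) (e.lmo_min _) rfl).2.2
    -- Cauchy-Schwarz bounds the squared error by `(DX² + DY²) (A² + B²)`, and `2 C1 = LG (DX² +
    -- DY²)`. This produces `C4`.
    have h2 : p.err (e.iter T k ω) (p.est T (k + 1) (e.iter T k ω) (e.batch (k + 1) ω)) ^ 2 /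
        (2 * c.C1) ≤ c.LG⁻¹ * (A ω ^ 2 + B ω ^ 2) := by
      have h3 : p.err (e.iter T k ω) (p.est T (k + 1) (e.iter T k ω) (e.batch (k + 1) ω)) =
        c.DX * A ω + c.DY * B ω := rfl
      rw [h3, div_le_iff₀ (by positivity), c.two_mul_C1]
      have h4 : c.LG⁻¹ * (A ω ^ 2 + B ω ^ 2) * (c.LG * (c.DX ^ 2 + c.DY ^ 2)) =
          (A ω ^ 2 + B ω ^ 2) * (c.DX ^ 2 + c.DY ^ 2) := by field_simp
      rw [h4]
      nlinarith [sq_nonneg (c.DX * B ω - c.DY * A ω)]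
    exact h1.trans (add_le_add_right h2 _)
  have hi1 := (hwi k).const_mul (1 - c.ρ)
  have hi2 := (hXi.add hYi).const_mul c.LG⁻¹
  have hint := integral_mono (hwi (k + 1)) (hi1.add hi2) hpt
  rw [integral_add' hi1 hi2, integral_const_mul, integral_const_mul, integral_add' hXi hYi] at hint
  refine hint.trans (add_le_add_right ?_ _)
  rw [Constants.C4, div_eq_inv_mul]
  exact mul_le_mul_of_nonneg_left (add_le_add hX hY) (inv_nonneg.2 hLG.le)

/-- Convergence of the adaptive method, up to any error floor that is at least `C4 / ρ`. -/
theorem integral_merit_adaptive_le (hC : 0 < c.C0) {mX mY : ℕ} {νX νY : ℝ} (hmX : 0 < mX)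
    (hmY : 0 < mY) (hνX : 0 < νX) (hνY : 0 < νY) {A : ℝ} (hA : c.C4 p.dX p.dY mX mY νX νY ≤ A)
    (k : ℕ) :
    ∫ ω, p.merit (e.iter (c.adaptive mX mY νX νY) k ω) ∂e.μ ≤
      (1 - c.ρ) ^ k * (p.merit e.z0 - 1 / c.ρ * A) + 1 / c.ρ * A := by
  have h := le_of_geometric_recursion
    (u := fun k => ∫ ω, p.merit (e.iter (c.adaptive mX mY νX νY) k ω) ∂e.μ)
    (SaddleProblem.ρ_pos p hC) (by linarith [SaddleProblem.ρ_le_half p]) (A := A) (fun k =>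
      (e.integral_merit_adaptive_succ_le hC hmX hmY hνX hνY k).trans (add_le_add_right hA _)) k
  have h0 : ∫ ω, p.merit (e.iter (c.adaptive mX mY νX νY) 0 ω) ∂e.μ = p.merit e.z0 := by
    have : ∀ ω, e.iter (c.adaptive mX mY νX νY) 0 ω = e.z0 := fun _ => rfl
    simp [this]
  simpa only [h0] using h

end Execution

/-! ### Oracle complexity -/

/-- `d + 5 ≤ 6 d` costs a factor 6, and rounding up a number that is at least 1 costs a factor 2. -/
theorem ceil_batch_le {B q : ℝ} {d : ℕ} (hB : 1 ≤ B) (hd : 0 < d) (hq : 1 ≤ q) :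
    (⌈B * (d + 5) * q⌉₊ : ℝ) ≤ 12 * (B * d) * q := by
  have hd' : (1 : ℝ) ≤ d := by exact_mod_cast hd
  have h1 : 1 ≤ B * (d + 5) * q :=
    one_le_mul_of_one_le_of_one_le (one_le_mul_of_one_le_of_one_le hB (by linarith)) hq
  have h2 : B * (d + 5) * q ≤ 6 * (B * d) * q := by
    have : B * (d + 5) ≤ 6 * (B * d) := by nlinarith
    exact mul_le_mul_of_nonneg_right this (by linarith)
  linarith [(Nat.ceil_lt_add_one (by linarith : 0 ≤ B * (d + 5) * q)).le]

/-- Number of zeroth-order calls of an iteration, for batches of size `⌈B (d + 5) q⌉`. -/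
theorem batch_calls_le (c : Constants) {q : ℝ} {dX dY : ℕ} (hX : 0 < dX) (hY : 0 < dY) (hq : 1 ≤ q) :
    2 * (⌈c.BX * (dX + 5) * q⌉₊ : ℝ) + 2 * (⌈c.BY * (dY + 5) * q⌉₊ : ℝ) ≤
      24 * (c.BX + c.BY) * (dX + dY) * q := by
  have h1 := ceil_batch_le c.one_le_BX hX hq
  have h2 := ceil_batch_le c.one_le_BY hY hq
  have hBX := c.one_le_BX
  have hBY := c.one_le_BY
  have h3 : 0 ≤ c.BX * dY * q := by positivity
  have h4 : 0 ≤ c.BY * dX * q := by positivity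
  nlinarith

theorem log_le_two_mul_sqrt {x : ℝ} (hx : 0 < x) : Real.log x ≤ 2 * √x := by
  have h1 := Real.log_le_sub_one_of_pos (Real.sqrt_pos.2 hx)
  rw [Real.log_sqrt hx.le] at h1
  linarith

namespace Constants

/-- The numerator of the `O(1 / N)` rate of the non-adaptive method. -/
def nonadaptiveRate (c : Constants) : ℝ :=
  36 * c.C1 / c.C0 + 11 * (c.LGX * c.BX + c.LGY * c.BY) / (2 * c.C0)

end Constants

theorem SaddleProblem.nonadaptiveRate_pos {c : Constants} (p : SaddleProblem.{u} c) (hC : 0 < c.C0) :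
    0 < c.nonadaptiveRate := by
  have hC1 := p.C1_pos
  have hLX := p.LGX_pos
  have hLY := p.LGY_pos
  have hBX := c.one_le_BX
  have hBY := c.one_le_BY
  unfold Constants.nonadaptiveRate; positivity

namespace Execution

variable {c : Constants} {p : SaddleProblem.{u} c} (e : Execution.{u, v} p)

theorem integral_merit_add_integral_fwGap_le_div (hC : 0 < c.C0) {N : ℕ} (hN : 1 ≤ N) {R : e.Ω → ℕ}
    (hR : e.IsOutputIndex N R) :
    (∫ ω, p.merit (e.iter (c.nonadaptive p.dX p.dY N) N ω) ∂e.μ) +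
        (∫ ω, p.fwGap (e.iter (c.nonadaptive p.dX p.dY N) (R ω) ω) ∂e.μ) ≤
      c.nonadaptiveRate / N := by
  have hN' : (1 : ℝ) ≤ N := by exact_mod_cast hN
  have hC1 := p.C1_pos
  refine (e.integral_merit_add_integral_fwGap_le hC hN hR).trans ?_
  have h1 : 36 * c.C1 / (c.C0 * ((N : ℝ) + 5)) ≤ 36 * c.C1 / (c.C0 * N) := by
    gcongr; linarith
  have h2 : c.nonadaptiveRate / N = 36 * c.C1 / (c.C0 * N) +
      11 * (c.LGX * c.BX + c.LGY * c.BY) / (2 * N * c.C0) := by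
    unfold Constants.nonadaptiveRate; field_simp
  rw [h2]
  linarith

theorem integral_nashGap_le {T : SaddleProblem.Tuning} (hT : T.Admissible) {N : ℕ} {R : e.Ω → ℕ}
    (hR : e.IsOutputIndex N R) :
    Integrable (fun ω => p.nashGap (e.iter T (R ω) ω)) e.μ ∧
      ∫ ω, p.nashGap (e.iter T (R ω) ω) ∂e.μ ≤ ∫ ω, p.fwGap (e.iter T (R ω) ω) ∂e.μ := by
  have h := (e.integral_comp_iter_outputIndex hT p.continuousOn_nashGap hR).1
  exact ⟨h, integral_mono h (e.integral_comp_iter_outputIndex hT p.continuousOn_fwGap hR).1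
    fun ω => p.nashGap_le_fwGap (e.iter_mem hT _ ω)⟩

theorem nonadaptive_calls_le {N : ℕ} (hN : 1 ≤ N) (ω : e.Ω) :
    ((e.state (c.nonadaptive p.dX p.dY N) N ω).zoCalls : ℝ) ≤
        24 * (c.BX + c.BY) * (p.dX + p.dY) * (N : ℝ) ^ 3 ∧
      (e.state (c.nonadaptive p.dX p.dY N) N ω).loCalls = N := by
  have hN' : (1 : ℝ) ≤ N := by exact_mod_cast hN
  obtain ⟨h1, h2⟩ := p.run_calls (T := c.nonadaptive p.dX p.dY N) e.lmo
    (fun _ => rfl) (fun _ => rfl) e.z0 (fun i j => e.sample i j ω) N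
  refine ⟨?_, h2⟩
  rw [state, h1]
  push_cast
  have h3 := mul_le_mul_of_nonneg_left
    (batch_calls_le c p.dX_pos p.dY_pos (one_le_pow₀ hN' (n := 2))) (by linarith : (0 : ℝ) ≤ N)
  refine h3.trans (le_of_eq (by ring))

/-- Accuracy of the adaptive method after logarithmically many iterations. -/
theorem integral_merit_adaptiveFor_le (hC : 0 < c.C0) {ε a : ℝ} (hε : 0 < ε) (ha : 0 < a)
    (hfloor : (c.LGX ^ 2 * c.BX + c.LGY ^ 2 * c.BY) * (ε * (4 * a + 3 / 4)) ≤ c.ρ * c.LG / 2) {N : ℕ}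
    (hN : Real.log (2 * c.C1 / ε) / c.ρ ≤ N) :
    ∫ ω, p.merit (e.iter (c.adaptiveFor p.dX p.dY ε a) N ω) ∂e.μ ≤ ε := by
  have hC1 := p.C1_pos
  have hLX := p.LGX_pos
  have hLY := p.LGY_pos
  have hLG := p.LG_pos
  have hBX := c.one_le_BX
  have hBY := c.one_le_BY
  have hρ := p.ρ_pos hC
  have hρ2 := p.ρ_le_half
  -- Half of the accuracy is left to the error floor, hence `A = ρ ε / 2`; the number of iterations
  -- brings the geometric term below the other half.
  have h := e.integral_merit_adaptive_le hC (mX := ⌈c.BX * (p.dX + 5) / (ε ^ 2 * a)⌉₊)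
    (mY := ⌈c.BY * (p.dY + 5) / (ε ^ 2 * a)⌉₊)
    (νX := √(c.BX * ε ^ 2 / (2 * ((p.dX : ℝ) + 6) ^ 3)))
    (νY := √(c.BY * ε ^ 2 / (2 * ((p.dY : ℝ) + 6) ^ 3)))
    (Nat.ceil_pos.2 (by positivity)) (Nat.ceil_pos.2 (by positivity))
    (Real.sqrt_pos.2 (by positivity)) (Real.sqrt_pos.2 (by positivity)) (A := c.ρ * (ε / 2)) (by
      have h1 := c.errX_adaptive_le hLX p.dX hε ha
      have h2 := c.errY_adaptive_le hLY p.dY hε ha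
      rw [Constants.C4, div_le_iff₀ hLG]
      have h3 := mul_le_mul_of_nonneg_right hfloor hε.le
      linarith) N
  refine h.trans ?_
  have e1 : 1 / c.ρ * (c.ρ * (ε / 2)) = ε / 2 := by field_simp
  rw [e1]
  have h1 : (1 - c.ρ) ^ N * (p.merit e.z0 - ε / 2) ≤ (1 - c.ρ) ^ N * c.C1 :=
    mul_le_mul_of_nonneg_left (by linarith [p.merit_le_C1 e.z0_mem])
      (pow_nonneg (by linarith) N)
  have h2 : (1 - c.ρ) ^ N ≤ ε / (2 * c.C1) := by
    calc (1 - c.ρ) ^ N ≤ Real.exp (-c.ρ) ^ N :=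
          pow_le_pow_left₀ (by linarith) (Real.one_sub_le_exp_neg _) N
      _ = Real.exp (-(N * c.ρ)) := by rw [← Real.exp_nat_mul]; ring_nf
      _ ≤ Real.exp (-Real.log (2 * c.C1 / ε)) :=
          Real.exp_le_exp.2 (neg_le_neg ((div_le_iff₀ hρ).1 hN))
      _ = ε / (2 * c.C1) := by
          rw [← Real.log_inv, Real.exp_log (by positivity), inv_div]
  have h3 := mul_le_mul_of_nonneg_right h2 hC1.le
  have e2 : ε / (2 * c.C1) * c.C1 = ε / 2 := by field_simp
  linarith

theorem adaptiveFor_calls_le {ε a : ℝ} (hε : 0 < ε) (ha : 0 < a) (hεa : ε ^ 2 * a ≤ 1) (N : ℕ)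
    (ω : e.Ω) :
    ((e.state (c.adaptiveFor p.dX p.dY ε a) N ω).zoCalls : ℝ) ≤
        N * (24 * (c.BX + c.BY) * (p.dX + p.dY) / (ε ^ 2 * a)) ∧
      (e.state (c.adaptiveFor p.dX p.dY ε a) N ω).loCalls = N := by
  obtain ⟨h1, h2⟩ := p.run_calls (T := c.adaptiveFor p.dX p.dY ε a) e.lmo
    (fun _ => rfl) (fun _ => rfl) e.z0 (fun i j => e.sample i j ω) N
  refine ⟨?_, h2⟩
  rw [state, h1]
  push_cast
  have h3 := batch_calls_le c p.dX_pos p.dY_pos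
    ((one_le_inv₀ (by positivity : 0 < ε ^ 2 * a)).2 hεa)
  simp only [← div_eq_mul_inv] at h3
  exact mul_le_mul_of_nonneg_left h3 N.cast_nonneg

end Execution

/-! ### Choice of the number of iterations -/

theorem exists_nonadaptive_complexity (c : Constants) (hC0 : 0 < c.C0) :
    ∃ K : ℝ, 0 < K ∧ ∀ ε : ℝ, 0 < ε → ε ≤ 1 → ∃ N : ℕ, 1 ≤ N ∧
      ∀ (p : SaddleProblem.{u} c) (e : Execution.{u, v} p),
        (∀ R : e.Ω → ℕ, e.IsOutputIndex N R →
          (∫ ω, p.merit (e.iter (c.nonadaptive p.dX p.dY N) N ω) ∂e.μ) +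
            (∫ ω, p.fwGap (e.iter (c.nonadaptive p.dX p.dY N) (R ω) ω) ∂e.μ) ≤ ε ∧
          Integrable (fun ω => p.nashGap (e.iter (c.nonadaptive p.dX p.dY N) (R ω) ω)) e.μ ∧
          ∫ ω, p.nashGap (e.iter (c.nonadaptive p.dX p.dY N) (R ω) ω) ∂e.μ ≤ ε) ∧
        ∀ ω, ((e.state (c.nonadaptive p.dX p.dY N) N ω).zoCalls : ℝ) ≤
              K * ((p.dX : ℝ) + p.dY) / ε ^ 3 ∧
            ((e.state (c.nonadaptive p.dX p.dY N) N ω).loCalls : ℝ) ≤ K / ε := by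
  -- Without a problem having these constants the claim is vacuous; otherwise any such problem `q`
  -- supplies their signs.
  rcases isEmpty_or_nonempty (SaddleProblem.{u} c) with hE | ⟨⟨q⟩⟩
  · exact ⟨1, one_pos, fun _ _ _ => ⟨1, le_rfl, fun p => hE.elim p⟩⟩
  have hA := q.nonadaptiveRate_pos hC0
  set A := c.nonadaptiveRate with hAdef
  have hBX := c.one_le_BX
  have hBY := c.one_le_BY
  refine ⟨24 * (c.BX + c.BY) * (A + 1) ^ 3 + (A + 1), by positivity, fun ε hε hε1 =>
    ⟨⌈A / ε⌉₊, Nat.ceil_pos.2 (by positivity), fun p e => ?_⟩⟩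
  have hN : 1 ≤ ⌈A / ε⌉₊ := Nat.ceil_pos.2 (by positivity)
  have hN2 : A / ε ≤ (⌈A / ε⌉₊ : ℝ) := Nat.le_ceil _
  have hN3 : (⌈A / ε⌉₊ : ℝ) ≤ (A + 1) / ε := by
    refine (Nat.ceil_lt_add_one (by positivity)).le.trans ?_
    rw [add_div]
    have : 1 ≤ 1 / ε := (one_le_div hε).2 hε1
    linarith
  set N := ⌈A / ε⌉₊
  have hN' : (1 : ℝ) ≤ N := by exact_mod_cast hN
  refine ⟨fun R hR => ?_, fun ω => ?_⟩
  · have h1 := e.integral_merit_add_integral_fwGap_le_div hC0 hN hR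
    have h2 : A / N ≤ ε := by
      rw [div_le_iff₀ (by positivity), mul_comm]
      exact (div_le_iff₀ hε).1 hN2
    have hT := c.nonadaptive_admissible p.dX p.dY N
    obtain ⟨h3, h4⟩ := e.integral_nashGap_le hT hR
    have h5 := e.integral_merit_nonneg hT N
    exact ⟨by linarith, h3, by linarith⟩
  · obtain ⟨h1, h2⟩ := e.nonadaptive_calls_le hN ω
    constructor
    · refine h1.trans ?_
      have h3 : (N : ℝ) ^ 3 ≤ (A + 1) ^ 3 / ε ^ 3 := by
        rw [← div_pow]
        exact pow_le_pow_left₀ (by positivity) hN3 3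
      calc 24 * (c.BX + c.BY) * (p.dX + p.dY) * (N : ℝ) ^ 3
          ≤ 24 * (c.BX + c.BY) * (p.dX + p.dY) * ((A + 1) ^ 3 / ε ^ 3) := by gcongr
        _ = 24 * (c.BX + c.BY) * (A + 1) ^ 3 * (p.dX + p.dY) / ε ^ 3 := by ring
        _ ≤ _ := by gcongr; linarith
    · rw [h2]
      have h3 : 0 ≤ 24 * (c.BX + c.BY) * (A + 1) ^ 3 := by positivity
      exact hN3.trans (div_le_div_of_nonneg_right (le_add_of_nonneg_left h3) hε.le)

theorem exists_adaptive_complexity (c : Constants) (hC0 : 0 < c.C0) :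
    ∃ K ε₀ : ℝ, 0 < K ∧ 0 < ε₀ ∧ ε₀ ≤ 1 / 2 ∧ ∀ ε : ℝ, 0 < ε → ε ≤ ε₀ → ∃ N : ℕ, 1 ≤ N ∧
      ∀ (p : SaddleProblem.{u} c) (e : Execution.{u, v} p),
        ((∫ ω, p.merit (e.iter (c.adaptiveFor p.dX p.dY ε 1) N ω) ∂e.μ ≤ ε) ∧
          ∀ ω, ((e.state (c.adaptiveFor p.dX p.dY ε 1) N ω).zoCalls : ℝ) ≤
                K * ((p.dX : ℝ) + p.dY) / ε ^ 2 * Real.log (1 / ε) ∧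
              ((e.state (c.adaptiveFor p.dX p.dY ε 1) N ω).loCalls : ℝ) ≤
                K * Real.log (1 / ε)) ∧
        ((∫ ω, p.merit (e.iter (c.adaptiveFor p.dX p.dY ε (Real.log (1 / ε))) N ω) ∂e.μ ≤ ε) ∧
          ∀ ω, ((e.state (c.adaptiveFor p.dX p.dY ε (Real.log (1 / ε))) N ω).zoCalls : ℝ) ≤
                K * ((p.dX : ℝ) + p.dY) / ε ^ 2 ∧
              ((e.state (c.adaptiveFor p.dX p.dY ε (Real.log (1 / ε))) N ω).loCalls : ℝ) ≤
                K * Real.log (1 / ε)) := by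
  rcases isEmpty_or_nonempty (SaddleProblem.{u} c) with hE | ⟨⟨q⟩⟩
  · exact ⟨1, 1 / 2, one_pos, one_half_pos, le_rfl, fun _ _ _ => ⟨1, le_rfl, fun p => hE.elim p⟩⟩
  have hBX := c.one_le_BX
  have hBY := c.one_le_BY
  have hLX := q.LGX_pos
  have hLY := q.LGY_pos
  have hLG := q.LG_pos
  have hC1 := q.C1_pos
  have hρ := q.ρ_pos hC0
  set Q := c.LGX ^ 2 * c.BX + c.LGY ^ 2 * c.BY with hQdef
  have hQ : 0 < Q := by positivity
  set D : ℝ := |Real.log (2 * c.C1)| with hD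
  -- As `log (1/ε) ≥ 1/2`, the constant `D` is at most `2 D log (1/ε)`, and the 2 lost by rounding
  -- and by the extra iteration is at most `4 log (1/ε)`.
  set K₁ : ℝ := (2 * D + 1) / c.ρ + 4 with hK₁
  have hK₁0 : 0 < K₁ := by positivity
  -- For `√ε ≤ r` the floor condition `9 Q √ε ≤ ρ LG / 2` holds, hence the entry `r²` of the
  -- threshold; the entry `1/2` keeps `log (1/ε)` away from 0.
  set r : ℝ := c.ρ * c.LG / (18 * Q) with hr
  have hr0 : 0 < r := by positivity
  refine ⟨K₁ * (24 * (c.BX + c.BY) + 1), min (1 / 2) (r ^ 2), by positivity,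
    lt_min (by norm_num) (by positivity), min_le_left _ _, fun ε hε hε0 => ?_⟩
  have hε1 : ε ≤ 1 / 2 := hε0.trans (min_le_left _ _)
  have hsq : √ε ≤ r := Real.sqrt_le_iff.2 ⟨hr0.le, hε0.trans (min_le_right _ _)⟩
  have hεs : ε ≤ √ε := by
    rw [Real.le_sqrt hε.le hε.le]; nlinarith
  set l := Real.log (1 / ε) with hl
  have hl1 : 1 / 2 ≤ l := by
    have h1 : Real.log 2 ≤ l := Real.log_le_log two_pos (by rw [le_div_iff₀ hε]; linarith)
    linarith [Real.log_two_gt_d9]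
  have hl0 : 0 < l := by linarith
  -- This admits the smaller batches: the floor is linear in the mean square error, and `ε (4 l +
  -- 3/4) ≤ 9 √ε` leaves room for the logarithm.
  have hεl : ε * l ≤ 2 * √ε := by
    have h1 := mul_le_mul_of_nonneg_left (log_le_two_mul_sqrt (by positivity : 0 < 1 / ε)) hε.le
    have h2 : ε * (2 * √(1 / ε)) = 2 * √ε := by
      rw [Real.sqrt_div zero_le_one, Real.sqrt_one]
      have h3 := Real.mul_self_sqrt hε.le
      have h4 := Real.sqrt_pos.2 hε
      field_simp
      linarith
    linarith
  have hεl2 : ε ^ 2 * l ≤ 1 := by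
    have h1 := Real.log_le_sub_one_of_pos (by positivity : 0 < 1 / ε)
    have h2 := mul_le_mul_of_nonneg_left h1 (sq_nonneg ε)
    have h3 : ε ^ 2 * (1 / ε - 1) = ε - ε ^ 2 := by field_simp
    nlinarith
  have hfloor : ∀ a, ε * (4 * a + 3 / 4) ≤ 9 * √ε → Q * (ε * (4 * a + 3 / 4)) ≤ c.ρ * c.LG / 2 := by
    intro a h
    calc Q * (ε * (4 * a + 3 / 4)) ≤ Q * (9 * r) :=
          mul_le_mul_of_nonneg_left (by linarith) hQ.le
      _ = c.ρ * c.LG / 2 := by rw [hr]; field_simp; ring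
  -- The additional iteration keeps `N ≥ 1` even when the logarithm is not positive.
  have hN2 : Real.log (2 * c.C1 / ε) / c.ρ ≤ (⌈Real.log (2 * c.C1 / ε) / c.ρ⌉₊ + 1 : ℕ) := by
    push_cast
    linarith [Nat.le_ceil (Real.log (2 * c.C1 / ε) / c.ρ)]
  have hN3 : ((⌈Real.log (2 * c.C1 / ε) / c.ρ⌉₊ + 1 : ℕ) : ℝ) ≤ K₁ * l := by
    have h1 : Real.log (2 * c.C1 / ε) ≤ D + l := by
      rw [hl, div_eq_mul_one_div, Real.log_mul (by positivity) (by positivity)]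
      linarith [le_abs_self (Real.log (2 * c.C1))]
    have h2 : (⌈Real.log (2 * c.C1 / ε) / c.ρ⌉₊ : ℝ) ≤ (D + l) / c.ρ + 1 := by
      have h3 : Real.log (2 * c.C1 / ε) / c.ρ ≤ (D + l) / c.ρ := by gcongr
      have h4 : (⌈Real.log (2 * c.C1 / ε) / c.ρ⌉₊ : ℝ) ≤ ⌈(D + l) / c.ρ⌉₊ := by
        exact_mod_cast Nat.ceil_mono h3
      exact h4.trans (Nat.ceil_lt_add_one (by positivity)).le
    push_cast
    have h5 : (D + l) / c.ρ ≤ (2 * D + 1) * l / c.ρ := by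
      gcongr
      nlinarith [abs_nonneg (Real.log (2 * c.C1))]
    have h6 : K₁ * l = (2 * D + 1) * l / c.ρ + 4 * l := by rw [hK₁]; ring
    linarith
  set N := ⌈Real.log (2 * c.C1 / ε) / c.ρ⌉₊ + 1
  have hlo : (N : ℝ) ≤ K₁ * (24 * (c.BX + c.BY) + 1) * l := by
    refine hN3.trans ?_
    gcongr
    exact le_mul_of_one_le_right hK₁0.le (by linarith)
  have hzo : ∀ (p : SaddleProblem.{u} c) (a : ℝ), 0 < a →
      N * (24 * (c.BX + c.BY) * (p.dX + p.dY) / (ε ^ 2 * a)) ≤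
        K₁ * (24 * (c.BX + c.BY) + 1) * ((p.dX : ℝ) + p.dY) / ε ^ 2 * (l / a) := by
    intro p a ha
    calc N * (24 * (c.BX + c.BY) * (p.dX + p.dY) / (ε ^ 2 * a))
        ≤ K₁ * l * ((24 * (c.BX + c.BY) + 1) * (p.dX + p.dY) / (ε ^ 2 * a)) := by
          gcongr
          linarith
      _ = _ := by field_simp
  refine ⟨N, Nat.le_add_left _ _, fun p e => ⟨⟨?_, fun ω => ?_⟩, ?_, fun ω => ?_⟩⟩
  · exact e.integral_merit_adaptiveFor_le hC0 hε one_pos (hfloor 1 (by linarith)) hN2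
  · obtain ⟨h1, h2⟩ := e.adaptiveFor_calls_le hε one_pos (by nlinarith) N ω
    refine ⟨h1.trans ((hzo p 1 one_pos).trans (le_of_eq ?_)), by rw [h2]; exact hlo⟩
    rw [div_one]
  · exact e.integral_merit_adaptiveFor_le hC0 hε hl0 (hfloor l (by linarith)) hN2
  · obtain ⟨h1, h2⟩ := e.adaptiveFor_calls_le hε hl0 hεl2 N ω
    refine ⟨h1.trans ((hzo p l hl0).trans (le_of_eq ?_)), by rw [h2]; exact hlo⟩
    rw [div_self hl0.ne', mul_one]

end

/-! ### The two convergence theorems -/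

theorem mainTheorem5 (c : Constants) (hC0 : 0 < c.C0) :
    -- (a) non-adaptive step size: explicit bound
    (∀ (p : SaddleProblem.{u} c) (e : Execution.{u, v} p) (N : ℕ), 1 ≤ N →
      ∀ R : e.Ω → ℕ, e.IsOutputIndex N R →
        Integrable (fun ω => p.merit (e.iter (c.nonadaptive p.dX p.dY N) N ω)) e.μ ∧
        Integrable (fun ω => p.fwGap (e.iter (c.nonadaptive p.dX p.dY N) (R ω) ω)) e.μ ∧
        (∫ ω, p.merit (e.iter (c.nonadaptive p.dX p.dY N) N ω) ∂e.μ) +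
            (∫ ω, p.fwGap (e.iter (c.nonadaptive p.dX p.dY N) (R ω) ω) ∂e.μ) ≤
          120 * p.merit e.z0 / ((N : ℝ) + 3) ^ 3 +
            18 * c.LG * (c.DX ^ 2 + c.DY ^ 2) / (c.C0 * ((N : ℝ) + 5)) +
            11 * (c.LGX * c.BX + c.LGY * c.BY) / (2 * N * c.C0)) ∧
    -- (a) non-adaptive step size: oracle complexity
    (∃ K : ℝ, 0 < K ∧ ∀ ε : ℝ, 0 < ε → ε ≤ 1 → ∃ N : ℕ, 1 ≤ N ∧
      ∀ (p : SaddleProblem.{u} c) (e : Execution.{u, v} p),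
        (∀ R : e.Ω → ℕ, e.IsOutputIndex N R →
          (∫ ω, p.merit (e.iter (c.nonadaptive p.dX p.dY N) N ω) ∂e.μ) +
            (∫ ω, p.fwGap (e.iter (c.nonadaptive p.dX p.dY N) (R ω) ω) ∂e.μ) ≤ ε ∧
          Integrable (fun ω => p.nashGap (e.iter (c.nonadaptive p.dX p.dY N) (R ω) ω)) e.μ ∧
          ∫ ω, p.nashGap (e.iter (c.nonadaptive p.dX p.dY N) (R ω) ω) ∂e.μ ≤ ε) ∧
        ∀ ω, ((e.state (c.nonadaptive p.dX p.dY N) N ω).zoCalls : ℝ) ≤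
              K * ((p.dX : ℝ) + p.dY) / ε ^ 3 ∧
            ((e.state (c.nonadaptive p.dX p.dY N) N ω).loCalls : ℝ) ≤ K / ε) ∧
    -- (b) adaptive step size: geometric decrease up to an error floor
    (∀ (p : SaddleProblem.{u} c) (e : Execution.{u, v} p) (mX mY : ℕ) (νX νY : ℝ),
      0 < mX → 0 < mY → 0 < νX → 0 < νY → ∀ k : ℕ,
        Integrable (fun ω => p.merit (e.iter (c.adaptive mX mY νX νY) k ω)) e.μ ∧
        ∫ ω, p.merit (e.iter (c.adaptive mX mY νX νY) k ω) ∂e.μ ≤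
          (1 - c.ρ) ^ k * (p.merit e.z0 - 1 / c.ρ *
              (max (c.C2 p.dX p.dY mX mY νX νY) (c.C3 p.dX p.dY mX mY νX νY) +
                c.C4 p.dX p.dY mX mY νX νY)) +
            1 / c.ρ * (max (c.C2 p.dX p.dY mX mY νX νY) (c.C3 p.dX p.dY mX mY νX νY) +
              c.C4 p.dX p.dY mX mY νX νY)) ∧
    -- (b) adaptive step size: oracle complexity, with batches of order `d / ε²` and with batches of
    -- order `d / (ε² log (1 / ε))`
    (∃ K ε₀ : ℝ, 0 < K ∧ 0 < ε₀ ∧ ε₀ ≤ 1 / 2 ∧ ∀ ε : ℝ, 0 < ε → ε ≤ ε₀ → ∃ N : ℕ, 1 ≤ N ∧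
      ∀ (p : SaddleProblem.{u} c) (e : Execution.{u, v} p),
        ((∫ ω, p.merit (e.iter (c.adaptiveFor p.dX p.dY ε 1) N ω) ∂e.μ ≤ ε) ∧
          ∀ ω, ((e.state (c.adaptiveFor p.dX p.dY ε 1) N ω).zoCalls : ℝ) ≤
                K * ((p.dX : ℝ) + p.dY) / ε ^ 2 * Real.log (1 / ε) ∧
              ((e.state (c.adaptiveFor p.dX p.dY ε 1) N ω).loCalls : ℝ) ≤
                K * Real.log (1 / ε)) ∧
        ((∫ ω, p.merit (e.iter (c.adaptiveFor p.dX p.dY ε (Real.log (1 / ε))) N ω) ∂e.μ ≤ ε) ∧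
          ∀ ω, ((e.state (c.adaptiveFor p.dX p.dY ε (Real.log (1 / ε))) N ω).zoCalls : ℝ) ≤
                K * ((p.dX : ℝ) + p.dY) / ε ^ 2 ∧
              ((e.state (c.adaptiveFor p.dX p.dY ε (Real.log (1 / ε))) N ω).loCalls : ℝ) ≤
                K * Real.log (1 / ε))) := by
  refine ⟨fun p e N hN R hR => ?_, exists_nonadaptive_complexity c hC0,
    fun p e mX mY νX νY hmX hmY hνX hνY k => ⟨?_, ?_⟩, exists_adaptive_complexity c hC0⟩
  · have hT := c.nonadaptive_admissible p.dX p.dY N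
    refine ⟨e.integrable_comp_iter hT p.continuousOn_merit N,
      (e.integral_comp_iter_outputIndex hT p.continuousOn_fwGap hR).1,
      (e.integral_merit_add_integral_fwGap_le hC0 hN hR).trans ?_⟩
    have h1 : 36 * c.C1 / (c.C0 * ((N : ℝ) + 5)) =
        18 * c.LG * (c.DX ^ 2 + c.DY ^ 2) / (c.C0 * ((N : ℝ) + 5)) := by
      rw [mul_assoc 18, ← c.two_mul_C1]
      ring
    -- The bound holds without this term, since the initial merit was already absorbed through `w ≤
    -- C1`.
    have h2 : 0 ≤ 120 * p.merit e.z0 / ((N : ℝ) + 3) ^ 3 := by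
      have := p.merit_nonneg e.z0_mem
      positivity
    rw [h1, add_assoc]
    exact le_add_of_nonneg_left h2
  · exact e.integrable_comp_iter (c.adaptive_admissible hC0 p.C1_pos mX mY νX νY)
      p.continuousOn_merit k
  · refine e.integral_merit_adaptive_le hC0 hmX hmY hνX hνY (le_add_of_nonneg_left ?_) k
    -- The floor `C4` alone suffices; the maximum only enlarges it, being at least `C3 ≥ 0`.
    refine le_max_of_le_right ?_
    have := p.DX_pos
    have := p.DY_pos
    unfold Constants.C3
    positivity
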